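/- Conventions. For $m\ge 1$ let $Z=(Z_1,\dots,Z_m)$ and $\zeta=(\zeta_1,\dots,\zeta_m)$. A bar over a power series means conjugation of its coefficients. A formal real hypersurface $M\subset\mathbb C^m$ (through $0$) is an ideal $I\subset\mathbb C[[Z,\zeta]]$ generated by one series $\rho$ (a defining function) with $\rho(0)=0$, $\bar\rho(\zeta,Z)\in I$ and $\rho_Z(0)\ne 0$. It is Levi-nondegenerate if the form $(u,v)\mapsto\sum_{j,k}\rho_{Z_j\zeta_k}(0)u_j\bar v_k$ is nondegenerate on $\{u\in\mathbb C^m:\rho_Z(0)u=0\}$. It is real-analytic (algebraic) if $\rho$ can be chosen convergent near $0$ (algebraic over the polynomials $\mathbb C[Z,\zeta]$). Coordinates $Z=(z,w)$, $\zeta=(\chi,\tau)$ in $\mathbb C^{n}\times\mathbb C$ are normal for $M$ if $I$ is generated by $w-Q(z,\chi,\tau)$ for a formal series $Q$ with $Q(z,0,\tau)=Q(0,\chi,\tau)=\tau$. A formal holomorphic map $H:(\mathbb C^N,0)\to(\mathbb C^{N'},0)$ is an $N'$-tuple of series in $\mathbb C[[Z]]$ without constant term. It maps $M$ (ideal $I$)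 into $M'$ (ideal $I'$, defining function $\rho'$), written $H:M\to M'$, if $\phi(H(Z),\bar H(\zeta))\in I$ for all $\phi\in I'$; it is transversal if $\rho'(H(Z),\bar H(\zeta))$ generates $I$. Let $E\subset\mathbb C[[Z,\zeta]]^{N'}$ be the submodule spanned by all $L_1\cdots L_r\,\rho'_{Z'}(H(Z),\bar H(\zeta))$, where $r\ge 0$ and $L_1,\dots,L_r$ are formal vector fields $\sum_j b_j(Z,\zeta)\,\partial/\partial\zeta_j$ that map $I$ into $I$. $H$ is constantly $s$-degenerate if $\dim_{\mathbb C}E(0)=N'-s$ and every minor of length $N'-s+1$ formed from elements of $E$ lies in $I$. Proposition. Let $M\subset\mathbb C^N$ and $M'\subset\mathbb C^{N+1}$ be Levi-nondegenerate formal real hypersurfaces, and let $Z=(z,w)$, $\zeta=(\chi,\tau)$ be normal coordinates for $M$, whose ideal is $I$. Let $\Lambda$ be a complex $(N+1)\times N$ matrix. Then there is a formal function $$\Psi:\mathbb C^N\times\mathbb C^N\times\mathbb C^{N+1}\times\mathbb C^{N+1}\times\mathbb C^{N(N+1)}\times\mathbb C^{N(N+1)}\to\mathbb C^{N+1}$$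 (an $(N+1)$-tuple of formal power series), depending only on $M$, $M'$ and $\Lambda$, such that for every transversal, constantly $1$-degenerate formal holomorphic map $H:M\to M'$ with $\partial H(0)=\Lambda$, all components of $$H(Z)-\Psi\bigl(Z,\zeta,\bar H(\zeta),H(\zeta),\partial\bar H(\zeta)-\partial\bar H(0),\partial H(0,\tau)-\partial H(0)\bigr)$$ lie in $I$, where $\partial H$ denotes the matrix of all first partial derivatives. If $M$ and $M'$ are real-analytic, then this $\Psi$ is convergent on a neighbourhood of the origin. If $M$ and $M'$ are algebraic, then this $\Psi$ is algebraic (over the polynomials in its variables). -/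

import Mathlib

namespace FormalCR

open MvPowerSeries

noncomputable section

/-- The ring `ℂ⟦Z, ζ⟧` in twice as many indeterminates as there are indices in `ι`;
`X (Sum.inl j)` is `Z_j` and `X (Sum.inr j)` is `ζ_j`. -/
abbrev Series2 (ι : Type) : Type := MvPowerSeries (ι ⊕ ι) ℂ

/-- The series with complex conjugate coefficients. -/
def conj {σ : Type} (f : MvPowerSeries σ ℂ) : MvPowerSeries σ ℂ :=
  MvPowerSeries.map (starRingEnd ℂ) f

/-- `h(Z)`, seen in `ℂ⟦Z, ζ⟧`. -/
def inZ {ι : Type} (h : MvPowerSeries ι ℂ) : Series2 ι :=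
  subst (fun j : ι => (X (Sum.inl j) : Series2 ι)) h

/-- `h(ζ)`, seen in `ℂ⟦Z, ζ⟧`. -/
def inZeta {ι : Type} (h : MvPowerSeries ι ℂ) : Series2 ι :=
  subst (fun j : ι => (X (Sum.inr j) : Series2 ι)) h

/-- The involution `φ(Z, ζ) ↦ φ̄(ζ, Z)` of `ℂ⟦Z, ζ⟧`. -/
def reflect {ι : Type} (φ : Series2 ι) : Series2 ι :=
  subst (Sum.elim (fun j : ι => (X (Sum.inr j) : Series2 ι))
    (fun j : ι => (X (Sum.inl j) : Series2 ι))) (conj φ)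

/-- `ρ` is a (formal) defining function, at the origin, of the real hypersurface represented by
the ideal `I`: it generates `I`, vanishes at the origin, satisfies the reality condition
`ρ̄(ζ, Z) ∈ I`, and its complex gradient at the origin is not zero. -/
structure IsDefiningFunction {ι : Type} (I : Ideal (Series2 ι)) (ρ : Series2 ι) : Prop where
  generates : I = Ideal.span {ρ}
  zero_mem : constantCoeff ρ = 0
  real : reflect ρ ∈ I
  gradient_ne_zero : ∃ j : ι, constantCoeff (pderiv ℂ (Sum.inl j) ρ) ≠ 0

/-- A formal real hypersurface through the origin of `ℂ^ι`. -/
structure FormalHypersurface (ι : Type) where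
  ideal : Ideal (Series2 ι)
  exists_definingFunction : ∃ ρ, IsDefiningFunction ideal ρ

/-- Membership of a vector in the complex tangent space at the origin of `{ρ = 0}`. -/
def IsComplexTangent {ι : Type} [Fintype ι] (ρ : Series2 ι) (v : ι → ℂ) : Prop :=
  ∑ j, constantCoeff (pderiv ℂ (Sum.inl j) ρ) * v j = 0

/-- The Levi form at the origin of the defining function `ρ`. -/
def leviForm {ι : Type} [Fintype ι] (ρ : Series2 ι) (u v : ι → ℂ) : ℂ :=
  ∑ j, ∑ k, constantCoeff (pderiv ℂ (Sum.inl j) (pderiv ℂ (Sum.inr k) ρ)) * u j *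
    starRingEnd ℂ (v k)

/-- Levi-nondegeneracy at the origin: for a defining function, the Levi form on the complex
tangent space has trivial kernel. -/
def FormalHypersurface.LeviNondegenerate {ι : Type} [Fintype ι] (M : FormalHypersurface ι) :
    Prop :=
  ∃ ρ, IsDefiningFunction M.ideal ρ ∧
    ∀ u : ι → ℂ, IsComplexTangent ρ u →
      (∀ v : ι → ℂ, IsComplexTangent ρ v → leviForm ρ u v = 0) → u = 0

/-- A power series that converges (absolutely) on a neighbourhood of the origin. -/
def IsConvergent {σ : Type} (f : MvPowerSeries σ ℂ) : Prop :=
  ∃ r : ℝ, 0 < r ∧ Summable fun α : σ →₀ ℕ => ‖coeff α f‖ * r ^ α.degree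

/-- A power series that is algebraic over the polynomials in the same indeterminates. -/
def IsAlgebraicSeries {σ : Type} (f : MvPowerSeries σ ℂ) : Prop :=
  IsAlgebraic (MvPolynomial σ ℂ) f

/-- A real-analytic hypersurface: it has a convergent defining function. -/
def FormalHypersurface.RealAnalytic {ι : Type} (M : FormalHypersurface ι) : Prop :=
  ∃ ρ, IsDefiningFunction M.ideal ρ ∧ IsConvergent ρ

/-- An algebraic hypersurface: it has an algebraic defining function. -/
def FormalHypersurface.Algebraic {ι : Type} (M : FormalHypersurface ι) : Prop :=
  ∃ ρ, IsDefiningFunction M.ideal ρ ∧ IsAlgebraicSeries ρ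

/-! ### Normal coordinates

In `ℂ^{n+1}` the coordinates are `Z = (z, w)` with `z_j = Z_{j.castSucc}` and `w = Z_{last}`, and
`ζ = (χ, τ)` is split in the same way. Series `Q(z, χ, τ)` use the index type
`Fin n ⊕ Fin n ⊕ Unit`. -/

/-- `Q(z, χ, τ)`, seen in `ℂ⟦Z, ζ⟧`. -/
def normalSubst {n : ℕ} (Q : MvPowerSeries (Fin n ⊕ Fin n ⊕ Unit) ℂ) : Series2 (Fin (n + 1)) :=
  subst (Sum.elim (fun j : Fin n => (X (Sum.inl j.castSucc) : Series2 (Fin (n + 1))))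
    (Sum.elim (fun j : Fin n => (X (Sum.inr j.castSucc) : Series2 (Fin (n + 1))))
      (fun _ : Unit => (X (Sum.inr (Fin.last n)) : Series2 (Fin (n + 1)))))) Q

/-- `Q(z, 0, τ) = Q(0, χ, τ) = τ`. -/
def IsNormal {n : ℕ} (Q : MvPowerSeries (Fin n ⊕ Fin n ⊕ Unit) ℂ) : Prop :=
  let A := MvPowerSeries (Fin n ⊕ Fin n ⊕ Unit) ℂ
  let τ : A := X (Sum.inr (Sum.inr ()))
  subst (Sum.elim (fun j : Fin n => (X (Sum.inl j) : A))
      (Sum.elim (fun _ : Fin n => (0 : A)) (fun _ : Unit => τ))) Q = τ ∧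
    subst (Sum.elim (fun _ : Fin n => (0 : A))
      (Sum.elim (fun j : Fin n => (X (Sum.inr (Sum.inl j)) : A)) (fun _ : Unit => τ))) Q = τ

/-- The coordinates `(z, w)` of `ℂ^{n+1}` are normal for `M`: the ideal of `M` is generated by
`w - Q(z, χ, τ)` for some `Q` with `Q(z, 0, τ) = Q(0, χ, τ) = τ`. -/
def FormalHypersurface.InNormalCoordinates {n : ℕ} (M : FormalHypersurface (Fin (n + 1))) :
    Prop :=
  ∃ Q : MvPowerSeries (Fin n ⊕ Fin n ⊕ Unit) ℂ, IsNormal Q ∧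
    M.ideal = Ideal.span {X (Sum.inl (Fin.last n)) - normalSubst Q}

/-! ### Formal maps -/

/-- A formal holomorphic map `(ℂ^ι, 0) → (ℂ^κ, 0)`. -/
structure FormalMap (ι κ : Type) where
  toFun : κ → MvPowerSeries ι ℂ
  map_zero : ∀ i, constantCoeff (toFun i) = 0

/-- The pullback `φ(Z′, ζ′) ↦ φ(H(Z), H̄(ζ))`. -/
def FormalMap.sharp {ι κ : Type} (H : FormalMap ι κ) (φ : Series2 κ) : Series2 ι :=
  subst (Sum.elim (fun i : κ => inZ (H.toFun i)) (fun i : κ => inZeta (conj (H.toFun i)))) φ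

/-- `H` maps `M` into `M′`. -/
def FormalMap.MapsInto {ι κ : Type} (H : FormalMap ι κ) (M : FormalHypersurface ι)
    (M' : FormalHypersurface κ) : Prop :=
  ∀ φ ∈ M'.ideal, H.sharp φ ∈ M.ideal

/-- `H` is transversal: the pullback of a defining function of `M′` generates the ideal of
`M`. -/
def FormalMap.Transversal {ι κ : Type} (H : FormalMap ι κ) (M : FormalHypersurface ι)
    (M' : FormalHypersurface κ) : Prop :=
  ∃ ρ', IsDefiningFunction M'.ideal ρ' ∧ Ideal.span {H.sharp ρ'} = M.ideal

/-- The first derivative `∂H(0)`, with entries `∂H_i/∂Z_j (0)`. -/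
def FormalMap.derivAtZero {ι κ : Type} (H : FormalMap ι κ) : Matrix κ ι ℂ :=
  fun i j => constantCoeff (pderiv ℂ j (H.toFun i))

/-! ### Degeneracy -/

/-- The formal vector field `∑ b_j ∂/∂ζ_j` of type `(0,1)`. -/
def field01 {ι : Type} [Fintype ι] (b : ι → Series2 ι) (φ : Series2 ι) : Series2 ι :=
  ∑ j, b j * pderiv ℂ (Sum.inr j) φ

/-- The field `∑ b_j ∂/∂ζ_j` is tangent to `M`, that is, a formal CR vector field on `M`. -/
def IsCRField {ι : Type} [Fintype ι] (M : FormalHypersurface ι) (b : ι → Series2 ι) : Prop :=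
  ∀ φ ∈ M.ideal, field01 b φ ∈ M.ideal

/-- The submodule `E` of `ℂ⟦Z, ζ⟧^κ` spanned by the vectors `L_1 ⋯ L_r ρ′_{Z′}(H(Z), H̄(ζ))`,
where `r ≥ 0` and `L_1, …, L_r` are formal CR vector fields on `M`. -/
def degeneracyModule {ι κ : Type} [Fintype ι] (M : FormalHypersurface ι) (H : FormalMap ι κ)
    (ρ' : Series2 κ) : Submodule (Series2 ι) (κ → Series2 ι) :=
  Submodule.span (Series2 ι)
    {v | ∃ L : List (ι → Series2 ι), (∀ b ∈ L, IsCRField M b) ∧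
      v = fun i => L.foldr field01 (H.sharp (pderiv ℂ (Sum.inl i) ρ'))}

/-- The space `E(0)` of the values at the origin of the elements of `E`. -/
def valueAtZero {ι κ : Type} (E : Submodule (Series2 ι) (κ → Series2 ι)) :
    Submodule ℂ (κ → ℂ) :=
  Submodule.span ℂ ((fun (e : κ → Series2 ι) (i : κ) => constantCoeff (e i)) '' E)

/-- `E` is of constant rank `l` over `I`: `l = dim E(0)` and all minors of length `l + 1` formed
from elements of `E` belong to `I`. -/
def IsConstantRank {ι κ : Type} (I : Ideal (Series2 ι))
    (E : Submodule (Series2 ι) (κ → Series2 ι)) (l : ℕ) : Prop :=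
  Module.finrank ℂ (valueAtZero E) = l ∧
    ∀ e : Fin (l + 1) → κ → Series2 ι, (∀ a, e a ∈ E) → ∀ c : Fin (l + 1) → κ,
      (Matrix.of fun a b => e a (c b)).det ∈ I

/-- `H : M → M′` has constant degeneracy `s`: `E` is of constant rank `N′ - s` over the ideal
of `M`, where `N′` is the dimension of the target space. -/
def FormalMap.ConstantlyDegenerate {ι κ : Type} [Fintype ι] [Fintype κ] (H : FormalMap ι κ)
    (M : FormalHypersurface ι) (M' : FormalHypersurface κ) (s : ℕ) : Prop :=
  ∃ ρ', IsDefiningFunction M'.ideal ρ' ∧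
    ∃ l : ℕ, l + s = Fintype.card κ ∧ IsConstantRank M.ideal (degeneracyModule M H ρ') l

/-! ### The arguments of the basic identity -/

/-- `h(0, τ)`, seen in `ℂ⟦Z, ζ⟧`. -/
def atZeroTau {n : ℕ} (h : MvPowerSeries (Fin (n + 1)) ℂ) : Series2 (Fin (n + 1)) :=
  subst (Fin.lastCases (X (Sum.inr (Fin.last n))) (fun _ => 0) :
    Fin (n + 1) → Series2 (Fin (n + 1))) h

/-- The indeterminates of `Ψ`, a formal function on
`ℂ^N × ℂ^N × ℂ^{N+1} × ℂ^{N+1} × ℂ^{N(N+1)} × ℂ^{N(N+1)}`, where `N = n + 1`. -/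
abbrev PsiVar (n : ℕ) : Type :=
  Fin (n + 1) ⊕ Fin (n + 1) ⊕ Fin (n + 2) ⊕ Fin (n + 2) ⊕
    (Fin (n + 2) × Fin (n + 1)) ⊕ (Fin (n + 2) × Fin (n + 1))

/-- The arguments
`(Z, ζ, H̄(ζ), H(ζ), ∂H̄(ζ) - ∂H̄(0), ∂H(0,τ) - ∂H(0))`. -/
def psiArgs {n : ℕ} (H : FormalMap (Fin (n + 1)) (Fin (n + 2))) :
    PsiVar n → Series2 (Fin (n + 1)) :=
  Sum.elim (fun j => X (Sum.inl j)) <|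
  Sum.elim (fun j => X (Sum.inr j)) <|
  Sum.elim (fun i => inZeta (conj (H.toFun i))) <|
  Sum.elim (fun i => inZeta (H.toFun i)) <|
  Sum.elim
    (fun p => inZeta (pderiv ℂ p.2 (conj (H.toFun p.1))) - C (starRingEnd ℂ (H.derivAtZero p.1 p.2)))
    (fun p => atZeroTau (pderiv ℂ p.2 (H.toFun p.1)) - C (H.derivAtZero p.1 p.2))

/-- All components of
`H(Z) - Ψ(Z, ζ, H̄(ζ), H(ζ), ∂H̄(ζ) - ∂H̄(0), ∂H(0,τ) - ∂H(0))`
belong to the ideal of `M`. -/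
def BasicIdentity {n : ℕ} (M : FormalHypersurface (Fin (n + 1)))
    (Ψ : Fin (n + 2) → MvPowerSeries (PsiVar n) ℂ)
    (H : FormalMap (Fin (n + 1)) (Fin (n + 2))) : Prop :=
  ∀ i, inZ (H.toFun i) - subst (psiArgs H) (Ψ i) ∈ M.ideal

end

end FormalCR

namespace FormalCR

open MvPowerSeries

noncomputable section

/-! Write M as w = Q(z,χ,τ), let ρ define M′, and put U = H(z,Q), h = H̄(χ,τ). Besides ρ(U,h) = 0
there are n equations obtained from it by the fields Q_τ ∂_{χ_j} − Q_{χ_j} ∂_τ, which annihilate z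
and Q: they say that ρ_{ζ′}(U,h) is orthogonal to vectors built from ∂H̄ (`sum_crRow`). The last
equation comes from the degeneracy. In the coordinates (z,χ,τ), and after a reflection, CR
derivatives are plain z-derivatives. So every z-derivative of ρ_{ζ′}(U,h) at z = 0 is dependent on
ρ_{ζ′} and its n first z-derivatives there. The generalized cross product W of these n+1 rows does
not involve z and is orthogonal to all Taylor coefficients in z, hence to ρ_{ζ′}(U,h) itself
(`realizes_of_degenerate`). Levi-nondegeneracy and transversality make the n+2 equations for U
nonsingular at the origin (`IsModel.jacobian_injective`), and the implicit function theorem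
expresses U through h and the annihilated vectors (`exists_base_solution`).

The difficulty is that W involves H(0,τ), which is not an argument of Ψ. It has to be recovered from
the other arguments. At χ = τ = 0 the system shows that H(z,0) depends on the data only
(`slice_eq_of_realizes`). Its χ-derivatives there show that H_w(z,0) is determined by the data up to
adding κD(z), with one vector D and a constant κ (`exists_direction`). On τ = 0, at points χ =
ξ(z,t) with Q(z,ξ,0) = z_{j₀}t, the system yields H(z, z_{j₀}t) = G(z,t,κ̄t). An interpolation
argument undoes the blow-up w = z_{j₀}t, so that all maps are specializations H = F(z,w,κ̄w) of a
single F (`exists_interpolation`, `exists_family`). As D has a nonzero first derivative at 0, the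
product κ̄τ can be solved from ∂H(0,τ), and H(0,τ) = F(0,τ,κ̄τ) (`exists_trace`). If n = 0, then M
is w = τ and H(ζ) itself serves as H(Z).

One and the same Ψ must be convergent or algebraic according to the data. Therefore every
construction stays inside an axiomatic class of series (`IsTame`), both regularity classes are shown
to satisfy the axioms, and Ψ is taken in the smallest such class containing Q and a canonical ρ. The
family F is built around one reference map, whose H_w(z,0) is as regular as the data
(`Realizes.isTame_transverse`). -/

abbrev Ser (σ : Type) : Type := MvPowerSeries σ ℂ

/-! ### Substitution, the chain rule, and setting indeterminates to zero. -/

section Substitution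

variable {σ τ υ : Type}

theorem hs [Finite σ] {a : σ → Ser τ} (h : ∀ i, constantCoeff (a i) = 0) : HasSubst a :=
  hasSubst_of_constantCoeff_zero h

theorem constantCoeff_subst_zero [Finite σ] {a : σ → Ser τ} (h : ∀ i, constantCoeff (a i) = 0)
    (f : Ser σ) : constantCoeff (subst a f) = constantCoeff f := by
  have h1 : subst a (f - C (constantCoeff f)) = subst a f - C (constantCoeff f) := by
    rw [subst_sub (hs h), subst_C]
  have h2 : constantCoeff (subst a (f - C (constantCoeff f))) = 0 :=
    constantCoeff_subst_eq_zero (hs h) h (by simp)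
  rw [h1] at h2
  simpa [sub_eq_zero] using h2

theorem subst_subst [Finite σ] [Finite τ] {a : σ → Ser τ} {b : τ → Ser υ}
    (ha : ∀ i, constantCoeff (a i) = 0) (hb : ∀ i, constantCoeff (b i) = 0) (f : Ser σ) :
    subst b (subst a f) = subst (fun i => subst b (a i)) f :=
  subst_comp_subst_apply (hs ha) (hs hb) f

theorem subst_X_eq (f : Ser σ) : subst (fun i => (X i : Ser σ)) f = f :=
  congrFun (subst_self (R := ℂ)) f

/-- Substituting series without constant term cannot lower the order. Hence a coefficient of a
composite sees only a polynomial truncation of the outer series. -/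
theorem subst_eq_zero_of_degree_lt [Finite σ] {a : σ → Ser τ}
    (ha : ∀ i, constantCoeff (a i) = 0) {g : Ser σ} {N : ℕ}
    (hg : ∀ d : σ →₀ ℕ, d.degree < N → coeff d g = 0) {e : τ →₀ ℕ} (he : e.degree < N) :
    coeff e (subst a g) = 0 := by
  rw [coeff_subst (hs ha), finsum_eq_zero_of_forall_eq_zero]
  intro d
  by_cases hd : d.degree < N
  · simp [hg d hd]
  · have : coeff e (d.prod fun s e => a s ^ e) = 0 := by
      apply coeff_of_lt_order
      refine lt_of_lt_of_le (Nat.cast_lt.mpr (lt_of_lt_of_le he (not_lt.mp hd))) ?_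
      rw [Finsupp.prod, Finsupp.degree_apply]
      refine le_trans ?_ (le_order_prod _ _)
      push_cast
      exact Finset.sum_le_sum fun i _ => le_order_pow_of_constantCoeff_eq_zero _ (ha i)
    simp [this]

theorem exists_polynomial_add (f : Ser σ) [Finite σ] (N : ℕ) :
    ∃ (p : MvPolynomial σ ℂ) (g : Ser σ), f = p + g ∧
      ∀ d : σ →₀ ℕ, d.degree < N → coeff d g = 0 := by
  refine ⟨truncTotal N f, f - truncTotal N f, by ring, fun d hd => ?_⟩
  rw [map_sub, MvPolynomial.coeff_coe, coeff_truncTotal _ hd, sub_self]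

/-- For polynomials this is an induction. A general series is a polynomial plus a tail of high
order, which does not reach the coefficient under consideration. -/
theorem pderiv_subst [Fintype σ] {a : σ → Ser τ} (ha : ∀ i, constantCoeff (a i) = 0) (t : τ)
    (f : Ser σ) :
    pderiv ℂ t (subst a f) = ∑ i, subst a (pderiv ℂ i f) * pderiv ℂ t (a i) := by
  classical
  have poly : ∀ p : MvPolynomial σ ℂ, pderiv ℂ t (subst a (p : Ser σ)) =
      ∑ i, subst a (pderiv ℂ i (p : Ser σ)) * pderiv ℂ t (a i) := by
    intro p
    simp only [pderiv_coe, subst_coe]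
    induction p using MvPolynomial.induction_on with
    | C c => simp [MvPowerSeries.algebraMap_apply]
    | add p q hp hq => simp [hp, hq, add_mul, Finset.sum_add_distrib]
    | mul_X p j hp =>
      simp only [map_mul, MvPolynomial.aeval_X, Derivation.leibniz, smul_eq_mul, hp,
        map_add, add_mul, Finset.sum_add_distrib,
        MvPolynomial.pderiv_X, Finset.mul_sum]
      congr 1
      · rw [Finset.sum_eq_single j]
        · simp
        · intro b _ hb; simp [Pi.single_eq_of_ne hb.symm]
        · simp
      · exact Finset.sum_congr rfl fun i _ => by ring
  ext e
  -- The coefficient at `e` of a derivative is read in degree |e| + 1, and differentiating the tail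
  -- lowers its order by one. Both effects are harmless if the tail starts in degree |e| + 2.
  obtain ⟨p, g, rfl, hg⟩ := exists_polynomial_add f (e.degree + 2)
  have h1 : coeff e (pderiv ℂ t (subst a g)) = 0 := by
    rw [coeff_pderiv, subst_eq_zero_of_degree_lt ha hg (by simp), zero_mul]
  have h2 : ∀ i, coeff e (subst a (pderiv ℂ i g) * pderiv ℂ t (a i)) = 0 := by
    intro i
    rw [coeff_mul]
    refine Finset.sum_eq_zero fun x hx => ?_
    rw [subst_eq_zero_of_degree_lt (N := e.degree + 1) ha, zero_mul]
    · intro d hd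
      rw [coeff_pderiv, hg _ (by simpa using hd), zero_mul]
    · rw [Finset.HasAntidiagonal.mem_antidiagonal] at hx
      rw [← hx, map_add]; omega
  simp only [subst_add (hs ha), map_add, add_mul, Finset.sum_add_distrib, poly, h1, add_zero]
  simp [map_sum, h2]

/-- Setting the variables in `S` to zero. -/
def kill [DecidableEq σ] (S : Finset σ) (f : Ser σ) : Ser σ :=
  subst (fun s => if s ∈ S then 0 else (X s : Ser σ)) f

theorem kill_const [DecidableEq σ] (S : Finset σ) (s : σ) :
    constantCoeff (if s ∈ S then 0 else (X s : Ser σ)) = 0 := by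
  split_ifs <;> simp

theorem kill_empty [DecidableEq σ] (f : Ser σ) : kill ∅ f = f := by
  simpa [kill] using subst_X_eq f

theorem kill_kill [DecidableEq σ] [Finite σ] (S T : Finset σ) (f : Ser σ) :
    kill S (kill T f) = kill (S ∪ T) f := by
  unfold kill
  rw [subst_subst (kill_const T) (kill_const S)]
  congr 1
  funext s
  by_cases h : s ∈ T
  · simp only [h, if_true, Finset.mem_union, or_true]
    rw [← coe_substAlgHom (hs (kill_const S)), map_zero]
  · by_cases h' : s ∈ S <;> simp [h, h', subst_X (hs (kill_const S))]

theorem coeff_kill [DecidableEq σ] [Finite σ] (s : σ) (f : Ser σ) {m : σ →₀ ℕ} (hm : m s = 0) :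
    coeff m (kill {s} f) = coeff m f := by
  unfold kill
  have key : ∀ d : σ →₀ ℕ, (d.prod fun i e => (if i ∈ ({s} : Finset σ) then 0 else (X i : Ser σ)) ^ e)
      = if d s = 0 then monomial d 1 else 0 := by
    intro d
    split_ifs with h
    · rw [monomial_one_eq]
      refine Finsupp.prod_congr fun i hi => ?_
      have : i ≠ s := by rintro rfl; simp [h] at hi
      simp [this]
    · apply Finset.prod_eq_zero (i := s) (by simpa using h)
      simp [h]
  rw [coeff_subst (hs (kill_const _)), finsum_eq_single _ m]
  · rw [key, if_pos hm]; simp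
  · intro d hd
    rw [key]
    split_ifs
    · rw [coeff_monomial_ne hd.symm, smul_zero]
    · simp

theorem X_dvd_of_kill [DecidableEq σ] [Finite σ] {s : σ} {f : Ser σ} (h : kill {s} f = 0) :
    (X s : Ser σ) ∣ f := by
  rw [X_dvd_iff]
  intro m hm
  rw [← coeff_kill s f hm, h, map_zero]

theorem X_dvd_sub_kill [DecidableEq σ] [Finite σ] (s : σ) (f : Ser σ) :
    (X s : Ser σ) ∣ f - kill {s} f := by
  apply X_dvd_of_kill
  have : kill {s} (f - kill {s} f) = kill {s} f - kill {s} (kill {s} f) :=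
    subst_sub (hs (kill_const _)) _ _
  rw [this, kill_kill]
  simp

end Substitution

end

end FormalCR

namespace FormalCR

open MvPowerSeries

noncomputable section

/-! ### Difference quotients of power series. -/

section Difference

variable {σ τ : Type}

theorem subst_zero' [Finite σ] {a : σ → Ser τ} (ha : ∀ i, constantCoeff (a i) = 0) :
    subst a (0 : Ser σ) = 0 := by
  rw [← coe_substAlgHom (hs ha), map_zero]

theorem subst_sum [Finite σ] {a : σ → Ser τ} (ha : ∀ i, constantCoeff (a i) = 0) {ι : Type*}
    (s : Finset ι) (f : ι → Ser σ) : subst a (∑ i ∈ s, f i) = ∑ i ∈ s, subst a (f i) := by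
  rw [← coe_substAlgHom (hs ha), map_sum]

theorem subst_C' (a : σ → Ser τ) (c : ℂ) : subst a (C c : Ser σ) = C c := subst_C c

/-- The substitution `x_s ↦ x_s + u`. -/
def shift [DecidableEq σ] (s : σ) (i : σ) : Ser (σ ⊕ Unit) :=
  X (Sum.inl i) + if i = s then X (Sum.inr ()) else 0

theorem shift_const [DecidableEq σ] (s i : σ) : constantCoeff (shift s i) = 0 := by
  unfold shift; split_ifs <;> simp

theorem elim_const {κ : Type} {a : σ → Ser τ} {b : κ → Ser τ} (ha : ∀ i, constantCoeff (a i) = 0)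
    (hb : ∀ i, constantCoeff (b i) = 0) (i : σ ⊕ κ) : constantCoeff (Sum.elim a b i) = 0 := by
  cases i <;> simp [ha, hb]

theorem X_const (s : σ) : constantCoeff (X s : Ser σ) = 0 := by simp

/-- The derivative is the value at u = 0 of the difference quotient. In this form differentiation is
a substitution, a division by an indeterminate and another substitution, so a class closed under
these is closed under derivatives. -/
theorem exists_shift_eq [DecidableEq σ] [Finite σ] (s : σ) (f : Ser σ) :
    ∃ K : Ser (σ ⊕ Unit), subst (shift s) f =
        subst (fun i => (X (Sum.inl i) : Ser (σ ⊕ Unit))) f + X (Sum.inr ()) * K ∧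
      subst (Sum.elim (fun i => (X i : Ser σ)) (fun _ => 0)) K = pderiv ℂ s f := by
  have := Fintype.ofFinite σ
  have hsh := shift_const s
  have hl : ∀ i : σ, constantCoeff (X (Sum.inl i) : Ser (σ ⊕ Unit)) = 0 := fun i => by simp
  have h0 : ∀ i : σ ⊕ Unit, constantCoeff (Sum.elim (fun i => (X i : Ser σ)) (fun _ => 0) i) = 0 :=
    elim_const (fun _ => by simp) (fun _ => by simp)
  obtain ⟨K, hK⟩ := X_dvd_sub_kill (Sum.inr ()) (subst (shift s) f)
  have hk : kill {Sum.inr ()} (subst (shift s) f) =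
      subst (fun i => (X (Sum.inl i) : Ser (σ ⊕ Unit))) f := by
    unfold kill
    rw [subst_subst hsh (kill_const _)]
    congr 1
    funext i
    unfold shift
    rw [subst_add (hs (kill_const _)), subst_X (hs (kill_const _))]
    by_cases h : i = s
    · simp only [h, if_true, subst_X (hs (kill_const _))]; simp
    · simp only [h, if_false, subst_zero' (kill_const _)]; simp
  rw [hk, sub_eq_iff_eq_add'] at hK
  refine ⟨K, hK, ?_⟩
  have h1 := congrArg (fun g => subst (Sum.elim (fun i => (X i : Ser σ)) (fun _ => 0))
    (pderiv ℂ (Sum.inr ()) g)) hK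
  simp only [map_add, pderiv_subst hsh, pderiv_subst hl, Derivation.leibniz, pderiv_X_self,
    smul_eq_mul] at h1
  have e1 : ∀ i, pderiv ℂ (Sum.inr ()) (shift s i) = if i = s then 1 else 0 := by
    intro i; unfold shift; split_ifs <;> simp
  simp only [e1, mul_ite, mul_one, mul_zero, Finset.sum_ite_eq', Finset.mem_univ, if_true] at h1
  rw [subst_subst hsh h0] at h1
  have e2 : (fun i => subst (Sum.elim (fun i => (X i : Ser σ)) (fun _ => 0)) (shift s i)) =
      fun i => X i := by
    funext i
    unfold shift
    rw [subst_add (hs h0), subst_X (hs h0)]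
    split_ifs <;> simp [subst_X (hs h0), subst_zero' h0]
  rw [e2, subst_X_eq] at h1
  rw [h1]
  simp [subst_add (hs h0), subst_mul (hs h0), subst_X (hs h0)]

theorem exists_update_sub [DecidableEq σ] [Finite σ] [Finite τ] (s : σ) (f : Ser σ) {a : σ → Ser τ}
    {y : Ser τ} (ha : ∀ i, constantCoeff (a i) = 0) (hy : constantCoeff y = 0) :
    ∃ k : Ser τ, subst (Function.update a s y) f - subst a f = (y - a s) * k ∧
      constantCoeff k = constantCoeff (pderiv ℂ s f) := by
  obtain ⟨K, hK, hK'⟩ := exists_shift_eq s f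
  have h0 : ∀ i : σ ⊕ Unit, constantCoeff (Sum.elim (fun i => (X i : Ser σ)) (fun _ => 0) i) = 0 :=
    elim_const (fun _ => by simp) (fun _ => by simp)
  have hb : ∀ i : σ ⊕ Unit, constantCoeff (Sum.elim a (fun _ => y - a s) i) = 0 :=
    elim_const ha (fun _ => by simp [ha, hy])
  have hl : ∀ i : σ, constantCoeff (X (Sum.inl i) : Ser (σ ⊕ Unit)) = 0 := fun i => by simp
  refine ⟨subst (Sum.elim a (fun _ => y - a s)) K, ?_, ?_⟩
  · have h1 := congrArg (subst (Sum.elim a (fun _ => y - a s))) hK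
    rw [subst_add (hs hb), subst_mul (hs hb), subst_subst (shift_const s) hb, subst_subst hl hb,
      subst_X (hs hb)] at h1
    have e1 : (fun i => subst (Sum.elim a (fun _ => y - a s)) (shift s i)) =
        Function.update a s y := by
      funext i
      unfold shift
      rw [subst_add (hs hb), subst_X (hs hb)]
      by_cases h : i = s
      · subst h; simp [subst_X (hs hb)]
      · simp [h, subst_zero' hb]
    have e2 : (fun i => subst (Sum.elim a (fun _ => y - a s)) (X (Sum.inl i) : Ser (σ ⊕ Unit))) =
        a := by
      funext i
      rw [subst_X (hs hb)]; simp
    rw [e1, e2] at h1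
    rw [h1]; simp
  · rw [constantCoeff_subst_zero hb, ← hK', constantCoeff_subst_zero h0]

/-- Hadamard's lemma, obtained by changing the arguments one at a time. The constant terms of the
quotients form the gradient at the origin, which is how Jacobians enter uniqueness arguments. -/
theorem exists_subst_sub [Fintype σ] [Finite τ] (f : Ser σ) {a b : σ → Ser τ}
    (ha : ∀ i, constantCoeff (a i) = 0) (hb : ∀ i, constantCoeff (b i) = 0) :
    ∃ K : σ → Ser τ, subst a f - subst b f = ∑ i, (a i - b i) * K i ∧
      ∀ i, constantCoeff (K i) = constantCoeff (pderiv ℂ i f) := by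
  classical
  have key : ∀ S : Finset σ, ∃ K : σ → Ser τ,
      subst (fun i => if i ∈ S then a i else b i) f - subst b f = ∑ i ∈ S, (a i - b i) * K i ∧
      ∀ i, constantCoeff (K i) = constantCoeff (pderiv ℂ i f) := by
    intro S
    induction S using Finset.induction_on with
    | empty => exact ⟨fun i => C (constantCoeff (pderiv ℂ i f)), by simp, by simp⟩
    | insert s S hs' ih =>
      obtain ⟨K, hK, hK'⟩ := ih
      obtain ⟨k, hk, hk'⟩ := exists_update_sub (a := fun i => if i ∈ S then a i else b i) s f
        (fun i => by split_ifs <;> simp [ha, hb]) (ha s)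
      have e : Function.update (fun i => if i ∈ S then a i else b i) s (a s) =
          fun i => if i ∈ insert s S then a i else b i := by
        funext i
        by_cases h : i = s
        · subst h; simp
        · simp [h]
      refine ⟨Function.update K s k, ?_, ?_⟩
      · rw [Finset.sum_insert hs', Function.update_self]
        have : ∑ i ∈ S, (a i - b i) * Function.update K s k i = ∑ i ∈ S, (a i - b i) * K i := by
          refine Finset.sum_congr rfl fun i hi => ?_
          rw [Function.update_of_ne (by rintro rfl; exact hs' hi)]
        rw [this, ← hK, ← e]
        simp only [hs', if_false] at hk
        linear_combination hk
      · intro i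
        by_cases h : i = s
        · subst h; simp [hk']
        · simp [h, hK']
  simpa using key Finset.univ

theorem subst_sub_mem [Finite σ] [Finite τ] (f : Ser σ) {a b : σ → Ser τ}
    (ha : ∀ i, constantCoeff (a i) = 0) (hb : ∀ i, constantCoeff (b i) = 0) {I : Ideal (Ser τ)}
    (h : ∀ i, a i - b i ∈ I) : subst a f - subst b f ∈ I := by
  have := Fintype.ofFinite σ
  obtain ⟨K, hK, -⟩ := exists_subst_sub f ha hb
  rw [hK]
  exact Ideal.sum_mem _ fun i _ => I.mul_mem_right _ (h i)

end Difference

/-! ### The formal implicit function theorem in one unknown. -/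

section ImplicitFunction

variable {σ τ : Type}

theorem exists_coeff_eq (φ : (σ →₀ ℕ) → ℂ) : ∃ g : Ser σ, ∀ e, coeff e g = φ e :=
  ⟨φ, fun _ => rfl⟩

theorem coeff_mul_eq_zero {f g : Ser σ} {m : ℕ}
    (hf : ∀ e : σ →₀ ℕ, e.degree < m → coeff e f = 0) (hg : constantCoeff g = 0) (e : σ →₀ ℕ)
    (he : e.degree < m + 1) : coeff e (f * g) = 0 := by
  classical
  rw [coeff_mul]
  refine Finset.sum_eq_zero fun x hx => ?_
  rw [Finset.HasAntidiagonal.mem_antidiagonal] at hx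
  by_cases h : x.1.degree < m
  · rw [hf _ h, zero_mul]
  · have : x.2 = 0 := by
      rw [← Finsupp.degree_eq_zero_iff]
      have := congrArg Finsupp.degree hx
      rw [map_add] at this
      omega
    rw [this, coeff_zero_eq_constantCoeff_apply, hg, mul_zero]

/-- Contraction for the degree filtration: `k` has no linear term in the unknown, so the difference
quotient has no constant term and one more degree of agreement is gained. -/
theorem sub_subst_coeff [Finite σ] [Finite τ] {k : Ser (σ ⊕ Unit)} {a : σ → Ser τ} {y y' : Ser τ}
    (ha : ∀ i, constantCoeff (a i) = 0)
    (hk : constantCoeff (pderiv ℂ (Sum.inr ()) k) = 0) (hy : constantCoeff y = 0)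
    (hy' : constantCoeff y' = 0) {m : ℕ} (h : ∀ e : τ →₀ ℕ, e.degree < m → coeff e y = coeff e y')
    (e : τ →₀ ℕ) (he : e.degree < m + 1) :
    coeff e (subst (Sum.elim a (fun _ => y)) k) = coeff e (subst (Sum.elim a (fun _ => y')) k) := by
  classical
  obtain ⟨κ, hκ, hκ'⟩ := exists_update_sub (Sum.inr ()) k (a := Sum.elim a (fun _ => y'))
    (y := y) (elim_const ha (fun _ => hy')) hy
  have e1 : Function.update (Sum.elim a (fun _ => y')) (Sum.inr ()) y = Sum.elim a (fun _ => y) := by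
    funext i
    rcases i with i | i <;> simp [Function.update]
  rw [e1] at hκ
  rw [← sub_eq_zero, ← map_sub, hκ]
  exact coeff_mul_eq_zero (fun e he => by simp [h e he]) (hκ'.trans hk) e he

/-- The Picard iterates of the fixed point problem `y = k(x, y)`. -/
def picard (k : Ser (σ ⊕ Unit)) : ℕ → Ser σ
  | 0 => 0
  | m + 1 => subst (Sum.elim (fun i => (X i : Ser σ)) (fun _ => picard k m)) k

theorem picard_const [Finite σ] {k : Ser (σ ⊕ Unit)} (hk : constantCoeff k = 0) (m : ℕ) :
    constantCoeff (picard k m) = 0 := by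
  induction m with
  | zero => simp [picard]
  | succ m ih => rw [picard, constantCoeff_subst_zero (elim_const X_const (fun _ => ih)), hk]

theorem coeff_picard [Finite σ] {k : Ser (σ ⊕ Unit)} (hk : constantCoeff k = 0)
    (hk' : constantCoeff (pderiv ℂ (Sum.inr ()) k) = 0) {g : Ser σ} (hg : constantCoeff g = 0)
    (h : subst (Sum.elim (fun i => (X i : Ser σ)) (fun _ => g)) k = g) (m : ℕ) (e : σ →₀ ℕ)
    (he : e.degree < m) : coeff e g = coeff e (picard k m) := by
  induction m generalizing e with
  | zero => omega
  | succ m ih =>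
    rw [picard, ← sub_subst_coeff X_const hk' hg (picard_const hk m) ih e he, h]

/-- The Picard iterates stabilize degree by degree. The fixed point takes its coefficient of degree
d from iterate d + 1. -/
theorem exists_fixed_point [Finite σ] {k : Ser (σ ⊕ Unit)} (hk : constantCoeff k = 0)
    (hk' : constantCoeff (pderiv ℂ (Sum.inr ()) k) = 0) :
    ∃ g : Ser σ, constantCoeff g = 0 ∧
      subst (Sum.elim (fun i => (X i : Ser σ)) (fun _ => g)) k = g := by
  have step : ∀ m (e : σ →₀ ℕ), e.degree < m → coeff e (picard k m) = coeff e (picard k (m + 1)) := by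
    intro m
    induction m with
    | zero => intro e he; omega
    | succ m ih =>
      intro e he
      rw [picard, picard]
      exact sub_subst_coeff X_const hk' (picard_const hk m) (picard_const hk _) ih e he
  have stab : ∀ m n (e : σ →₀ ℕ), e.degree < m → m ≤ n →
      coeff e (picard k m) = coeff e (picard k n) := by
    intro m n e he hmn
    induction n, hmn using Nat.le_induction with
    | base => rfl
    | succ n hn ih => rw [ih, step n e (by omega)]
  obtain ⟨g, hg0⟩ := exists_coeff_eq fun e : σ →₀ ℕ => coeff e (picard k (e.degree + 1))
  have hgm : ∀ m (e : σ →₀ ℕ), e.degree < m → coeff e g = coeff e (picard k m) := by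
    intro m e he
    rw [hg0]
    exact stab _ _ e (by omega) (by omega)
  have hg : constantCoeff g = 0 := by
    rw [← coeff_zero_eq_constantCoeff_apply, hgm 1 0 (by simp), coeff_zero_eq_constantCoeff_apply,
      picard_const hk]
  refine ⟨g, hg, ?_⟩
  ext e
  rw [hgm (e.degree + 1 + 1) e (by omega), picard]
  exact sub_subst_coeff X_const hk' hg (picard_const hk _) (hgm _) e (by omega)

theorem exists_implicit [Finite σ] {f : Ser (σ ⊕ Unit)} (hf : constantCoeff f = 0)
    (hf' : constantCoeff (pderiv ℂ (Sum.inr ()) f) ≠ 0) :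
    ∃ g : Ser σ, constantCoeff g = 0 ∧
      subst (Sum.elim (fun i => (X i : Ser σ)) (fun _ => g)) f = 0 := by
  set c := constantCoeff (pderiv ℂ (Sum.inr ()) f) with hc
  -- Newton's method with frozen derivative: a fixed point of y − f/c is a zero of f, and dividing
  -- by c cancels the linear term in y.
  obtain ⟨g, hg, h⟩ := exists_fixed_point (k := X (Sum.inr ()) - C c⁻¹ * f) (by simp [hf])
    (by simp [← hc, hf'])
  refine ⟨g, hg, ?_⟩
  have he : ∀ i, constantCoeff (Sum.elim (fun i => (X i : Ser σ)) (fun _ : Unit => g) i) = 0 :=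
    elim_const X_const (fun _ => hg)
  rw [subst_sub (hs he), subst_X (hs he), subst_mul (hs he), subst_C'] at h
  simp only [Sum.elim_inr, sub_eq_self] at h
  have hC : (C c⁻¹ : Ser σ) ≠ 0 := by
    intro h0
    have := congrArg constantCoeff h0
    simp at this
    exact hf' this
  exact (mul_eq_zero.mp h).resolve_left hC

end ImplicitFunction

/-! ### Uniqueness of implicit solutions. -/

section Uniqueness

variable {σ τ : Type}

theorem isUnit_of_constantCoeff {f : Ser σ} (h : constantCoeff f ≠ 0) : IsUnit f :=
  isUnit_iff_constantCoeff.mpr (isUnit_iff_ne_zero.mpr h)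

theorem det_constantCoeff {ι : Type*} [Fintype ι] [DecidableEq ι] (M : Matrix ι ι (Ser σ)) :
    constantCoeff M.det = (M.map (constantCoeff (σ := σ) (R := ℂ))).det :=
  RingHom.map_det _ M

theorem mulVec_eq_zero_of_injective {ι : Type*} [Fintype ι] [DecidableEq ι]
    {M : Matrix ι ι (Ser σ)}
    (hM : ∀ u : ι → ℂ, (∀ i, ∑ j, constantCoeff (M i j) * u j = 0) → u = 0)
    {x : ι → Ser σ} (hx : ∀ i, ∑ j, M i j * x j = 0) : x = 0 := by
  have hdet : M.det ≠ 0 := by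
    intro h
    have h1 := det_constantCoeff M
    rw [h, map_zero] at h1
    obtain ⟨u, hu, hu'⟩ := Matrix.exists_mulVec_eq_zero_iff.mpr h1.symm
    exact hu (hM u fun i => congrFun hu' i)
  exact Matrix.eq_zero_of_mulVec_eq_zero hdet (funext hx)

/-- By Hadamard's lemma the difference of two solutions lies in the kernel of a matrix whose
constant term is the Jacobian. The determinant of this matrix is a nonzero element of a domain. -/
theorem implicit_unique [Finite σ] [Finite τ] {m : ℕ} {F : Fin m → Ser (σ ⊕ Fin m)}
    (hF : ∀ u : Fin m → ℂ,
      (∀ i, ∑ j, constantCoeff (pderiv ℂ (Sum.inr j) (F i)) * u j = 0) → u = 0)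
    {a : σ → Ser τ} {b b' : Fin m → Ser τ} (ha : ∀ i, constantCoeff (a i) = 0)
    (hb : ∀ i, constantCoeff (b i) = 0) (hb' : ∀ i, constantCoeff (b' i) = 0)
    (h : ∀ i, subst (Sum.elim a b) (F i) = 0) (h' : ∀ i, subst (Sum.elim a b') (F i) = 0) :
    b = b' := by
  have := Fintype.ofFinite σ
  choose K hK hK' using fun i => exists_subst_sub (F i) (elim_const ha hb) (elim_const ha hb')
  rw [← sub_eq_zero]
  apply mulVec_eq_zero_of_injective (M := fun i j => K i (Sum.inr j))
  · simpa only [hK'] using hF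
  · intro i
    have h1 := hK i
    rw [h, h', sub_zero, Fintype.sum_sum_type] at h1
    simp only [Sum.elim_inl, sub_self, zero_mul, Finset.sum_const_zero, zero_add,
      Sum.elim_inr] at h1
    rw [h1]
    exact Finset.sum_congr rfl fun j _ => by simp [mul_comm]

end Uniqueness

end

end FormalCR

namespace FormalCR

open MvPowerSeries

noncomputable section

/-! ### Axioms for regularity classes, and their first consequences. -/

/-- A class of power series that is stable under the ring operations, substitution, conjugation,
division by an indeterminate, blowing down, and the implicit function theorem. -/
structure IsTame (P : ∀ σ : Type, Ser σ → Prop) : Prop where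
  const : ∀ {σ : Type} (c : ℂ), P σ (C c)
  var : ∀ {σ : Type} (s : σ), P σ (X s)
  add : ∀ {σ : Type} {f g : Ser σ}, P σ f → P σ g → P σ (f + g)
  mul : ∀ {σ : Type} {f g : Ser σ}, P σ f → P σ g → P σ (f * g)
  comp : ∀ {σ τ : Type} [Finite σ] [Finite τ] {a : σ → Ser τ} {f : Ser σ},
    (∀ i, constantCoeff (a i) = 0) → (∀ i, P τ (a i)) → P σ f → P τ (subst a f)
  conj : ∀ {σ : Type} {f : Ser σ}, P σ f → P σ (FormalCR.conj f)
  of_X_mul : ∀ {σ : Type} [Finite σ] (s : σ) {f : Ser σ}, P σ (X s * f) → P σ f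
  of_blowup : ∀ {σ : Type} [Finite σ] [DecidableEq σ] {s t : σ} {f : Ser σ}, s ≠ t →
    P σ (subst (Function.update (fun i => (X i : Ser σ)) t (X s * X t)) f) → P σ f
  implicit : ∀ {σ : Type} [Finite σ] {f : Ser (σ ⊕ Unit)} {g : Ser σ}, constantCoeff g = 0 →
    constantCoeff (pderiv ℂ (Sum.inr ()) f) ≠ 0 →
    subst (Sum.elim (fun i => (X i : Ser σ)) (fun _ => g)) f = 0 → P _ f → P σ g

namespace IsTame

variable {P : ∀ σ : Type, Ser σ → Prop} (hP : IsTame P) {σ τ : Type}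
include hP

theorem zero : P σ 0 := by simpa using hP.const (σ := σ) 0

theorem one : P σ 1 := by simpa using hP.const (σ := σ) 1

theorem neg {f : Ser σ} (hf : P σ f) : P σ (-f) := by
  have := hP.mul (hP.const (-1)) hf
  simpa using this

theorem sub {f g : Ser σ} (hf : P σ f) (hg : P σ g) : P σ (f - g) := by
  rw [sub_eq_add_neg]; exact hP.add hf (hP.neg hg)

theorem sum {ι : Type*} {s : Finset ι} {f : ι → Ser σ} (hf : ∀ i ∈ s, P σ (f i)) :
    P σ (∑ i ∈ s, f i) :=
  Finset.sum_induction _ _ (fun _ _ => hP.add) hP.zero hf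

theorem prod {ι : Type*} {s : Finset ι} {f : ι → Ser σ} (hf : ∀ i ∈ s, P σ (f i)) :
    P σ (∏ i ∈ s, f i) :=
  Finset.prod_induction _ _ (fun _ _ => hP.mul) hP.one hf

theorem det {ι : Type*} [Fintype ι] [DecidableEq ι] {M : Matrix ι ι (Ser σ)}
    (hM : ∀ i j, P σ (M i j)) : P σ M.det := by
  rw [Matrix.det_apply']
  refine hP.sum fun p _ => hP.mul ?_ (hP.prod fun i _ => hM _ _)
  have := hP.const (σ := σ) ((Equiv.Perm.sign p : ℤ) : ℂ)
  simpa using this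

/-- The derivative is the difference quotient at u = 0, and its numerator is u times the quotient.
-/
theorem pderiv [Finite σ] (s : σ) {f : Ser σ} (hf : P σ f) : P σ (MvPowerSeries.pderiv ℂ s f) := by
  classical
  obtain ⟨K, hK, hK'⟩ := exists_shift_eq s f
  rw [← hK']
  refine hP.comp (elim_const X_const (fun _ => by simp)) ?_ ?_
  · rintro (i | i)
    · exact hP.var i
    · exact hP.zero
  · apply hP.of_X_mul (Sum.inr ())
    rw [eq_sub_of_add_eq' hK.symm]
    refine hP.sub (hP.comp (shift_const s) (fun i => ?_) hf)
      (hP.comp (fun i => X_const _) (fun i => hP.var _) hf)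
    unfold shift
    refine hP.add (hP.var _) ?_
    split_ifs
    · exact hP.var _
    · exact hP.zero

theorem kill [Finite σ] [DecidableEq σ] (S : Finset σ) {f : Ser σ} (hf : P σ f) :
    P σ (FormalCR.kill S f) := by
  refine hP.comp (kill_const S) (fun i => ?_) hf
  split_ifs
  · exact hP.zero
  · exact hP.var _

/-- Division by a unit is an instance of the implicit function axiom: f − f(0) solves u(y + f(0)) =
uf for y. The shift by f(0) is needed because implicit solutions must vanish at the origin. -/
theorem of_unit_mul [Finite σ] {u f : Ser σ} (hu : P σ u) (hu0 : constantCoeff u ≠ 0)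
    (h : P σ (u * f)) : P σ f := by
  set c := constantCoeff f
  have hl : ∀ i : σ, constantCoeff (X (Sum.inl i) : Ser (σ ⊕ Unit)) = 0 := fun i => by simp
  have h0 : ∀ i, constantCoeff (Sum.elim (fun i => (X i : Ser σ)) (fun _ : Unit => f - C c) i) = 0 :=
    elim_const X_const (fun _ => by simp [c])
  have hren : ∀ g : Ser σ, P σ g → P (σ ⊕ Unit) (subst (fun i => X (Sum.inl i)) g) :=
    fun g hg => hP.comp hl (fun i => hP.var _) hg
  have key : P σ (f - C c) := by
    refine hP.implicit (f := subst (fun i => X (Sum.inl i)) u * (X (Sum.inr ()) + C c) -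
      subst (fun i => X (Sum.inl i)) (u * f)) (by simp [c]) ?_ ?_ ?_
    · have := Fintype.ofFinite σ
      simp [pderiv_subst hl, constantCoeff_subst_zero hl, hu0]
    · rw [subst_sub (hs h0), subst_mul (hs h0), subst_subst hl h0, subst_subst hl h0,
        subst_add (hs h0), subst_X (hs h0), subst_C']
      simp only [subst_X (hs h0), Sum.elim_inl, Sum.elim_inr, subst_X_eq]
      ring
    · exact hP.sub (hP.mul (hren _ hu) (hP.add (hP.var _) (hP.const c))) (hren _ h)
  have := hP.add key (hP.const c)
  simpa using this

/-- Cramer's rule, the determinant being a unit. -/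
theorem solve [Finite σ] {m : ℕ} {M : Matrix (Fin m) (Fin m) (Ser σ)} {x b : Fin m → Ser σ}
    (hM : ∀ i j, P σ (M i j)) (hb : ∀ i, P σ (b i))
    (hM0 : ∀ u : Fin m → ℂ, (∀ i, ∑ j, constantCoeff (M i j) * u j = 0) → u = 0)
    (h : ∀ i, ∑ j, M i j * x j = b i) (i : Fin m) : P σ (x i) := by
  have hdet : constantCoeff M.det ≠ 0 := by
    rw [det_constantCoeff]
    intro h
    obtain ⟨u, hu, hu'⟩ := Matrix.exists_mulVec_eq_zero_iff.mpr h
    exact hu (hM0 u fun i => congrFun hu' i)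
  apply hP.of_unit_mul (hP.det hM) hdet
  have h1 : M.mulVec x = b := funext h
  have h2 : M.det * x i = (M.adjugate.mulVec b) i := by
    rw [← h1, Matrix.mulVec_mulVec, Matrix.adjugate_mul, Matrix.smul_mulVec, Matrix.one_mulVec]
    simp
  rw [h2, Matrix.mulVec, dotProduct]
  refine hP.sum fun j _ => hP.mul ?_ (hb j)
  rw [Matrix.adjugate_apply]
  refine hP.det fun k l => ?_
  rw [Matrix.updateRow_apply]
  split_ifs
  · by_cases h : l = i
    · subst h; simpa using hP.one
    · simpa [h] using hP.zero
  · exact hM _ _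

end IsTame

/-! ### The implicit function theorem for systems, with control of regularity. -/

section System

variable {σ : Type}

/-- The reindexing of the indeterminates that singles out the last unknown. -/
def splitLast {m : ℕ} : σ ⊕ Fin (m + 1) → Ser ((σ ⊕ Fin m) ⊕ Unit) :=
  Sum.elim (fun i => X (Sum.inl (Sum.inl i)))
    (Fin.lastCases (X (Sum.inr ())) (fun j => X (Sum.inl (Sum.inr j))))

theorem splitLast_const {m : ℕ} (i : σ ⊕ Fin (m + 1)) : constantCoeff (splitLast i) = 0 := by
  rcases i with i | i
  · simp [splitLast]
  · induction i using Fin.lastCases <;> simp [splitLast]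

theorem constantCoeff_pderiv_splitLast {m : ℕ} [Finite σ] (f : Ser (σ ⊕ Fin (m + 1))) :
    constantCoeff (pderiv ℂ (Sum.inr ()) (subst splitLast f)) =
      constantCoeff (pderiv ℂ (Sum.inr (Fin.last m)) f) := by
  have := Fintype.ofFinite σ
  rw [pderiv_subst splitLast_const, Fintype.sum_sum_type, Fin.sum_univ_castSucc]
  simp only [map_add, map_sum, map_mul, constantCoeff_subst_zero splitLast_const]
  simp [splitLast]

theorem lastCases_const {τ : Type} {m : ℕ} {g : Ser τ} {b : Fin m → Ser τ}
    (hg : constantCoeff g = 0) (hb : ∀ i, constantCoeff (b i) = 0) (i : Fin (m + 1)) :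
    constantCoeff ((Fin.lastCases g b : Fin (m + 1) → Ser τ) i) = 0 := by
  induction i using Fin.lastCases <;> simp [hg, hb]

/-- The last equation eliminates the last unknown. Because the Jacobian is the identity, the other
equations have no linear term in that unknown, so the reduced system again has identity Jacobian.
Regularity is carried along, as the axiom covers only one unknown. -/
theorem exists_implicit_normalized (m : ℕ) {σ : Type} [Finite σ] (F : Fin m → Ser (σ ⊕ Fin m))
    (hF : ∀ i, constantCoeff (F i) = 0)
    (hF' : ∀ i j, constantCoeff (pderiv ℂ (Sum.inr j) (F i)) = if i = j then 1 else 0) :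
    ∃ y : Fin m → Ser σ, (∀ i, constantCoeff (y i) = 0) ∧
      (∀ i, subst (Sum.elim (fun i => (X i : Ser σ)) y) (F i) = 0) ∧
      ∀ P, IsTame P → (∀ i, P _ (F i)) → ∀ i, P σ (y i) := by
  have := Fintype.ofFinite σ
  induction m with
  | zero => exact ⟨fun i => i.elim0, fun i => i.elim0, fun i => i.elim0, fun _ _ _ i => i.elim0⟩
  | succ m ih =>
    obtain ⟨g, hg, hg'⟩ := exists_implicit (f := subst splitLast (F (Fin.last m)))
      (by rw [constantCoeff_subst_zero splitLast_const, hF])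
      (by rw [constantCoeff_pderiv_splitLast, hF']; simp)
    have htame : ∀ P, IsTame P → (∀ i, P _ (F i)) → P _ g := by
      intro P hP hPF
      refine hP.implicit hg ?_ hg' (hP.comp splitLast_const ?_ (hPF _))
      · rw [constantCoeff_pderiv_splitLast, hF']; simp
      · rintro (i | i)
        · exact hP.var _
        · induction i using Fin.lastCases
          · simpa [splitLast] using hP.var _
          · simpa [splitLast] using hP.var _
    let a : σ ⊕ Fin (m + 1) → Ser (σ ⊕ Fin m) := Sum.elim (fun i => X (Sum.inl i))
      (Fin.lastCases g (fun j => X (Sum.inr j)))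
    have ha : ∀ i, constantCoeff (a i) = 0 :=
      elim_const (fun _ => by simp) (lastCases_const hg (fun _ => by simp))
    have hg0 : subst a (F (Fin.last m)) = 0 := by
      have hgc : ∀ i, constantCoeff (Sum.elim (fun i => (X i : Ser (σ ⊕ Fin m)))
        (fun _ : Unit => g) i) = 0 := elim_const X_const (fun _ => hg)
      rw [subst_subst splitLast_const hgc] at hg'
      convert hg' using 2
      funext i
      rcases i with i | i
      · simp [a, splitLast, subst_X (hs hgc)]
      · induction i using Fin.lastCases <;> simp [a, splitLast, subst_X (hs hgc)]
    obtain ⟨y, hy, hyF, hyP⟩ := ih (fun i => subst a (F i.castSucc))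
      (fun i => by rw [constantCoeff_subst_zero ha, hF])
      (fun i j => by
        rw [pderiv_subst ha, Fintype.sum_sum_type, Fin.sum_univ_castSucc]
        simp only [map_add, map_sum, map_mul, constantCoeff_subst_zero ha, hF']
        rw [if_neg (Fin.castSucc_lt_last i).ne]
        simp only [a, Sum.elim_inl, Sum.elim_inr, Fin.lastCases_castSucc, Fin.lastCases_last,
          zero_mul, add_zero]
        rw [Finset.sum_eq_zero, zero_add, Finset.sum_eq_single j]
        · simp
        · intro k _ hk; simp [hk]
        · simp
        · intro k _; simp)
    have hXy : ∀ i, constantCoeff (Sum.elim (fun i => (X i : Ser σ)) y i) = 0 :=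
      elim_const X_const hy
    have hsub : ∀ f : Ser (σ ⊕ Fin (m + 1)), subst (Sum.elim (fun i => (X i : Ser σ)) y) (subst a f)
        = subst (Sum.elim (fun i => (X i : Ser σ))
          (Fin.lastCases (subst (Sum.elim (fun i => (X i : Ser σ)) y) g) y)) f := by
      intro f
      rw [subst_subst ha hXy]
      congr 1
      funext i
      rcases i with i | i
      · simp [a, subst_X (hs hXy)]
      · induction i using Fin.lastCases <;> simp [a, subst_X (hs hXy)]
    refine ⟨Fin.lastCases (subst (Sum.elim (fun i => (X i : Ser σ)) y) g) y, ?_, ?_, ?_⟩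
    · exact lastCases_const (by rw [constantCoeff_subst_zero hXy, hg]) hy
    · intro i
      rw [← hsub]
      induction i using Fin.lastCases with
      | last => rw [hg0, subst_zero' hXy]
      | cast i => exact hyF i
    · intro P hP hPF
      have hgP := htame P hP hPF
      have hyP' := hyP P hP fun i => hP.comp ha (by
        rintro (i | i)
        · exact hP.var _
        · induction i using Fin.lastCases
          · simpa [a] using hgP
          · simpa [a] using hP.var _) (hPF _)
      intro i
      induction i using Fin.lastCases with
      | last =>
        simp only [Fin.lastCases_last]
        refine hP.comp hXy ?_ hgP
        rintro (i | i)
        · exact hP.var _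
        · exact hyP' i
      | cast i => simpa using hyP' i

/-- Multiplication by the constant inverse of the Jacobian reduces to identity Jacobian without
changing the solutions. -/
theorem exists_implicit_system {m : ℕ} [Finite σ] (F : Fin m → Ser (σ ⊕ Fin m))
    (hF : ∀ i, constantCoeff (F i) = 0)
    (hF' : ∀ u : Fin m → ℂ,
      (∀ i, ∑ j, constantCoeff (pderiv ℂ (Sum.inr j) (F i)) * u j = 0) → u = 0) :
    ∃ y : Fin m → Ser σ, (∀ i, constantCoeff (y i) = 0) ∧
      (∀ i, subst (Sum.elim (fun i => (X i : Ser σ)) y) (F i) = 0) ∧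
      ∀ P, IsTame P → (∀ i, P _ (F i)) → ∀ i, P σ (y i) := by
  let J : Matrix (Fin m) (Fin m) ℂ :=
    Matrix.of fun i j => constantCoeff (pderiv ℂ (Sum.inr j) (F i))
  have hJ : J.det ≠ 0 := by
    intro h
    obtain ⟨u, hu, hu'⟩ := Matrix.exists_mulVec_eq_zero_iff.mpr h
    exact hu (hF' u fun i => congrFun hu' i)
  have hJ1 : J⁻¹ * J = 1 := Matrix.nonsing_inv_mul J (isUnit_iff_ne_zero.mpr hJ)
  have hJ2 : J * J⁻¹ = 1 := Matrix.mul_nonsing_inv J (isUnit_iff_ne_zero.mpr hJ)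
  obtain ⟨y, hy, hyF, hyP⟩ := exists_implicit_normalized m (fun i => ∑ j, C (J⁻¹ i j) * F j)
    (fun i => by simp [hF]) (fun i j => by
      have := congrFun (congrFun hJ1 i) j
      rw [Matrix.mul_apply, Matrix.one_apply] at this
      rw [← this]
      simp [J])
  have hXy : ∀ i, constantCoeff (Sum.elim (fun i => (X i : Ser σ)) y i) = 0 :=
    elim_const X_const hy
  refine ⟨y, hy, fun i => ?_, fun P hP hPF => hyP P hP fun i =>
    hP.sum fun j _ => hP.mul (hP.const _) (hPF j)⟩
  have e : F i = ∑ j, C (J i j) * ∑ k, C (J⁻¹ j k) * F k := by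
    simp_rw [Finset.mul_sum, ← mul_assoc, ← map_mul]
    rw [Finset.sum_comm]
    simp_rw [← Finset.sum_mul, ← map_sum, ← Matrix.mul_apply, hJ2, Matrix.one_apply]
    simp
  rw [e, subst_sum hXy]
  exact Finset.sum_eq_zero fun j _ => by rw [subst_mul (hs hXy), hyF, mul_zero]

end System

end

end FormalCR

namespace FormalCR

open MvPowerSeries

noncomputable section

/-! ### Blow-ups x_t ↦ x_s x_t and their effect on coefficients. -/

section Blowup

variable {σ : Type}

/-- The substitution `x_t ↦ x_s x_t`. -/
def blowup [DecidableEq σ] (s t : σ) (f : Ser σ) : Ser σ :=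
  subst (Function.update (fun i => (X i : Ser σ)) t (X s * X t)) f

theorem blowup_const [DecidableEq σ] (s t i : σ) :
    constantCoeff (Function.update (fun i => (X i : Ser σ)) t (X s * X t) i) = 0 := by
  by_cases h : i = t
  · subst h; simp
  · simp [h]

/-- The exponent of the image of a monomial under a blow-up. -/
def blowupExp (s t : σ) (d : σ →₀ ℕ) : σ →₀ ℕ := d + Finsupp.single s (d t)

theorem blowupExp_injective {s t : σ} (hst : s ≠ t) : Function.Injective (blowupExp s t) := by
  intro d d' h
  have ht : d t = d' t := by
    have := DFunLike.congr_fun h t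
    simpa [blowupExp, Finsupp.single_apply, hst] using this
  unfold blowupExp at h
  rw [ht] at h
  exact add_right_cancel h

theorem blowup_prod [DecidableEq σ] {s t : σ} (d : σ →₀ ℕ) :
    (d.prod fun i e => (Function.update (fun i => (X i : Ser σ)) t (X s * X t) i) ^ e) =
      monomial (blowupExp s t d) 1 := by
  have h1 : (d.prod fun i e => (Function.update (fun i => (X i : Ser σ)) t (X s * X t) i) ^ e) =
      d.prod (fun i e => (X i : Ser σ) ^ e) *
        d.prod (fun i e => (if i = t then (X s : Ser σ) else 1) ^ e) := by
    rw [← Finsupp.prod_mul]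
    refine Finsupp.prod_congr fun i _ => ?_
    by_cases h : i = t
    · subst h; simp; ring
    · simp [h]
  have h2 : d.prod (fun i e => (if i = t then (X s : Ser σ) else 1) ^ e) = X s ^ d t := by
    rw [Finsupp.prod]
    by_cases ht : t ∈ d.support
    · rw [Finset.prod_eq_single_of_mem t ht]
      · simp
      · intro b _ hb; simp [hb]
    · rw [Finset.prod_eq_one]
      · simp [Finsupp.notMem_support_iff.mp ht]
      · intro b hb
        have : b ≠ t := by rintro rfl; exact ht hb
        simp [this]
  rw [h1, h2, ← monomial_one_eq, X_pow_eq, monomial_mul_monomial, one_mul, blowupExp]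

theorem coeff_blowup [Finite σ] [DecidableEq σ] {s t : σ} (hst : s ≠ t) (f : Ser σ)
    (d : σ →₀ ℕ) : coeff (blowupExp s t d) (blowup s t f) = coeff d f := by
  unfold blowup
  rw [coeff_subst (hs (blowup_const s t)), finsum_eq_single _ d]
  · rw [blowup_prod]; simp
  · intro d' hd'
    rw [blowup_prod, coeff_monomial_ne, smul_zero]
    exact fun h => hd' (blowupExp_injective hst h.symm)

/-- A monomial of a blown-up series contains x_s at least as often as x_t. Conversely this describes
the image of the blow-up, see `exists_eq_blowup`. -/
theorem coeff_blowup_of_notMem [Finite σ] [DecidableEq σ] {s t : σ} (f : Ser σ) (e : σ →₀ ℕ)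
    (he : e s < e t) (hst : s ≠ t) : coeff e (blowup s t f) = 0 := by
  unfold blowup
  rw [coeff_subst (hs (blowup_const s t)), finsum_eq_zero_of_forall_eq_zero]
  intro d
  rw [blowup_prod, coeff_monomial_ne, smul_zero]
  rintro rfl
  simp [blowupExp, hst] at he

theorem blowup_injective [Finite σ] [DecidableEq σ] {s t : σ} (hst : s ≠ t) :
    Function.Injective (blowup s t) := by
  intro f g h
  ext d
  rw [← coeff_blowup hst, h, coeff_blowup hst]

end Blowup

open scoped ENNReal NNReal

/-! ### Weighted ℓ¹ norms on polydiscs. -/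

section Majorant

variable {σ τ : Type}

/-- The weighted `ℓ¹` norm of a power series on a polydisc. -/
def polyNorm (r : σ → ℝ≥0∞) (f : Ser σ) : ℝ≥0∞ :=
  ∑' e : σ →₀ ℕ, ‖coeff e f‖ₑ * e.prod fun i k => r i ^ k

theorem prod_const (r : ℝ≥0∞) (e : σ →₀ ℕ) : (e.prod fun _ k => r ^ k) = r ^ e.degree := by
  rw [Finsupp.prod, Finset.prod_pow_eq_pow_sum, Finsupp.degree_apply]

theorem isConvergent_iff {f : Ser σ} :
    IsConvergent f ↔ ∃ r : ℝ≥0, 0 < r ∧ polyNorm (fun _ => (r : ℝ≥0∞)) f ≠ ∞ := by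
  have key : ∀ r : ℝ≥0, (Summable fun α : σ →₀ ℕ => ‖coeff α f‖ * (r : ℝ) ^ α.degree) ↔
      polyNorm (fun _ => (r : ℝ≥0∞)) f ≠ ∞ := by
    intro r
    have h1 : polyNorm (fun _ => (r : ℝ≥0∞)) f =
        ∑' e : σ →₀ ℕ, ((‖coeff e f‖₊ * r ^ e.degree : ℝ≥0) : ℝ≥0∞) := by
      unfold polyNorm
      congr 1; funext e
      rw [prod_const, enorm_eq_nnnorm]; push_cast; rfl
    rw [h1, ENNReal.tsum_coe_ne_top_iff_summable, ← NNReal.summable_coe]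
    simp
  constructor
  · rintro ⟨r, hr, h⟩
    exact ⟨⟨r, hr.le⟩, hr, (key _).mp h⟩
  · rintro ⟨r, hr, h⟩
    exact ⟨r, hr, (key r).mpr h⟩

theorem polyNorm_mono {r r' : σ → ℝ≥0∞} (h : ∀ i, r i ≤ r' i) (f : Ser σ) :
    polyNorm r f ≤ polyNorm r' f := by
  refine ENNReal.tsum_le_tsum fun e => ?_
  gcongr
  exact Finset.prod_le_prod' fun i _ => pow_le_pow_left' (h i) _

theorem polyNorm_add (r : σ → ℝ≥0∞) (f g : Ser σ) :
    polyNorm r (f + g) ≤ polyNorm r f + polyNorm r g := by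
  unfold polyNorm
  rw [← ENNReal.tsum_add]
  refine ENNReal.tsum_le_tsum fun e => ?_
  rw [← add_mul, map_add]
  gcongr
  exact enorm_add_le _ _

theorem polyNorm_monomial (r : σ → ℝ≥0∞) (e : σ →₀ ℕ) (c : ℂ) :
    polyNorm r (monomial e c) = ‖c‖ₑ * e.prod fun i k => r i ^ k := by
  classical
  unfold polyNorm
  rw [tsum_eq_single e]
  · simp
  · intro d hd; rw [coeff_monomial_ne hd]; simp

theorem polyNorm_one (r : σ → ℝ≥0∞) : polyNorm r (1 : Ser σ) = 1 := by
  rw [← monomial_zero_one, polyNorm_monomial]; simp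

theorem polyNorm_mul (r : σ → ℝ≥0∞) (f g : Ser σ) :
    polyNorm r (f * g) ≤ polyNorm r f * polyNorm r g := by
  classical
  unfold polyNorm
  calc ∑' e : σ →₀ ℕ, ‖coeff e (f * g)‖ₑ * e.prod (fun i k => r i ^ k)
      ≤ ∑' e : σ →₀ ℕ, ∑ p ∈ Finset.HasAntidiagonal.antidiagonal e,
          (‖coeff p.1 f‖ₑ * p.1.prod fun i k => r i ^ k) *
            (‖coeff p.2 g‖ₑ * p.2.prod fun i k => r i ^ k) := by
        refine ENNReal.tsum_le_tsum fun e => ?_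
        rw [coeff_mul]
        refine le_trans (mul_le_mul_left (enorm_sum_le _ _) _) ?_
        rw [Finset.sum_mul]
        refine Finset.sum_le_sum fun p hp => le_of_eq ?_
        rw [Finset.HasAntidiagonal.mem_antidiagonal] at hp
        rw [← hp, Finsupp.prod_add_index' (by simp) (by intros; exact pow_add _ _ _), enorm_mul]
        ring
    _ = ∑' p : (σ →₀ ℕ) × (σ →₀ ℕ), (‖coeff p.1 f‖ₑ * p.1.prod fun i k => r i ^ k) *
            (‖coeff p.2 g‖ₑ * p.2.prod fun i k => r i ^ k) := by
        rw [← Finset.HasAntidiagonal.sigmaAntidiagonalEquivProd.tsum_eq, ENNReal.tsum_sigma']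
        refine tsum_congr fun e => ?_
        rw [tsum_fintype]
        exact (Finset.sum_coe_sort _ _).symm
    _ = _ := by
        rw [ENNReal.tsum_prod']
        simp_rw [ENNReal.tsum_mul_left, ENNReal.tsum_mul_right]

theorem polyNorm_pow (r : σ → ℝ≥0∞) (f : Ser σ) (n : ℕ) :
    polyNorm r (f ^ n) ≤ polyNorm r f ^ n := by
  induction n with
  | zero => simp [polyNorm_one]
  | succ n ih =>
    rw [pow_succ, pow_succ]
    exact (polyNorm_mul _ _ _).trans (mul_le_mul_left ih _)

theorem polyNorm_finset_prod (r : σ → ℝ≥0∞) {ι : Type*} (s : Finset ι) (f : ι → Ser σ) :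
    polyNorm r (∏ i ∈ s, f i) ≤ ∏ i ∈ s, polyNorm r (f i) := by
  classical
  induction s using Finset.induction_on with
  | empty => simp [polyNorm_one]
  | insert i s hi ih =>
    rw [Finset.prod_insert hi, Finset.prod_insert hi]
    exact (polyNorm_mul _ _ _).trans (mul_le_mul_right ih _)

/-- Expanding the composite and exchanging the sums, the norm of each monomial in the `a i` is
bounded by submultiplicativity. The norms of the inner series thus serve as radii for the outer one.
-/
theorem polyNorm_subst [Finite σ] (r : τ → ℝ≥0∞) {a : σ → Ser τ}
    (ha : ∀ i, constantCoeff (a i) = 0) (f : Ser σ) :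
    polyNorm r (subst a f) ≤ polyNorm (fun i => polyNorm r (a i)) f := by
  calc polyNorm r (subst a f)
      ≤ ∑' e : τ →₀ ℕ, ∑' d : σ →₀ ℕ, ‖coeff d f‖ₑ *
          (‖coeff e (d.prod fun i k => a i ^ k)‖ₑ * e.prod fun i k => r i ^ k) := by
        refine ENNReal.tsum_le_tsum fun e => ?_
        rw [coeff_subst (hs ha), finsum_eq_sum _ (coeff_subst_finite (hs ha) f e)]
        refine le_trans (mul_le_mul_left (enorm_sum_le _ _) _) ?_
        rw [Finset.sum_mul]
        refine le_trans (le_of_eq ?_) (ENNReal.sum_le_tsum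
          (coeff_subst_finite (hs ha) f e).toFinset)
        refine Finset.sum_congr rfl fun d _ => ?_
        rw [smul_eq_mul, enorm_mul, mul_assoc]
    _ = ∑' d : σ →₀ ℕ, ‖coeff d f‖ₑ * polyNorm r (d.prod fun i k => a i ^ k) := by
        rw [ENNReal.tsum_comm]
        simp_rw [ENNReal.tsum_mul_left]
        rfl
    _ ≤ _ := by
        refine ENNReal.tsum_le_tsum fun d => ?_
        gcongr
        exact (polyNorm_finset_prod _ _ _).trans
          (Finset.prod_le_prod' fun i _ => polyNorm_pow _ _ _)

/-- Without a constant term every monomial gains at least one factor c, so the norm tends to zero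
with the radius. -/
theorem polyNorm_smul_le {r c : ℝ≥0∞} (hc : c ≤ 1) {f : Ser σ} (hf : constantCoeff f = 0) :
    polyNorm (fun _ => c * r) f ≤ c * polyNorm (fun _ => r) f := by
  unfold polyNorm
  rw [← ENNReal.tsum_mul_left]
  refine ENNReal.tsum_le_tsum fun e => ?_
  rw [prod_const, prod_const, mul_pow]
  by_cases he : e = 0
  · subst he; simp [hf]
  · have : c ^ e.degree ≤ c := pow_le_of_le_one zero_le hc (by rwa [Ne, Finsupp.degree_eq_zero_iff])
    calc ‖coeff e f‖ₑ * (c ^ e.degree * r ^ e.degree) ≤ ‖coeff e f‖ₑ * (c * r ^ e.degree) := by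
          gcongr
      _ = _ := by ring

end Majorant

end

end FormalCR

namespace FormalCR

open MvPowerSeries

noncomputable section

open scoped ENNReal NNReal

/-! ### Convergent series form a tame class. -/

section Convergent

variable {σ τ : Type}

theorem isConvergent_of_tsum {f : Ser σ} {r : ℝ≥0} (hr : 0 < r)
    (h : polyNorm (fun _ => (r : ℝ≥0∞)) f ≠ ∞) : IsConvergent f :=
  isConvergent_iff.mpr ⟨r, hr, h⟩

theorem IsConvergent.exists_le {f : Ser σ} (hf : IsConvergent f) {b : ℝ≥0} (hb : 0 < b) :
    ∃ r : ℝ≥0, 0 < r ∧ r ≤ b ∧ polyNorm (fun _ => (r : ℝ≥0∞)) f ≠ ∞ := by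
  obtain ⟨r, hr, h⟩ := isConvergent_iff.mp hf
  refine ⟨min r b, lt_min hr hb, min_le_right _ _, ne_top_of_le_ne_top h ?_⟩
  exact polyNorm_mono (fun _ => ENNReal.coe_le_coe.mpr (min_le_left _ _)) f

theorem polyNorm_ne_top_of_le {f : Ser σ} {r s : ℝ≥0} (h : polyNorm (fun _ => (r : ℝ≥0∞)) f ≠ ∞)
    (hs : s ≤ r) : polyNorm (fun _ => (s : ℝ≥0∞)) f ≠ ∞ :=
  ne_top_of_le_ne_top h (polyNorm_mono (fun _ => ENNReal.coe_le_coe.mpr hs) f)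

theorem IsConvergent.exists_polyNorm_le {f : Ser σ} (hf : IsConvergent f)
    (h0 : constantCoeff f = 0) {ε : ℝ≥0} (hε : 0 < ε) :
    ∃ r : ℝ≥0, 0 < r ∧ polyNorm (fun _ => (r : ℝ≥0∞)) f ≤ ε := by
  obtain ⟨r, hr, h⟩ := isConvergent_iff.mp hf
  lift polyNorm (fun _ => (r : ℝ≥0∞)) f to ℝ≥0 using h with B hB
  refine ⟨min 1 (ε / (B + 1)) * r, mul_pos (lt_min one_pos (div_pos hε (by positivity))) hr, ?_⟩
  rw [ENNReal.coe_mul]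
  refine (polyNorm_smul_le (by exact_mod_cast min_le_left _ _) h0).trans ?_
  rw [← hB]
  norm_cast
  calc min 1 (ε / (B + 1)) * B ≤ ε / (B + 1) * (B + 1) := by
        gcongr
        · exact min_le_right _ _
        · exact le_self_add
    _ = ε := div_mul_cancel₀ _ (by positivity)

theorem IsConvergent.exists_common [Finite σ] {a : σ → Ser τ} (ha : ∀ i, IsConvergent (a i))
    (h0 : ∀ i, constantCoeff (a i) = 0) {ε : ℝ≥0} (hε : 0 < ε) :
    ∃ r : ℝ≥0, 0 < r ∧ ∀ i, polyNorm (fun _ => (r : ℝ≥0∞)) (a i) ≤ ε := by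
  have := Fintype.ofFinite σ
  choose r hr h using fun i => (ha i).exists_polyNorm_le (h0 i) hε
  refine ⟨Finset.univ.fold min 1 r, ?_, fun i => (polyNorm_mono (fun _ => ?_) _).trans (h i)⟩
  · rw [Finset.lt_fold_min]
    exact ⟨one_pos, fun i _ => hr i⟩
  · refine ENNReal.coe_le_coe.mpr ?_
    rw [Finset.fold_min_le]
    exact Or.inr ⟨i, Finset.mem_univ _, le_rfl⟩

theorem polyNorm_X (r : σ → ℝ≥0∞) (s : σ) : polyNorm r (X s : Ser σ) = r s := by
  rw [X, polyNorm_monomial]; simp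

/-- Give the variables x weight 2 and the unknown y weight 1. Since `k` lacks the constant term and
the linear term in y, all its monomials have weight at least 2, which gains the factor μ². -/
theorem polyNorm_anisotropic [Finite σ] {r μ : ℝ≥0} (hr : r ≤ 1) (hμ : μ ≤ 1)
    {k : Ser (σ ⊕ Unit)} (hk : constantCoeff k = 0)
    (hk' : constantCoeff (pderiv ℂ (Sum.inr ()) k) = 0) :
    polyNorm (Sum.elim (fun _ => ((r * μ) ^ 2 : ℝ≥0∞)) (fun _ => (r * μ : ℝ≥0∞))) k ≤
      μ ^ 2 * polyNorm (fun _ => (r : ℝ≥0∞)) k := by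
  have := Fintype.ofFinite σ
  have hr' : (r : ℝ≥0∞) ≤ 1 := by exact_mod_cast hr
  have hμ' : (μ : ℝ≥0∞) ≤ 1 := by exact_mod_cast hμ
  unfold polyNorm
  rw [← ENNReal.tsum_mul_left]
  refine ENNReal.tsum_le_tsum fun e => ?_
  set a := ∑ i, e (Sum.inl i) with ha
  set b := e (Sum.inr ()) with hb
  have hw : (e.prod fun i k => (Sum.elim (fun _ => ((r * μ) ^ 2 : ℝ≥0∞))
      (fun _ => (r * μ : ℝ≥0∞)) i) ^ k) = (r * μ : ℝ≥0∞) ^ (2 * a + b) := by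
    rw [Finsupp.prod_fintype _ _ (by simp), Fintype.prod_sum_type]
    simp only [Sum.elim_inl, Sum.elim_inr, Finset.prod_pow_eq_pow_sum, ← pow_mul]
    rw [pow_add, ← Finset.mul_sum, ← ha]
    simp [hb]
  have hdeg : e.degree = a + b := by
    rw [Finsupp.degree_eq_sum, Fintype.sum_sum_type]; simp [ha, hb]
  rw [hw, prod_const, hdeg]
  by_cases h2 : 2 ≤ 2 * a + b
  · calc ‖coeff e k‖ₑ * (r * μ : ℝ≥0∞) ^ (2 * a + b)
        = ‖coeff e k‖ₑ * ((r : ℝ≥0∞) ^ (2 * a + b) * (μ : ℝ≥0∞) ^ (2 * a + b)) := by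
          rw [mul_pow]
      _ ≤ ‖coeff e k‖ₑ * ((r : ℝ≥0∞) ^ (a + b) * (μ : ℝ≥0∞) ^ 2) := by
          refine mul_le_mul_right (mul_le_mul' ?_ ?_) _
          · exact pow_le_pow_of_le_one zero_le hr' (by omega)
          · exact pow_le_pow_of_le_one zero_le hμ' h2
      _ = _ := by ring
  · have hz : coeff e k = 0 := by
      have ha0 : a = 0 := by omega
      have hi : ∀ i, e (Sum.inl i) = 0 := fun i =>
        (Finset.sum_eq_zero_iff.mp ha0) i (Finset.mem_univ _)
      have hb' : b = 0 ∨ b = 1 := by omega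
      rcases hb' with h | h
      · have : e = 0 := by
          ext (i | i)
          · exact hi i
          · exact h
        rw [this, coeff_zero_eq_constantCoeff_apply, hk]
      · have : e = 0 + Finsupp.single (Sum.inr ()) 1 := by
          ext (i | i)
          · simp [hi i]
          · simpa using h
        rw [← coeff_zero_eq_constantCoeff_apply, coeff_pderiv] at hk'
        rw [this]
        simpa using hk'
    simp [hz]

/-- On a suitable anisotropic polydisc all Picard iterates have norm at most rμ. Any finite partial
sum of the norm of `g` coincides with that of a late iterate, so the bound passes to `g`. -/
theorem isConvergent_of_fixed_point [Finite σ] {k : Ser (σ ⊕ Unit)} (hk : constantCoeff k = 0)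
    (hk' : constantCoeff (pderiv ℂ (Sum.inr ()) k) = 0) (hc : IsConvergent k) {g : Ser σ}
    (hg : constantCoeff g = 0)
    (h : subst (Sum.elim (fun i => (X i : Ser σ)) (fun _ => g)) k = g) : IsConvergent g := by
  obtain ⟨r, hr, hr1, hN⟩ := hc.exists_le one_pos
  have haniso : ∀ μ : ℝ≥0, μ ≤ 1 → _ := fun μ hμ => polyNorm_anisotropic hr1 hμ hk hk'
  lift polyNorm (fun _ => (r : ℝ≥0∞)) k to ℝ≥0 using hN with B
  -- With B the norm of `k` at radius r, this choice gives μ²B ≤ rμ, so the ball of radius rμ is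
  -- mapped into itself. The summand 1 covers B = 0.
  set μ : ℝ≥0 := min 1 (r / (B + 1)) with hμ
  have hμ1 : μ ≤ 1 := min_le_left _ _
  have hμ0 : 0 < μ := lt_min one_pos (div_pos hr (by positivity))
  have hμB : μ ^ 2 * B ≤ r * μ := by
    have : μ * B ≤ r := by
      calc μ * B ≤ r / (B + 1) * (B + 1) := by
            gcongr
            · exact min_le_right _ _
            · exact le_self_add
        _ = r := div_mul_cancel₀ _ (by positivity)
    calc μ ^ 2 * B = μ * (μ * B) := by ring
      _ ≤ μ * r := by gcongr
      _ = r * μ := mul_comm _ _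
  have hbound := haniso μ hμ1
  have hpic : ∀ m, polyNorm (fun _ => (((r * μ) ^ 2 : ℝ≥0) : ℝ≥0∞)) (picard k m) ≤
      ((r * μ : ℝ≥0) : ℝ≥0∞) := by
    intro m
    induction m with
    | zero => simp [picard, polyNorm]
    | succ m ih =>
      rw [picard]
      refine (polyNorm_subst _ (elim_const X_const (fun _ => picard_const hk m)) k).trans ?_
      refine (polyNorm_mono ?_ k).trans (hbound.trans (by exact_mod_cast hμB))
      rintro (i | i)
      · simp [polyNorm_X]
      · simpa using ih
  refine isConvergent_of_tsum (r := (r * μ) ^ 2) (by positivity)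
    (ne_top_of_le_ne_top (ENNReal.coe_ne_top (r := r * μ)) ?_)
  unfold polyNorm
  rw [ENNReal.tsum_eq_iSup_sum]
  refine iSup_le fun S => ?_
  set m := (S.sup fun e => e.degree) + 1 with hm
  have : ∀ e ∈ S, coeff e g = coeff e (picard k m) := fun e he =>
    coeff_picard hk hk' hg h m e
      (Nat.lt_succ_of_le (Finset.le_sup (f := fun e : σ →₀ ℕ => e.degree) he))
  rw [Finset.sum_congr rfl fun e he => by rw [this e he]]
  exact (ENNReal.sum_le_tsum S).trans (hpic m)

theorem isTame_isConvergent : IsTame fun _ f => IsConvergent f := by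
  have hconst : ∀ {σ : Type} (e : σ →₀ ℕ) (c : ℂ), IsConvergent (monomial e c : Ser σ) := by
    intro σ e c
    refine isConvergent_of_tsum one_pos ?_
    rw [polyNorm_monomial]; simp [Finsupp.prod]
  have hadd : ∀ {σ : Type} {f g : Ser σ}, IsConvergent f → IsConvergent g →
      IsConvergent (f + g) := by
    intro σ f g hf hg
    obtain ⟨r, hr, h⟩ := isConvergent_iff.mp hf
    obtain ⟨s, hs', hsr, h'⟩ := hg.exists_le hr
    exact isConvergent_of_tsum hs' (ne_top_of_le_ne_top
      (ENNReal.add_ne_top.mpr ⟨polyNorm_ne_top_of_le h hsr, h'⟩) (polyNorm_add _ _ _))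
  have hmul : ∀ {σ : Type} {f g : Ser σ}, IsConvergent f → IsConvergent g →
      IsConvergent (f * g) := by
    intro σ f g hf hg
    obtain ⟨r, hr, h⟩ := isConvergent_iff.mp hf
    obtain ⟨s, hs', hsr, h'⟩ := hg.exists_le hr
    exact isConvergent_of_tsum hs' (ne_top_of_le_ne_top
      (ENNReal.mul_ne_top (polyNorm_ne_top_of_le h hsr) h') (polyNorm_mul _ _ _))
  refine
    { const := fun c => hconst 0 c
      var := fun s => hconst _ 1
      add := hadd
      mul := hmul
      comp := ?_
      conj := ?_
      of_X_mul := ?_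
      of_blowup := ?_
      implicit := ?_ }
  · intro σ τ _ _ a f ha hac hf
    obtain ⟨r, hr, h⟩ := isConvergent_iff.mp hf
    obtain ⟨s, hs', hsr⟩ := IsConvergent.exists_common hac ha hr
    exact isConvergent_of_tsum hs' (ne_top_of_le_ne_top h
      ((polyNorm_subst _ ha f).trans (polyNorm_mono hsr f)))
  · intro σ f hf
    obtain ⟨r, hr, h⟩ := isConvergent_iff.mp hf
    refine isConvergent_of_tsum hr ?_
    convert h using 1
    unfold polyNorm FormalCR.conj
    refine tsum_congr fun e => ?_
    rw [coeff_map, ← ofReal_norm, ← ofReal_norm, RCLike.norm_conj]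
  · intro σ _ s f hf
    obtain ⟨r, hr, h⟩ := isConvergent_iff.mp hf
    refine isConvergent_of_tsum hr ?_
    have hle : polyNorm (fun _ => (r : ℝ≥0∞)) f * r ≤ polyNorm (fun _ => (r : ℝ≥0∞)) (X s * f) := by
      unfold polyNorm
      rw [← ENNReal.tsum_mul_right]
      refine le_trans (le_of_eq ?_) (ENNReal.tsum_comp_le_tsum_of_injective
        (add_left_injective (Finsupp.single s 1)) _)
      refine tsum_congr fun e => ?_
      rw [prod_const, prod_const, map_add, mul_comm (X s) f, X, coeff_add_mul_monomial]
      simp [pow_succ, mul_assoc]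
    intro htop
    rw [htop, ENNReal.top_mul (by exact_mod_cast hr.ne')] at hle
    exact h (top_le_iff.mp hle)
  · intro σ _ _ s t f hst hf
    obtain ⟨r, hr, hr1, h⟩ := hf.exists_le one_pos
    -- A monomial of degree |e| becomes one of degree |e| + e_t ≤ 2|e|, so squaring a radius r ≤ 1
    -- is enough.
    refine isConvergent_of_tsum (r := r ^ 2) (by positivity) (ne_top_of_le_ne_top h ?_)
    unfold polyNorm
    refine le_trans (ENNReal.tsum_le_tsum fun e => ?_) (ENNReal.tsum_comp_le_tsum_of_injective
      (blowupExp_injective hst) _)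
    have := coeff_blowup hst f e
    unfold blowup at this
    rw [this, prod_const, prod_const]
    refine mul_le_mul_right ?_ _
    rw [ENNReal.coe_pow, ← pow_mul]
    refine pow_le_pow_of_le_one zero_le (by exact_mod_cast hr1) ?_
    rw [blowupExp, map_add, Finsupp.degree_single]
    have := Finsupp.le_degree t e
    omega
  · intro σ _ f g hg hf' h hf
    set c := constantCoeff (pderiv ℂ (Sum.inr ()) f) with hc
    have he : ∀ i, constantCoeff (Sum.elim (fun i => (X i : Ser σ)) (fun _ : Unit => g) i) = 0 :=
      elim_const X_const (fun _ => hg)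
    have hf0 : constantCoeff f = 0 := by
      rw [← constantCoeff_subst_zero he, h, map_zero]
    refine isConvergent_of_fixed_point (k := X (Sum.inr ()) + C (-c⁻¹) * f) (by simp [hf0])
      (by simp [← hc, hf']) (hadd (hconst _ _) (hmul (hconst _ _) hf)) hg ?_
    rw [subst_add (hs he), subst_X (hs he), subst_mul (hs he), h]
    simp

end Convergent

end

end FormalCR

namespace FormalCR

open MvPowerSeries

noncomputable section

/-! ### Algebraic series form a tame class. -/

section Algebraic

variable {σ τ : Type}

/-- The zero substitution factors through the ring in no indeterminates, where a series is its
constant term. -/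
theorem subst_zero_args [Finite σ] (f : Ser σ) :
    subst (fun _ => (0 : Ser τ)) f = C (constantCoeff f) := by
  have h0 : ∀ _ : σ, constantCoeff (0 : Ser Empty) = 0 := fun _ => map_zero _
  have h1 : ∀ i : Empty, constantCoeff (i.elim : Ser τ) = 0 := fun i => i.elim
  have h : subst (fun _ => (0 : Ser Empty)) f = C (constantCoeff f) := by
    ext e
    obtain rfl : e = 0 := Subsingleton.elim _ _
    rw [coeff_zero_eq_constantCoeff_apply, constantCoeff_subst_zero h0,
      coeff_zero_eq_constantCoeff_apply, constantCoeff_C]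
  have h2 := subst_subst h0 h1 f
  rw [subst_zero' h1, h, subst_C] at h2
  exact h2.symm

theorem algebraMap_polynomial (p : MvPolynomial σ ℂ) :
    algebraMap (MvPolynomial σ ℂ) (Ser σ) p = (p : Ser σ) := by
  simp [MvPowerSeries.algebraMap_apply']

instance : IsDomain (Ser σ) := NoZeroDivisors.to_isDomain _

/-- The inclusion of the polynomials into the power series. -/
def polyHom (σ : Type) : MvPolynomial σ ℂ →ₐ[ℂ] Ser σ :=
  Algebra.algHom ℂ (MvPolynomial σ ℂ) (Ser σ)

theorem polyHom_apply (p : MvPolynomial σ ℂ) : polyHom σ p = (p : Ser σ) :=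
  algebraMap_polynomial p

theorem polyHom_X (i : σ) : polyHom σ (MvPolynomial.X i) = X i := by
  rw [polyHom_apply, MvPolynomial.coe_X]

theorem algebraMap_polynomial_injective :
    Function.Injective (algebraMap (MvPolynomial σ ℂ) (Ser σ)) := by
  intro p q h
  rw [algebraMap_polynomial, algebraMap_polynomial] at h
  exact MvPolynomial.coe_injective _ _ h

/-- Transitivity: the coefficients of `p` lie in the algebraic closure of `R` inside `S`, and a
series algebraic over that closure is algebraic over `R`. -/
theorem isAlgebraic_of_subring {R S T : Type} [CommRing R] [IsDomain R] [CommRing S] [IsDomain S]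
    [Algebra R S] [CommRing T] (ψ : T →+* S) (hψ : Function.Injective ψ)
    (hT : ∀ t, IsAlgebraic R (ψ t)) {f : S} {p : Polynomial T} (hp : p ≠ 0)
    (hf : p.eval₂ ψ f = 0) : IsAlgebraic R f := by
  let B := Subalgebra.algebraicClosure R S
  let φ : T →+* B := ψ.codRestrict B.toSubring hT
  have hφ : Function.Injective φ := fun a b h => hψ (congrArg Subtype.val h)
  have hB : Algebra.IsAlgebraic R B := by
    refine ⟨fun b => ?_⟩
    exact IsAlgebraic.of_ringHom_of_comp_eq (RingHom.id R) (B.val) b.2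
      Function.surjective_id Subtype.val_injective rfl
  have : IsAlgebraic B f := by
    refine ⟨p.map φ, (Polynomial.map_ne_zero_iff hφ).mpr hp, ?_⟩
    rw [Polynomial.aeval_def, Polynomial.eval₂_map]
    exact hf
  exact this.restrictScalars R

/-- Setting x = 0 could annihilate every coefficient of the relation. Dividing out the highest power
of x prevents this, and the quotient is still a relation because `S` is a domain into which `R`
embeds. -/
theorem isAlgebraic_specialize {R R' S S' : Type} [CommRing R] [IsDomain R] [IsNoetherianRing R]
    [CommRing R'] [CommRing S] [IsDomain S] [CommRing S'] [Algebra R S] [Algebra R' S']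
    (hRS : Function.Injective (algebraMap R S))
    (ev : R →+* R') (Ev : S →+* S')
    (h : Ev.comp (algebraMap R S) = (algebraMap R' S').comp ev) (x : R) (hx0 : x ≠ 0)
    (hxu : ¬ IsUnit x) (hx : ∀ r, ev r = 0 → x ∣ r) {f : S} (hf : IsAlgebraic R f) :
    IsAlgebraic R' (Ev f) := by
  obtain ⟨p, hp, hpf⟩ := hf
  have hu : ¬ IsUnit (Polynomial.C x) := by rwa [Polynomial.isUnit_C]
  obtain ⟨q, hq, hqx⟩ := (FiniteMultiplicity.of_not_isUnit hu hp).exists_eq_pow_mul_and_not_dvd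
  have hqf : Polynomial.aeval f q = 0 := by
    rw [hq, map_mul, map_pow, Polynomial.aeval_C] at hpf
    refine (mul_eq_zero.mp hpf).resolve_left (pow_ne_zero _ ?_)
    exact (map_ne_zero_iff _ hRS).mpr hx0
  refine ⟨q.map ev, fun h0 => hqx ?_, ?_⟩
  · rw [Polynomial.C_dvd_iff_dvd_coeff]
    intro i
    apply hx
    rw [← Polynomial.coeff_map, h0, Polynomial.coeff_zero]
  · rw [Polynomial.aeval_def, Polynomial.eval₂_map, ← h, ← Polynomial.hom_eval₂,
      ← Polynomial.aeval_def, hqf, map_zero]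

/-- Setting the last of the parameters to zero. -/
def dropLast (τ : Type) (m : ℕ) : τ ⊕ Fin (m + 1) → MvPolynomial (τ ⊕ Fin m) ℂ :=
  Sum.elim (fun i => MvPolynomial.X (Sum.inl i))
    (Fin.lastCases 0 fun j => MvPolynomial.X (Sum.inr j))

theorem X_dvd_of_dropLast (m : ℕ) (p : MvPolynomial (τ ⊕ Fin (m + 1)) ℂ)
    (hp : MvPolynomial.aeval (dropLast τ m) p = 0) :
    MvPolynomial.X (Sum.inr (Fin.last m)) ∣ p := by
  let s : MvPolynomial (τ ⊕ Fin m) ℂ →ₐ[ℂ] MvPolynomial (τ ⊕ Fin (m + 1)) ℂ :=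
    MvPolynomial.rename (Sum.map id Fin.castSucc)
  let I : Ideal (MvPolynomial (τ ⊕ Fin (m + 1)) ℂ) :=
    Ideal.span {MvPolynomial.X (Sum.inr (Fin.last m))}
  have key : (Ideal.Quotient.mkₐ ℂ I).comp (s.comp (MvPolynomial.aeval (dropLast τ m))) =
      Ideal.Quotient.mkₐ ℂ I := by
    apply MvPolynomial.algHom_ext
    rintro (i | j)
    · simp [dropLast, s]
    · refine Fin.lastCases ?_ (fun j => ?_) j
      · simp only [dropLast, AlgHom.comp_apply, MvPolynomial.aeval_X, Sum.elim_inr,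
          Fin.lastCases_last, map_zero]
        symm
        exact Ideal.Quotient.eq_zero_iff_mem.mpr (Ideal.mem_span_singleton_self _)
      · simp [dropLast, s]
  have h := DFunLike.congr_fun key p
  simp only [AlgHom.comp_apply, hp, map_zero] at h
  exact Ideal.mem_span_singleton.mp (Ideal.Quotient.eq_zero_iff_mem.mp h.symm)

theorem isAlgebraicSeries_dropLast [Finite τ] {m : ℕ} {f : Ser (τ ⊕ Fin (m + 1))}
    (hf : IsAlgebraicSeries f) :
    IsAlgebraicSeries (subst (fun i => ((dropLast τ m i : MvPolynomial _ ℂ) : Ser (τ ⊕ Fin m))) f)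
    := by
  have hc : ∀ i, constantCoeff ((dropLast τ m i : MvPolynomial _ ℂ) : Ser (τ ⊕ Fin m)) = 0 := by
    rintro (i | j)
    · simp [dropLast]
    · refine Fin.lastCases ?_ (fun j => ?_) j <;> simp [dropLast]
  have := isAlgebraic_specialize (S' := Ser (τ ⊕ Fin m)) algebraMap_polynomial_injective
    (MvPolynomial.aeval (dropLast τ m)).toRingHom (substAlgHom (hs hc)).toRingHom ?_
    (MvPolynomial.X (Sum.inr (Fin.last m))) (MvPolynomial.X_ne_zero _) ?_
    (X_dvd_of_dropLast m) hf
  · simpa only [AlgHom.toRingHom_eq_coe, RingHom.coe_coe, coe_substAlgHom, IsAlgebraicSeries] using this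
  · ext p
    · simp [algebraMap_polynomial, coe_substAlgHom]
    · simp [algebraMap_polynomial, coe_substAlgHom, subst_X (hs hc)]
  · intro hu
    have := hu.map (MvPolynomial.constantCoeff (R := ℂ))
    simp at this

/-- The parameters go one at a time, since `isAlgebraic_specialize` needs every element that
specializes to zero to be divisible by one element. -/
theorem isAlgebraicSeries_dropAll [Finite τ] {m : ℕ} {f : Ser (τ ⊕ Fin m)}
    (hf : IsAlgebraicSeries f) :
    IsAlgebraicSeries (subst (Sum.elim (fun i => (X i : Ser τ)) fun _ => 0) f) := by
  have hc (m : ℕ) : ∀ i : τ ⊕ Fin m, constantCoeff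
      ((Sum.elim (fun i => (X i : Ser τ)) fun _ => 0) i) = 0 := by
    rintro (i | j) <;> simp
  induction m with
  | zero =>
    let g : MvPolynomial (τ ⊕ Fin 0) ℂ →ₐ[ℂ] MvPolynomial τ ℂ :=
      MvPolynomial.aeval (Sum.elim MvPolynomial.X fun _ => 0)
    have hg : Function.Injective g := by
      apply Function.LeftInverse.injective (g := MvPolynomial.rename Sum.inl)
      intro p
      have : (MvPolynomial.rename Sum.inl).comp g = AlgHom.id ℂ _ := by
        apply MvPolynomial.algHom_ext
        rintro (i | j)
        · simp [g]
        · exact j.elim0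
      exact DFunLike.congr_fun this p
    have := IsAlgebraic.ringHom_of_comp_eq (B := Ser τ) g.toRingHom
      (substAlgHom (hs (hc 0))).toRingHom hf hg ?_
    · simpa only [AlgHom.toRingHom_eq_coe, RingHom.coe_coe, coe_substAlgHom, IsAlgebraicSeries] using this
    · ext p
      · simp [g, algebraMap_polynomial, coe_substAlgHom]
      · rcases p with p | j
        · simp [g, algebraMap_polynomial, coe_substAlgHom, subst_X (hs (hc 0))]
        · exact j.elim0
  | succ m ih =>
    have h := ih (isAlgebraicSeries_dropLast hf)
    rw [subst_subst _ (hc m)] at h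
    · convert h using 3 with i
      rcases i with i | j
      · simp [dropLast, subst_X (hs (hc m))]
      · refine Fin.lastCases ?_ (fun j => ?_) j
        · simp [dropLast, subst_zero' (hc m)]
        · simp [dropLast, subst_X (hs (hc m))]
    · rintro (i | j)
      · simp [dropLast]
      · refine Fin.lastCases ?_ (fun j => ?_) j <;> simp [dropLast]

theorem IsAlgebraicSeries.coe (p : MvPolynomial σ ℂ) : IsAlgebraicSeries (p : Ser σ) := by
  rw [← algebraMap_polynomial]; exact isAlgebraic_algebraMap p

theorem IsAlgebraicSeries.rename_inl {f : Ser τ} [Finite τ] (hf : IsAlgebraicSeries f) (σ : Type) :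
    IsAlgebraicSeries (subst (fun i => (X (Sum.inl i) : Ser (τ ⊕ σ))) f) := by
  have hc : ∀ i : τ, constantCoeff (X (Sum.inl i) : Ser (τ ⊕ σ)) = 0 := by simp
  have := IsAlgebraic.ringHom_of_comp_eq (B := Ser (τ ⊕ σ))
    (MvPolynomial.rename Sum.inl : MvPolynomial τ ℂ →ₐ[ℂ] MvPolynomial (τ ⊕ σ) ℂ).toRingHom
    (substAlgHom (hs hc)).toRingHom hf (MvPolynomial.rename_injective _ Sum.inl_injective) ?_
  · simpa only [AlgHom.toRingHom_eq_coe, RingHom.coe_coe, coe_substAlgHom, IsAlgebraicSeries] using this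
  · ext p
    · simp [algebraMap_polynomial, coe_substAlgHom]
    · simp [algebraMap_polynomial, coe_substAlgHom, subst_X (hs hc)]

theorem IsAlgebraicSeries.subst_polynomial {R : Type} [CommRing R] [IsDomain R] [Algebra R (Ser τ)]
    [Algebra ℂ R] [IsScalarTower ℂ R (Ser τ)]
    (φ : MvPolynomial σ ℂ →ₐ[ℂ] Ser τ) (hφ : ∀ i, IsAlgebraic R (φ (MvPolynomial.X i)))
    (p : MvPolynomial σ ℂ) : IsAlgebraic R (φ p) := by
  induction p using MvPolynomial.induction_on with
  | C c =>
    rw [← MvPolynomial.algebraMap_eq, AlgHom.commutes, IsScalarTower.algebraMap_apply ℂ R]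
    exact isAlgebraic_algebraMap _
  | add p q hp hq => rw [map_add]; exact hp.add hq
  | mul_X p i hp => rw [map_mul]; exact hp.mul (hφ i)

/-- Substituting `a` directly into a relation for `f` may turn it into 0 = 0. The deformed
substitution x_s ↦ t_s + a_s, with new parameters t, is injective, so the relation survives. Its
coefficients become algebraic elements, and the parameters are set to zero at the end. -/
theorem IsAlgebraicSeries.subst [Finite σ] [Finite τ] {a : σ → Ser τ} {f : Ser σ}
    (ha : ∀ i, constantCoeff (a i) = 0) (hP : ∀ i, IsAlgebraicSeries (a i))
    (hf : IsAlgebraicSeries f) : IsAlgebraicSeries (subst a f) := by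
  obtain ⟨m, ⟨e⟩⟩ := Finite.exists_equiv_fin σ
  have hl : ∀ i : τ, constantCoeff (X (Sum.inl i) : Ser (τ ⊕ Fin m)) = 0 := by simp
  let θ : σ → Ser (τ ⊕ Fin m) := fun s =>
    X (Sum.inr (e s)) + MvPowerSeries.subst (fun i => (X (Sum.inl i) : Ser (τ ⊕ Fin m))) (a s)
  have hθ : ∀ s, constantCoeff (θ s) = 0 := by
    intro s
    simp [θ, constantCoeff_subst_zero hl, ha]
  have hr : ∀ i : τ ⊕ Fin m, constantCoeff
      ((Sum.elim (fun _ => 0) fun j => (X (e.symm j) : Ser σ)) i) = 0 := by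
    rintro (i | j) <;> simp
  -- The left inverse puts the old variables to zero and sends t_s to x_s. The series a_s disappear
  -- because they have no constant term.
  have hinj : Function.Injective (MvPowerSeries.subst θ : Ser σ → Ser (τ ⊕ Fin m)) := by
    apply Function.LeftInverse.injective
      (g := MvPowerSeries.subst (Sum.elim (fun _ => 0) fun j => (X (e.symm j) : Ser σ)))
    intro f
    rw [subst_subst hθ hr]
    convert subst_X_eq f using 2
    funext s
    simp only [θ]
    rw [subst_add (hs hr), subst_X (hs hr), subst_subst hl hr]
    have h0 : (fun i => MvPowerSeries.subst (Sum.elim (fun _ => 0) fun j => (X (e.symm j) : Ser σ))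
        (X (Sum.inl i) : Ser (τ ⊕ Fin m))) = fun _ => 0 := by
      funext i
      rw [subst_X (hs hr), Sum.elim_inl]
    rw [h0, subst_zero_args, ha]
    simp
  have hΘ : IsAlgebraicSeries (MvPowerSeries.subst θ f) := by
    obtain ⟨p, hp, hpf⟩ := hf
    refine isAlgebraic_of_subring
      ((substAlgHom (hs hθ)).toRingHom.comp (algebraMap (MvPolynomial σ ℂ) (Ser σ)))
      ?_ ?_ hp ?_
    · intro p q h
      apply algebraMap_polynomial_injective
      apply hinj
      simpa [coe_substAlgHom] using h
    · have := IsAlgebraicSeries.subst_polynomial (R := MvPolynomial (τ ⊕ Fin m) ℂ)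
        ((substAlgHom (hs hθ)).comp (polyHom σ)) ?_
      · exact this
      · intro i
        have : substAlgHom (hs hθ) (X i : Ser σ) = θ i := by
          rw [coe_substAlgHom, subst_X (hs hθ)]
        rw [AlgHom.comp_apply, polyHom_X, this]
        refine IsAlgebraic.add ?_ ((hP i).rename_inl _)
        simpa [IsAlgebraicSeries] using
          IsAlgebraicSeries.coe (MvPolynomial.X (Sum.inr (e i)) : MvPolynomial (τ ⊕ Fin m) ℂ)
    · have : (substAlgHom (hs hθ)).toRingHom f = MvPowerSeries.subst θ f := by
        simp
      rw [← this, ← Polynomial.hom_eval₂, ← Polynomial.aeval_def, hpf, map_zero]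
  have h := isAlgebraicSeries_dropAll hΘ
  have hd : ∀ i : τ ⊕ Fin m, constantCoeff
      ((Sum.elim (fun i => (X i : Ser τ)) fun _ => 0) i) = 0 := by
    rintro (i | j) <;> simp
  rw [subst_subst hθ hd] at h
  convert h using 2
  funext s
  simp only [θ]
  rw [subst_add (hs hd), subst_X (hs hd), subst_subst hl hd]
  simp [subst_X (hs hd), subst_X_eq]

/-- Polynomials are algebraic over the subring `A` of blown-up polynomials, because X_t = (X_s
X_t)/X_s. So the blow-up of `f` is algebraic over `A`, and injectivity of the blow-up carries the
relation back. -/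
theorem IsAlgebraicSeries.of_blowup [Finite σ] [DecidableEq σ] {s t : σ} {f : Ser σ} (hst : s ≠ t)
    (hf : IsAlgebraicSeries (blowup s t f)) : IsAlgebraicSeries f := by
  have hc := blowup_const (s := s) (t := t)
  let Φ : Ser σ →ₐ[ℂ] Ser σ := substAlgHom (hs hc)
  have hΦ : ∀ f, Φ f = blowup s t f := fun f => by simp [Φ, blowup]
  let β : MvPolynomial σ ℂ →ₐ[ℂ] Ser σ := Φ.comp (polyHom σ)
  let A : Subalgebra ℂ (Ser σ) := β.range
  have : IsDomain A := NoZeroDivisors.to_isDomain _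
  have hβX : ∀ i, β (MvPolynomial.X i) = Function.update (fun i => (X i : Ser σ)) t (X s * X t) i := by
    intro i
    simp only [β, AlgHom.comp_apply, polyHom_X, Φ, coe_substAlgHom, subst_X (hs hc)]
  have hX : ∀ i, i ≠ t → (X i : Ser σ) ∈ A := by
    intro i hi
    refine ⟨MvPolynomial.X i, ?_⟩
    have := hβX i
    rw [Function.update_of_ne hi] at this
    exact this
  have hXt : IsAlgebraic A (X t : Ser σ) := by
    have h1 : (X s : Ser σ) * X t ∈ A := by
      refine ⟨MvPolynomial.X t, ?_⟩
      have := hβX t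
      rw [Function.update_self] at this
      exact this
    apply IsAlgebraic.of_smul (y := ⟨X s, hX s hst⟩)
    · rw [mem_nonZeroDivisors_iff_ne_zero]
      intro h
      have h1 : (X s : Ser σ) = 0 := congrArg Subtype.val h
      simpa using congrArg (coeff (Finsupp.single s 1)) h1
    · exact isAlgebraic_algebraMap (⟨X s * X t, h1⟩ : A)
  have hpoly : ∀ p : MvPolynomial σ ℂ, IsAlgebraic A (algebraMap (MvPolynomial σ ℂ) (Ser σ) p) := by
    refine IsAlgebraicSeries.subst_polynomial (polyHom σ) ?_
    intro i
    rw [polyHom_X]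
    by_cases hi : i = t
    · rw [hi]; exact hXt
    · exact isAlgebraic_algebraMap (⟨X i, hX i hi⟩ : A)
  obtain ⟨p, hp, hpf⟩ := hf
  have h1 : IsAlgebraic A (Φ f) := by
    rw [hΦ]
    exact isAlgebraic_of_subring (algebraMap (MvPolynomial σ ℂ) (Ser σ))
      algebraMap_polynomial_injective hpoly hp hpf
  refine IsAlgebraic.of_ringHom_of_comp_eq (β.rangeRestrict.toRingHom) Φ.toRingHom h1
    β.rangeRestrict_surjective ?_ ?_
  · intro f g h
    exact blowup_injective hst (by rw [← hΦ, ← hΦ]; exact h)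
  · rfl

/-- Since f ≠ 0, it satisfies a relation with nonzero constant coefficient p₀. Putting y = g makes f
vanish and leaves p₀(x,g) = 0, a relation for `g` that is nontrivial because p₀ ≠ 0 as a polynomial
in y over the polynomials in x. -/
theorem IsAlgebraicSeries.implicit [Finite σ] {f : Ser (σ ⊕ Unit)} {g : Ser σ}
    (hg : constantCoeff g = 0) (hf' : constantCoeff (pderiv ℂ (Sum.inr ()) f) ≠ 0)
    (hfg : MvPowerSeries.subst (Sum.elim (fun i => (X i : Ser σ)) (fun _ => g)) f = 0)
    (hf : IsAlgebraicSeries f) : IsAlgebraicSeries g := by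
  have hf0 : f ≠ 0 := by
    rintro rfl
    simp at hf'
  obtain ⟨p, hp, hpf⟩ := hf.exists_nonzero_coeff_and_aeval_eq_zero
    (mem_nonZeroDivisors_of_ne_zero hf0)
  have hc : ∀ i : σ ⊕ Unit, constantCoeff
      ((Sum.elim (fun i => (X i : Ser σ)) fun _ => g) i) = 0 := by
    rintro (i | j) <;> simp [hg]
  let Φ : Ser (σ ⊕ Unit) →ₐ[ℂ] Ser σ := substAlgHom (hs hc)
  have h0 : Φ (algebraMap (MvPolynomial (σ ⊕ Unit) ℂ) _ (p.coeff 0)) = 0 := by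
    have h1 := congrArg Φ.toRingHom hpf
    rw [map_zero, Polynomial.aeval_def, Polynomial.hom_eval₂] at h1
    have h2 : Φ.toRingHom f = 0 := by
      simpa [Φ, coe_substAlgHom] using hfg
    rw [h2, Polynomial.eval₂_at_zero] at h1
    exact h1
  let v : MvPolynomial (σ ⊕ Unit) ℂ →ₐ[ℂ] Polynomial (MvPolynomial σ ℂ) :=
    MvPolynomial.aeval (Sum.elim (fun i => Polynomial.C (MvPolynomial.X i)) fun _ => Polynomial.X)
  have hv : Function.Injective v := by
    let w : Polynomial (MvPolynomial σ ℂ) →+* MvPolynomial (σ ⊕ Unit) ℂ :=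
      Polynomial.eval₂RingHom (MvPolynomial.rename Sum.inl).toRingHom (MvPolynomial.X (Sum.inr ()))
    apply Function.LeftInverse.injective (g := w)
    intro q
    have : w.comp v.toRingHom = RingHom.id _ := by
      ext i
      · simp [w, v]
      · rcases i with i | i <;> simp [w, v]
    exact DFunLike.congr_fun this q
  refine ⟨v (p.coeff 0), (map_ne_zero_iff v hv).mpr hp, ?_⟩
  rw [← h0]
  have : ((Polynomial.aeval g).restrictScalars ℂ).comp v =
      Φ.comp (polyHom (σ ⊕ Unit)) := by
    apply MvPolynomial.algHom_ext
    rintro (i | i) <;>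
    simp [v, Φ, algebraMap_polynomial, polyHom_X, coe_substAlgHom, subst_X (hs hc)]
  exact DFunLike.congr_fun this (p.coeff 0)

theorem isTame_isAlgebraicSeries : IsTame fun _ f => IsAlgebraicSeries f where
  const c := by simpa using IsAlgebraicSeries.coe (MvPolynomial.C c)
  var s := by simpa using IsAlgebraicSeries.coe (MvPolynomial.X s)
  add hf hg := IsAlgebraic.add hf hg
  mul hf hg := IsAlgebraic.mul hf hg
  comp ha hP hf := hf.subst ha hP
  conj {σ f} hf := by
    have := IsAlgebraic.ringHom_of_comp_eq (B := Ser σ)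
      (MvPolynomial.map (σ := σ) (starRingEnd ℂ)) (MvPowerSeries.map (σ := σ) (starRingEnd ℂ))
      hf (MvPolynomial.map_injective _ (starRingEnd ℂ).injective) ?_
    · exact this
    · ext p
      · simp [algebraMap_polynomial]
      · simp [algebraMap_polynomial]
  of_X_mul {σ _} s {f} hf := by
    apply IsAlgebraic.of_smul (y := (MvPolynomial.X s : MvPolynomial σ ℂ))
    · exact mem_nonZeroDivisors_of_ne_zero (MvPolynomial.X_ne_zero s)
    · rw [Algebra.smul_def, algebraMap_polynomial, MvPolynomial.coe_X]
      exact hf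
  of_blowup hst hf := IsAlgebraicSeries.of_blowup hst hf
  implicit hg hf' hfg hf := hf.implicit hg hf' hfg

end Algebraic

end

end FormalCR

namespace FormalCR

open MvPowerSeries

noncomputable section

/-! ### Interpolation: undoing a blow-up for a family with a varying slope. -/

section Interpolation

variable {σ : Type}

/-- The substitution `y ↦ r x_b`. -/
def atSlope (b : σ) (r : ℂ) : σ ⊕ Unit → Ser σ :=
  Sum.elim (fun i => X i) fun _ => C r * X b

theorem atSlope_const (b : σ) (r : ℂ) (i : σ ⊕ Unit) : constantCoeff (atSlope b r i) = 0 := by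
  rcases i with i | i <;> simp [atSlope]

theorem atSlope_inl (b : σ) (r : ℂ) (i : σ) : atSlope b r (Sum.inl i) = X i := rfl

theorem atSlope_inr (b : σ) (r : ℂ) (i : Unit) : atSlope b r (Sum.inr i) = C r * X b := rfl

/-- The exponent of the image of a monomial under `y ↦ r x_b`. -/
def slopeExp [Finite σ] (b : σ) (d : σ ⊕ Unit →₀ ℕ) : σ →₀ ℕ :=
  Finsupp.equivFunOnFinite.symm (fun i => d (Sum.inl i)) + Finsupp.single b (d (Sum.inr ()))

theorem slopeExp_prod [Finite σ] (b : σ) (r : ℂ) (d : σ ⊕ Unit →₀ ℕ) :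
    (d.prod fun i e => atSlope b r i ^ e) = monomial (slopeExp b d) (r ^ d (Sum.inr ())) := by
  classical
  cases nonempty_fintype σ
  rw [Finsupp.prod_fintype _ _ (by simp), Fintype.prod_sum_type]
  have h1 : (monomial (Finsupp.equivFunOnFinite.symm fun i => d (Sum.inl i)) (1 : ℂ) : Ser σ) =
      ∏ i, (X i : Ser σ) ^ d (Sum.inl i) := by
    rw [monomial_one_eq, Finsupp.prod_fintype _ _ (by simp)]
    rfl
  have h2 : (C r * X b : Ser σ) ^ d (Sum.inr ()) =
      monomial (Finsupp.single b (d (Sum.inr ()))) (r ^ d (Sum.inr ())) := by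
    rw [mul_pow, X_pow_eq, ← map_pow, ← monomial_zero_eq_C_apply, monomial_mul_monomial]
    simp
  simp only [atSlope, Sum.elim_inl, Sum.elim_inr, Finset.univ_unique, Finset.prod_singleton]
  rw [← h1, PUnit.default_eq_unit, h2, monomial_mul_monomial, one_mul, slopeExp]

theorem slopeExp_degree [Finite σ] (b : σ) (d : σ ⊕ Unit →₀ ℕ) :
    (slopeExp b d).degree = d.degree := by
  cases nonempty_fintype σ
  rw [slopeExp, map_add, Finsupp.degree_eq_sum, Finsupp.degree_single,
    Finsupp.degree_eq_sum d, Fintype.sum_sum_type]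
  simp

theorem slopeExp_eq [Finite σ] {b : σ} {d d' : σ ⊕ Unit →₀ ℕ} (h : slopeExp b d = slopeExp b d')
    (h' : d (Sum.inr ()) = d' (Sum.inr ())) : d = d' := by
  unfold slopeExp at h
  rw [h'] at h
  have h1 := add_right_cancel h
  ext i
  rcases i with i | i
  · simpa using DFunLike.congr_fun h1 i
  · exact h'

/-- A coefficient of G(x, r x_b) is a polynomial in r. Exponents of `G` with the same image differ
in their y-degree, so the coefficients of this polynomial are single coefficients of `G`. Infinitely
many roots make them all zero. -/
theorem coeff_eq_zero_of_atSlope [Finite σ] {b : σ} {G : Ser (σ ⊕ Unit)} {S : Set ℂ}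
    (hS : S.Infinite) (d : σ ⊕ Unit →₀ ℕ)
    (h : ∀ r ∈ S, coeff (slopeExp b d) (subst (atSlope b r) G) = 0) : coeff d G = 0 := by
  classical
  have hfin : {d' | slopeExp b d' = slopeExp b d}.Finite := by
    refine (Finsupp.finite_of_degree_le d.degree).subset ?_
    intro d' hd'
    simp only [Set.mem_ofPred_eq] at hd' ⊢
    rw [← slopeExp_degree b d', hd', slopeExp_degree]
  let T := hfin.toFinset
  let p : Polynomial ℂ := ∑ d' ∈ T, Polynomial.C (coeff d' G) * Polynomial.X ^ d' (Sum.inr ())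
  have hp : ∀ r, coeff (slopeExp b d) (subst (atSlope b r) G) = p.eval r := by
    intro r
    rw [coeff_subst (hs (atSlope_const b r)), finsum_eq_sum_of_support_subset (s := T)]
    · simp only [p, Polynomial.eval_finsetSum]
      refine Finset.sum_congr rfl fun d' hd' => ?_
      have : slopeExp b d' = slopeExp b d := by simpa [T] using hd'
      rw [slopeExp_prod, this, coeff_monomial_same]
      simp
    · intro d' hd'
      simp only [T, Set.Finite.coe_toFinset, Set.mem_ofPred_eq]
      by_contra hne
      apply hd'
      simp only
      rw [slopeExp_prod, coeff_monomial_ne (Ne.symm hne), smul_zero]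
  have hp0 : p = 0 := by
    apply Polynomial.eq_zero_of_infinite_isRoot
    refine hS.mono fun r hr => ?_
    simp only [Set.mem_ofPred_eq, Polynomial.IsRoot, ← hp, h r hr]
  have hc : p.coeff (d (Sum.inr ())) = coeff d G := by
    simp only [p, Polynomial.finsetSum_coeff, Polynomial.coeff_C_mul_X_pow]
    rw [Finset.sum_eq_single d]
    · simp
    · intro d' hd' hne
      rw [if_neg]
      intro h'
      exact hne (slopeExp_eq (by simpa [T] using hd') h'.symm)
    · simp [T]
  rw [← hc, hp0, Polynomial.coeff_zero]

theorem exists_eq_blowup [Finite σ] [DecidableEq σ] {s t : σ} (hst : s ≠ t) {f : Ser σ}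
    (h : ∀ e : σ →₀ ℕ, e s < e t → coeff e f = 0) :
    ∃ g, f = blowup s t g ∧ ∀ d, coeff d g = coeff (blowupExp s t d) f := by
  obtain ⟨g, hg⟩ := exists_coeff_eq fun d => coeff (blowupExp s t d) f
  refine ⟨g, ?_, hg⟩
  ext e
  rcases lt_or_ge (e s) (e t) with he | he
  · rw [h e he, coeff_blowup_of_notMem g e he hst]
  · have : e = blowupExp s t (e - Finsupp.single s (e t)) := by
      ext i
      by_cases hi : i = s
      · subst hi; simp [blowupExp, hst]; omega
      · simp [blowupExp, hst, Ne.symm hi]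
    rw [this, coeff_blowup hst, hg]

/-- For each slope the left side contains only monomials whose x_a-exponent is at least the
x_b-exponent. With infinitely many slopes this forces every exponent of `G` to satisfy d_a ≥ d_b +
d_y. Hence G(x,y) arises from a series F by the blow-ups x_b ↦ x_a x_b and y ↦ x_a y, and F is the
interpolating series. -/
theorem exists_interpolation_of_infinite [Finite σ] [DecidableEq σ] {ι : Type} {a b : σ}
    (hab : a ≠ b) (G : Ser (σ ⊕ Unit)) (K : ι → Ser σ) (r : ι → ℂ)
    (h : ∀ i, blowup a b (K i) = subst (atSlope b (r i)) G) (hr : (Set.range r).Infinite) :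
    ∃ F : Ser (σ ⊕ Unit), (∀ i, K i = subst (atSlope b (r i)) F) ∧
      ∀ P, IsTame P → P _ G → P _ F := by
  have hG : ∀ d : σ ⊕ Unit →₀ ℕ, d (Sum.inl a) < d (Sum.inl b) + d (Sum.inr ()) →
      coeff d G = 0 := by
    intro d hd
    apply coeff_eq_zero_of_atSlope hr
    rintro _ ⟨i, rfl⟩
    rw [← h]
    apply coeff_blowup_of_notMem _ _ _ hab
    simpa [slopeExp, Finsupp.single_apply, hab.symm] using hd
  have h1 : (Sum.inl a : σ ⊕ Unit) ≠ Sum.inr () := by simp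
  have h2 : (Sum.inl a : σ ⊕ Unit) ≠ Sum.inl b := by simpa using hab
  obtain ⟨G1, hG1, hG1c⟩ := exists_eq_blowup h1 (f := G) fun e he => hG e (by omega)
  obtain ⟨F, hF, -⟩ := exists_eq_blowup h2 (f := G1) fun e he => by
    rw [hG1c]
    apply hG
    simp only [blowupExp, Finsupp.add_apply, Finsupp.single_apply]
    simp [hab]
    omega
  refine ⟨F, fun i => ?_, fun P hP hPG => ?_⟩
  · apply blowup_injective hab
    rw [h, hG1, hF]
    unfold blowup
    rw [subst_subst (blowup_const _ _) (blowup_const _ _),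
      subst_subst _ (atSlope_const _ _), subst_subst (atSlope_const _ _) (blowup_const _ _)]
    · congr 1
      funext j
      have hX := fun i => subst_X (hs (atSlope_const b (r i))) (R := ℂ)
      have hm := fun i => subst_mul (hs (atSlope_const b (r i))) (R := ℂ)
      have hB := subst_X (hs (blowup_const a b)) (R := ℂ)
      have hBm := subst_mul (hs (blowup_const a b)) (R := ℂ)
      have hB' := subst_X (hs (blowup_const (Sum.inl a : σ ⊕ Unit) (Sum.inl b))) (R := ℂ)
      have hC' := subst_X (hs (blowup_const (Sum.inl a : σ ⊕ Unit) (Sum.inr ()))) (R := ℂ)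
      have hCm := subst_mul (hs (blowup_const (Sum.inl a : σ ⊕ Unit) (Sum.inr ()))) (R := ℂ)
      rcases j with j | j
      · rw [atSlope_inl, hB]
        by_cases hj : j = b
        · subst hj
          rw [Function.update_self, Function.update_self, hCm, hC', hC',
            Function.update_of_ne h1, Function.update_of_ne (by simp), hm, hX, hX, atSlope_inl,
            atSlope_inl]
        · rw [Function.update_of_ne hj, Function.update_of_ne (by simpa using hj), hC',
            Function.update_of_ne (by simp), hX, atSlope_inl]
      · rw [atSlope_inr, hBm, subst_C' _, hB, Function.update_self,
          Function.update_of_ne (by simp), hC', Function.update_self, hm, hX, hX, atSlope_inl,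
          atSlope_inr]
        ring
    · intro j
      rw [constantCoeff_subst_zero (blowup_const _ _), blowup_const]
  · rw [hG1, hF] at hPG
    exact hP.of_blowup h2 (hP.of_blowup h1 hPG)

/-- The translation `y ↦ y + c x_b`. -/
def slopeShift (b : σ) (c : ℂ) : σ ⊕ Unit → Ser (σ ⊕ Unit) :=
  Sum.elim (fun i => X (Sum.inl i)) fun _ => X (Sum.inr ()) + C c * X (Sum.inl b)

theorem slopeShift_const (b : σ) (c : ℂ) (i : σ ⊕ Unit) :
    constantCoeff (slopeShift b c i) = 0 := by
  rcases i with i | i <;> simp [slopeShift]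

theorem subst_slopeShift [Finite σ] (b : σ) (c r : ℂ) (f : Ser (σ ⊕ Unit)) :
    subst (atSlope b r) (subst (slopeShift b c) f) = subst (atSlope b (r + c)) f := by
  rw [subst_subst (slopeShift_const b c) (atSlope_const b r)]
  congr 1
  funext i
  have hX := subst_X (hs (atSlope_const b r)) (R := ℂ)
  rcases i with i | i
  · exact hX _
  · simp only [slopeShift, Sum.elim_inr]
    rw [subst_add (hs (atSlope_const b r)), subst_mul (hs (atSlope_const b r)),
      subst_C', hX, hX, atSlope_inl, atSlope_inr, atSlope_inr, map_add]
    ring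

theorem IsTame.slopeShift [Finite σ] {P : ∀ σ : Type, Ser σ → Prop} (hP : IsTame P) (b : σ) (c : ℂ)
    {f : Ser (σ ⊕ Unit)} (hf : P _ f) : P _ (subst (FormalCR.slopeShift b c) f) := by
  refine hP.comp (slopeShift_const b c) ?_ hf
  rintro (i | i)
  · exact hP.var _
  · exact hP.add (hP.var _) (hP.mul (hP.const _) (hP.var _))

theorem IsTame.of_X_pow_mul [Finite σ] {P : ∀ σ : Type, Ser σ → Prop} (hP : IsTame P) (s : σ)
    (e : ℕ) {f : Ser σ} (hf : P σ (X s ^ e * f)) : P σ f := by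
  induction e with
  | zero => simpa using hf
  | succ e ih =>
    rw [pow_succ', mul_assoc] at hf
    exact ih (hP.of_X_mul s hf)

theorem X_ne_zero' (s : σ) : (X s : Ser σ) ≠ 0 := by
  intro h
  simpa using congrArg (coeff (Finsupp.single s 1)) h

/-- On x_b = 0 the blow-up acts trivially, so the divisibility can be tested there. -/
theorem X_dvd_of_X_pow_mul_blowup [Finite σ] [DecidableEq σ] {a b : σ} (hab : a ≠ b) {e : ℕ}
    {f : Ser σ} (h : (X b : Ser σ) ∣ X a ^ e * blowup a b f) : (X b : Ser σ) ∣ f := by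
  have hk := kill_const ({b} : Finset σ)
  obtain ⟨g, hg⟩ := X_dvd_sub_kill b f
  suffices h0 : kill {b} f = 0 by
    rw [h0, sub_zero] at hg
    exact ⟨g, hg⟩
  have h1 : kill {b} (X a ^ e * blowup a b f) = 0 := by
    obtain ⟨u, hu⟩ := h
    rw [hu]
    unfold kill
    rw [subst_mul (hs hk), subst_X (hs hk)]
    simp
  have h2 : kill {b} (X a ^ e * blowup a b f) = X a ^ e * kill {b} f := by
    unfold kill
    rw [subst_mul (hs hk), subst_pow (hs hk), subst_X (hs hk), if_neg (by simpa using hab)]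
    unfold blowup
    rw [subst_subst (blowup_const a b) hk]
    congr 2
    funext i
    by_cases hi : i = b
    · subst hi
      rw [Function.update_self, subst_mul (hs hk), subst_X (hs hk), subst_X (hs hk)]
      simp
    · rw [Function.update_of_ne hi, subst_X (hs hk)]
  rw [h2] at h1
  exact (mul_eq_zero.mp h1).resolve_left (pow_ne_zero _ (X_ne_zero' a))

/-- For finitely many slopes `G` need not itself be a blow-up, and Newton interpolation takes over.
Each step moves one slope to 0 by a translation in y and passes to divided differences (K_i −
K_{i₀})/((r_i − r_{i₀})x_b), with one slope less. The exponent `e` records the powers of x_a that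
accumulate. -/
theorem exists_interpolation_of_finite [Finite σ] [DecidableEq σ] {a b : σ} (hab : a ≠ b) (m : ℕ) :
    ∀ {ι : Type} (e : ℕ) (G : Ser (σ ⊕ Unit)) (K : ι → Ser σ) (r : ι → ℂ) (S : Finset ℂ),
      (∀ i, r i ∈ S) → S.card ≤ m →
      (∀ i, X a ^ e * blowup a b (K i) = subst (atSlope b (r i)) G) →
      ∃ F : Ser (σ ⊕ Unit), (∀ i, K i = subst (atSlope b (r i)) F) ∧
        ∀ P, IsTame P → P _ G → P _ F := by
  induction m with
  | zero =>
    intro ι e G K r S hS hm h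
    have : S = ∅ := by simpa using hm
    subst this
    exact ⟨0, fun i => absurd (hS i) (by simp), fun P hP _ => hP.zero⟩
  | succ m ih =>
    intro ι e G K r S hS hm h
    rcases isEmpty_or_nonempty ι with hι | ⟨⟨i0⟩⟩
    · exact ⟨0, fun i => isEmptyElim i, fun P hP _ => hP.zero⟩
    let G' := subst (slopeShift b (r i0)) G
    have hG' : ∀ i, X a ^ e * blowup a b (K i) = subst (atSlope b (r i - r i0)) G' := by
      intro i
      rw [h, subst_slopeShift, sub_add_cancel]
    obtain ⟨G1, hG1⟩ := X_dvd_sub_kill (Sum.inr () : σ ⊕ Unit) G'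
    have hk := kill_const ({Sum.inr ()} : Finset (σ ⊕ Unit))
    have hkill : ∀ c, subst (atSlope b c) (kill {Sum.inr ()} G') = subst (atSlope b 0) G' := by
      intro c
      unfold kill
      rw [subst_subst hk (atSlope_const b c)]
      congr 1
      funext i
      rcases i with i | i
      · rw [if_neg (by simp), subst_X (hs (atSlope_const b c))]; rfl
      · rw [if_pos (by simp), subst_zero' (atSlope_const b c)]
        simp [atSlope]
    have hdiff : ∀ i, X a ^ e * blowup a b (K i - K i0) =
        X b * (C (r i - r i0) * subst (atSlope b (r i - r i0)) G1) := by
      intro i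
      have e1 : blowup a b (K i - K i0) = blowup a b (K i) - blowup a b (K i0) :=
        subst_sub (hs (blowup_const a b)) _ _
      have e2 : subst (atSlope b (r i - r i0)) (G' - kill {Sum.inr ()} G') =
          subst (atSlope b (r i - r i0)) G' - subst (atSlope b 0) G' := by
        rw [subst_sub (hs (atSlope_const b _)), hkill]
      rw [e1, mul_sub, hG', hG', sub_self, ← e2, hG1, subst_mul (hs (atSlope_const b _)),
        subst_X (hs (atSlope_const b _)), atSlope_inr]
      ring
    have hdvd : ∀ i, ∃ g, K i - K i0 = X b * g := fun i =>
      X_dvd_of_X_pow_mul_blowup hab ⟨_, hdiff i⟩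
    choose K' hK' using hdvd
    -- The blow-up of x_b is x_a x_b, so cancelling x_b against G′(x,y) − G′(x,0) = y G₁ leaves one
    -- additional factor x_a.
    have hK'' : ∀ i : {i // r i ≠ r i0}, X a ^ (e + 1) *
        blowup a b (C (r i - r i0)⁻¹ * K' i) = subst (atSlope b (r i - r i0)) G1 := by
      rintro ⟨i, hi⟩
      have h0 : r i - r i0 ≠ 0 := sub_ne_zero.mpr hi
      have h1 := hdiff i
      rw [hK'] at h1
      have e1 : ∀ f g, blowup a b (f * g) = blowup a b f * blowup a b g :=
        subst_mul (hs (blowup_const a b))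
      have e2 : blowup a b (X b) = X a * X b := by
        unfold blowup
        rw [subst_X (hs (blowup_const a b)), Function.update_self]
      have e3 : ∀ c, blowup a b (C c) = C c := subst_C' _
      rw [e1, e2] at h1
      have h2 : X b * (X a ^ (e + 1) * blowup a b (K' i)) =
          X b * (C (r i - r i0) * subst (atSlope b (r i - r i0)) G1) := by
        rw [← h1]; ring
      have h3 := mul_left_cancel₀ (X_ne_zero' b) h2
      simp only
      rw [e1, e3, mul_left_comm, h3, ← mul_assoc, ← map_mul, inv_mul_cancel₀ h0, map_one, one_mul]
    obtain ⟨F1, hF1, hF1P⟩ := ih (ι := {i // r i ≠ r i0}) (e + 1) G1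
      (fun i => C (r i - r i0)⁻¹ * K' i) (fun i => r i - r i0)
      ((S.erase (r i0)).image fun c => c - r i0)
      (fun i => Finset.mem_image_of_mem _ (Finset.mem_erase.mpr ⟨i.2, hS i⟩))
      (le_trans Finset.card_image_le (by rw [Finset.card_erase_of_mem (hS i0)]; omega)) hK''
    let K0 : Ser (σ ⊕ Unit) := subst (fun i => (X (Sum.inl i) : Ser (σ ⊕ Unit))) (K i0)
    have hl : ∀ i : σ, constantCoeff (X (Sum.inl i) : Ser (σ ⊕ Unit)) = 0 := by simp
    have hK0 : ∀ c, subst (atSlope b c) K0 = K i0 := by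
      intro c
      simp only [K0]
      rw [subst_subst hl (atSlope_const b c)]
      convert subst_X_eq (K i0) using 2
      funext i
      rw [subst_X (hs (atSlope_const b c)), atSlope_inl]
    refine ⟨subst (slopeShift b (-r i0)) (K0 + X (Sum.inr ()) * F1), fun i => ?_,
      fun P hP hPG => ?_⟩
    · rw [subst_slopeShift, ← sub_eq_add_neg, subst_add (hs (atSlope_const b _)), hK0,
        subst_mul (hs (atSlope_const b _)), subst_X (hs (atSlope_const b _)), atSlope_inr]
      -- Members with the same slope as the base member have the same blow-up, hence coincide with
      -- it.
      by_cases hi : r i = r i0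
      · have h1 := hdiff i
        rw [hi, sub_self, map_zero, zero_mul, mul_zero] at h1
        have h2 := (mul_eq_zero.mp h1).resolve_left (pow_ne_zero _ (X_ne_zero' a))
        have h3 : blowup a b 0 = 0 := subst_zero' (blowup_const a b)
        have h4 := blowup_injective hab (h2.trans h3.symm)
        rw [hi, sub_self, map_zero, zero_mul, zero_mul, add_zero, ← sub_eq_zero, h4]
      · rw [← hF1 ⟨i, hi⟩, mul_right_comm, ← mul_assoc, ← map_mul,
          mul_inv_cancel₀ (sub_ne_zero.mpr hi), map_one, one_mul, mul_comm, ← hK']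
        ring
    · have hPG' : P _ G' := hP.slopeShift b _ hPG
      -- The base member is regular because its blow-up is the value of `G'` at slope 0, up to a
      -- power of x_a.
      have hPK : P _ (K i0) := by
        have h1 : P _ (X a ^ e * blowup a b (K i0)) := by
          rw [hG', sub_self]
          refine hP.comp (atSlope_const b _) ?_ hPG'
          rintro (i | i)
          · exact hP.var _
          · exact hP.mul (hP.const _) (hP.var _)
        exact hP.of_blowup hab (hP.of_X_pow_mul a e h1)
      refine hP.slopeShift b _ (hP.add ?_ (hP.mul (hP.var _) (hF1P P hP ?_)))
      · exact hP.comp hl (fun i => hP.var _) hPK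
      · apply hP.of_X_mul (Sum.inr ())
        rw [← hG1]
        exact hP.sub hPG' (hP.kill _ hPG')

/-- A family `H_i` with `H_i(x, x_a x_b) = G(x, r_i x_b)` is of the form `F(x, r_i x_b)`, where
`F` is as tame as `G`. -/
theorem exists_interpolation [Finite σ] [DecidableEq σ] {ι : Type} {a b : σ}
    (hab : a ≠ b) (G : Ser (σ ⊕ Unit)) (K : ι → Ser σ) (r : ι → ℂ)
    (h : ∀ i, blowup a b (K i) = subst (atSlope b (r i)) G) :
    ∃ F : Ser (σ ⊕ Unit), (∀ i, K i = subst (atSlope b (r i)) F) ∧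
      ∀ P, IsTame P → P _ G → P _ F := by
  by_cases hr : (Set.range r).Infinite
  · exact exists_interpolation_of_infinite hab G K r h hr
  · rw [Set.not_infinite] at hr
    exact exists_interpolation_of_finite hab _ 0 G K r hr.toFinset (by simp) le_rfl
      (by simpa using h)

end Interpolation

end

end FormalCR

namespace FormalCR

open MvPowerSeries

noncomputable section

/-! ### Conjugation of coefficients and the reflection exchanging Z and ζ. -/

section Conjugation

variable {σ τ ι : Type}

theorem conj_subst [Finite σ] {a : σ → Ser τ} (ha : ∀ i, constantCoeff (a i) = 0) (f : Ser σ) :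
    conj (subst a f) = subst (fun i => conj (a i)) (conj f) :=
  map_subst (hs ha) f

theorem conj_add (f g : Ser σ) : conj (f + g) = conj f + conj g := map_add _ _ _

theorem conj_mul (f g : Ser σ) : conj (f * g) = conj f * conj g := map_mul _ _ _

theorem conj_X (i : σ) : conj (X i : Ser σ) = X i := map_X _ _

theorem conj_C (c : ℂ) : conj (C c : Ser σ) = C (starRingEnd ℂ c) := map_C _ _

theorem conj_zero : conj (0 : Ser σ) = 0 := map_zero _

theorem conj_conj (f : Ser σ) : conj (conj f) = f := by
  ext d
  simp [conj]

theorem constantCoeff_conj (f : Ser σ) :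
    constantCoeff (conj f) = starRingEnd ℂ (constantCoeff f) := by
  rw [← coeff_zero_eq_constantCoeff_apply, ← coeff_zero_eq_constantCoeff_apply, conj, coeff_map]

theorem pderiv_conj (i : σ) (f : Ser σ) : pderiv ℂ i (conj f) = conj (pderiv ℂ i f) := by
  ext d
  simp [conj, coeff_pderiv]

/-- Exchange of `Z` and `ζ`. -/
def swapVar : ι ⊕ ι → Series2 ι := Sum.elim (fun j => X (Sum.inr j)) fun j => X (Sum.inl j)

theorem swapVar_const (i : ι ⊕ ι) : constantCoeff (swapVar i) = 0 := by
  rcases i with i | i <;> simp [swapVar]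

@[simp] theorem swapVar_inl (j : ι) : swapVar (Sum.inl j : ι ⊕ ι) = X (Sum.inr j) := rfl

@[simp] theorem swapVar_inr (j : ι) : swapVar (Sum.inr j : ι ⊕ ι) = X (Sum.inl j) := rfl

theorem reflect_eq (φ : Series2 ι) : reflect φ = subst swapVar (conj φ) := rfl

variable [Finite ι]

theorem reflect_reflect (φ : Series2 ι) : reflect (reflect φ) = φ := by
  rw [reflect_eq, reflect_eq, conj_subst swapVar_const, conj_conj, subst_subst _ swapVar_const]
  · convert subst_X_eq φ using 2
    funext i
    rcases i with i | i <;> simp [conj_X, subst_X (hs (swapVar_const (ι := ι)))]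
  · intro i
    rw [constantCoeff_conj, swapVar_const, map_zero]

theorem reflect_add (φ ψ : Series2 ι) : reflect (φ + ψ) = reflect φ + reflect ψ := by
  rw [reflect_eq, conj_add, subst_add (hs swapVar_const)]; rfl

theorem reflect_mul (φ ψ : Series2 ι) : reflect (φ * ψ) = reflect φ * reflect ψ := by
  rw [reflect_eq, conj_mul, subst_mul (hs swapVar_const)]; rfl

theorem constantCoeff_reflect (φ : Series2 ι) :
    constantCoeff (reflect φ) = starRingEnd ℂ (constantCoeff φ) := by
  rw [reflect_eq, constantCoeff_subst_zero swapVar_const, constantCoeff_conj]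

theorem pderiv_inl_reflect (j : ι) (φ : Series2 ι) :
    pderiv ℂ (Sum.inl j) (reflect φ) = reflect (pderiv ℂ (Sum.inr j) φ) := by
  classical
  cases nonempty_fintype ι
  rw [reflect_eq, pderiv_subst swapVar_const, Fintype.sum_sum_type]
  simp [swapVar, pderiv_X, Pi.single_apply, pderiv_conj, reflect]

theorem pderiv_inr_reflect (j : ι) (φ : Series2 ι) :
    pderiv ℂ (Sum.inr j) (reflect φ) = reflect (pderiv ℂ (Sum.inl j) φ) := by
  rw [← reflect_reflect (pderiv ℂ (Sum.inr j) (reflect φ)), ← pderiv_inl_reflect, reflect_reflect]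

theorem reflect_mem {I : Ideal (Series2 ι)} {ρ : Series2 ι} (hρ : IsDefiningFunction I ρ)
    {φ : Series2 ι} (hφ : φ ∈ I) : reflect φ ∈ I := by
  have := hφ
  rw [hρ.generates, Ideal.mem_span_singleton] at this
  obtain ⟨c, rfl⟩ := this
  rw [reflect_mul]
  exact I.mul_mem_right _ hρ.real

end Conjugation

/-! ### Coordinates (z,χ,τ) on the hypersurface w = Q. -/

section Restriction

variable {n : ℕ}

/-- The indeterminates `(z, χ, τ)`. -/
abbrev CRVar (n : ℕ) : Type := Fin n ⊕ Fin n ⊕ Unit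

/-- The point `(z, Q(z, χ, τ))`. -/
def onZ (Q : Ser (CRVar n)) : Fin (n + 1) → Ser (CRVar n) :=
  Fin.lastCases Q fun j => X (Sum.inl j)

/-- The point `(χ, τ)`. -/
def onZeta : Fin (n + 1) → Ser (CRVar n) :=
  Fin.lastCases (X (Sum.inr (Sum.inr ()))) fun j => X (Sum.inr (Sum.inl j))

/-- The restriction to the hypersurface `w = Q(z, χ, τ)`. -/
def restrict (Q : Ser (CRVar n)) (φ : Series2 (Fin (n + 1))) : Ser (CRVar n) :=
  subst (Sum.elim (onZ Q) onZeta) φ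

/-- The inclusion of the `(z, χ, τ)` into `(Z, ζ)`. -/
def normalVar : CRVar n → Series2 (Fin (n + 1)) :=
  Sum.elim (fun j : Fin n => X (Sum.inl j.castSucc))
    (Sum.elim (fun j : Fin n => X (Sum.inr j.castSucc)) fun _ : Unit => X (Sum.inr (Fin.last n)))

@[simp] theorem normalVar_inl (j : Fin n) :
    normalVar (Sum.inl j : CRVar n) = X (Sum.inl j.castSucc) := rfl

@[simp] theorem normalVar_inr_inl (j : Fin n) :
    normalVar (Sum.inr (Sum.inl j) : CRVar n) = X (Sum.inr j.castSucc) := rfl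

@[simp] theorem normalVar_inr_inr (j : Unit) :
    normalVar (Sum.inr (Sum.inr j) : CRVar n) = X (Sum.inr (Fin.last n)) := rfl

theorem normalSubst_eq (f : Ser (CRVar n)) : normalSubst f = subst normalVar f := rfl

theorem normalVar_const (i : CRVar n) : constantCoeff (normalVar i) = 0 := by
  rcases i with i | i | i <;> simp [normalVar]

@[simp] theorem onZ_castSucc (Q : Ser (CRVar n)) (j : Fin n) : onZ Q j.castSucc = X (Sum.inl j) := by
  simp [onZ]

@[simp] theorem onZ_last (Q : Ser (CRVar n)) : onZ Q (Fin.last n) = Q := by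
  simp [onZ]

@[simp] theorem onZeta_castSucc (j : Fin n) :
    (onZeta j.castSucc : Ser (CRVar n)) = X (Sum.inr (Sum.inl j)) := by
  simp [onZeta]

@[simp] theorem onZeta_last : (onZeta (Fin.last n) : Ser (CRVar n)) = X (Sum.inr (Sum.inr ())) := by
  simp [onZeta]

theorem onZ_const {Q : Ser (CRVar n)} (hQ : constantCoeff Q = 0) (j : Fin (n + 1)) :
    constantCoeff (onZ Q j) = 0 := by
  refine Fin.lastCases ?_ (fun j => ?_) j <;> simp [hQ]

theorem onZeta_const (j : Fin (n + 1)) : constantCoeff (onZeta j : Ser (CRVar n)) = 0 := by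
  refine Fin.lastCases ?_ (fun j => ?_) j <;> simp

theorem restrict_const {Q : Ser (CRVar n)} (hQ : constantCoeff Q = 0)
    (i : Fin (n + 1) ⊕ Fin (n + 1)) : constantCoeff (Sum.elim (onZ Q) onZeta i) = 0 :=
  elim_const (onZ_const hQ) onZeta_const i

theorem restrict_normalSubst {Q : Ser (CRVar n)} (hQ : constantCoeff Q = 0) (f : Ser (CRVar n)) :
    restrict Q (normalSubst f) = f := by
  rw [restrict, normalSubst_eq, subst_subst normalVar_const (restrict_const hQ)]
  convert subst_X_eq f using 2
  funext i
  rcases i with i | i | i <;> simp [subst_X (hs (restrict_const hQ))]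

/-- Modulo w − Q a series is congruent to its restriction written again in (Z,ζ), so the ideal is
exactly the kernel of the restriction. -/
theorem restrict_eq_zero_iff {Q : Ser (CRVar n)} (hQ : constantCoeff Q = 0)
    (φ : Series2 (Fin (n + 1))) : restrict Q φ = 0 ↔
      φ ∈ Ideal.span {(X (Sum.inl (Fin.last n)) : Series2 (Fin (n + 1))) - normalSubst Q} := by
  have hr := restrict_const hQ
  constructor
  · intro h
    have key := subst_sub_mem φ (X_const (σ := Fin (n + 1) ⊕ Fin (n + 1)))
      (b := fun i => subst normalVar (Sum.elim (onZ Q) onZeta i))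
      (fun i => by rw [constantCoeff_subst_zero normalVar_const, hr])
      (I := Ideal.span {(X (Sum.inl (Fin.last n)) : Series2 (Fin (n + 1))) - normalSubst Q}) ?_
    · rw [subst_X_eq, ← subst_subst hr normalVar_const] at key
      rw [restrict] at h
      rwa [h, subst_zero' normalVar_const, sub_zero] at key
    · have hX := subst_X (hs (normalVar_const (n := n))) (R := ℂ)
      rintro (i | i)
      · refine Fin.lastCases ?_ (fun j => ?_) i
        · simp only [Sum.elim_inl, onZ_last]
          exact Ideal.mem_span_singleton_self _
        · simp [hX]
      · refine Fin.lastCases ?_ (fun j => ?_) i <;> simp [hX]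
  · intro h
    obtain ⟨c, rfl⟩ := Ideal.mem_span_singleton.mp h
    have h1 := restrict_normalSubst hQ Q
    unfold restrict at *
    rw [subst_mul (hs hr), subst_sub (hs hr), h1, subst_X (hs hr)]
    simp

theorem pderiv_z_restrict {Q : Ser (CRVar n)} (hQ : constantCoeff Q = 0) (j : Fin n)
    (φ : Series2 (Fin (n + 1))) : pderiv ℂ (Sum.inl j) (restrict Q φ) =
      restrict Q (pderiv ℂ (Sum.inl j.castSucc) φ) +
        restrict Q (pderiv ℂ (Sum.inl (Fin.last n)) φ) * pderiv ℂ (Sum.inl j) Q := by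
  classical
  unfold restrict
  rw [pderiv_subst (restrict_const hQ), Fintype.sum_sum_type, Fin.sum_univ_castSucc,
    Fin.sum_univ_castSucc]
  simp [pderiv_X, Pi.single_apply]

/-- The coefficients of the CR field `∂/∂χ_j + (Q_{z_j})‾(χ, z, w) ∂/∂τ`. -/
def crField (Q : Ser (CRVar n)) (j : Fin n) : Fin (n + 1) → Series2 (Fin (n + 1)) :=
  Fin.lastCases (reflect (normalSubst (pderiv ℂ (Sum.inl j) Q))) (Pi.single j 1)

theorem field01_crField (Q : Ser (CRVar n)) (j : Fin n) (φ : Series2 (Fin (n + 1))) :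
    field01 (crField Q j) φ = pderiv ℂ (Sum.inr j.castSucc) φ +
      reflect (normalSubst (pderiv ℂ (Sum.inl j) Q)) * pderiv ℂ (Sum.inr (Fin.last n)) φ := by
  unfold field01
  rw [Fin.sum_univ_castSucc]
  simp [crField, Pi.single_apply]

theorem restrict_add {Q : Ser (CRVar n)} (hQ : constantCoeff Q = 0)
    (φ ψ : Series2 (Fin (n + 1))) : restrict Q (φ + ψ) = restrict Q φ + restrict Q ψ :=
  subst_add (hs (restrict_const hQ)) _ _

theorem restrict_mul {Q : Ser (CRVar n)} (hQ : constantCoeff Q = 0)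
    (φ ψ : Series2 (Fin (n + 1))) : restrict Q (φ * ψ) = restrict Q φ * restrict Q ψ :=
  subst_mul (hs (restrict_const hQ)) _ _

/-- After reflection and restriction the CR field becomes the coordinate derivative ∂/∂z_j. This
turns statements on iterated CR derivatives into statements on Taylor coefficients in z. -/
theorem restrict_reflect_field01 {Q : Ser (CRVar n)} (hQ : constantCoeff Q = 0) (j : Fin n)
    (φ : Series2 (Fin (n + 1))) : restrict Q (reflect (field01 (crField Q j) φ)) =
      pderiv ℂ (Sum.inl j) (restrict Q (reflect φ)) := by
  rw [pderiv_z_restrict hQ, field01_crField, reflect_add, reflect_mul, reflect_reflect,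
    pderiv_inl_reflect, pderiv_inl_reflect, restrict_add hQ, restrict_mul hQ,
    restrict_normalSubst hQ, mul_comm]

end Restriction

/-! ### The module E and the vanishing of its maximal minors. -/

section Degeneracy

variable {n : ℕ} {ι κ : Type}

theorem isCRField_crField {M : FormalHypersurface (Fin (n + 1))} {Q : Ser (CRVar n)}
    (hQ : constantCoeff Q = 0)
    (hM : M.ideal = Ideal.span {X (Sum.inl (Fin.last n)) - normalSubst Q}) (j : Fin n) :
    IsCRField M (crField Q j) := by
  obtain ⟨ρ, hρ⟩ := M.exists_definingFunction
  have hiff : ∀ φ, restrict Q φ = 0 ↔ φ ∈ M.ideal := fun φ => by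
    rw [hM]; exact restrict_eq_zero_iff hQ φ
  intro φ hφ
  rw [← reflect_reflect (field01 _ _)]
  apply reflect_mem hρ
  rw [← hiff, restrict_reflect_field01 hQ, (hiff _).mpr (reflect_mem hρ hφ), map_zero]

theorem field01_add [Fintype ι] (b : ι → Series2 ι) (φ ψ : Series2 ι) :
    field01 b (φ + ψ) = field01 b φ + field01 b ψ := by
  simp [field01, mul_add, Finset.sum_add_distrib]

theorem field01_sub [Fintype ι] (b : ι → Series2 ι) (φ ψ : Series2 ι) :
    field01 b (φ - ψ) = field01 b φ - field01 b ψ := by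
  simp [field01, mul_sub, Finset.sum_sub_distrib]

theorem field01_mul [Fintype ι] (b : ι → Series2 ι) (φ ψ : Series2 ι) :
    field01 b (φ * ψ) = φ * field01 b ψ + field01 b φ * ψ := by
  simp only [field01, Derivation.leibniz, smul_eq_mul, Finset.mul_sum, Finset.sum_mul]
  rw [← Finset.sum_add_distrib]
  exact Finset.sum_congr rfl fun i _ => by ring

/-- The Leibniz rule makes E stable under CR fields, although it is spanned with arbitrary
coefficients. -/
theorem field01_mem_degeneracyModule [Fintype ι] {M : FormalHypersurface ι} {H : FormalMap ι κ}
    {ρ' : Series2 κ} {b : ι → Series2 ι} (hb : IsCRField M b) {v : κ → Series2 ι}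
    (hv : v ∈ degeneracyModule M H ρ') :
    (fun i => field01 b (v i)) ∈ degeneracyModule M H ρ' := by
  induction hv using Submodule.span_induction with
  | mem v hv =>
    obtain ⟨L, hL, rfl⟩ := hv
    apply Submodule.subset_span
    exact ⟨b :: L, by simpa using ⟨hb, hL⟩, rfl⟩
  | zero =>
    have : (fun i => field01 b ((0 : κ → Series2 ι) i)) = 0 := by
      funext i; simp [field01]
    rw [this]; exact Submodule.zero_mem _
  | add v w _ _ hv hw =>
    have : (fun i => field01 b ((v + w) i)) =
        (fun i => field01 b (v i)) + fun i => field01 b (w i) := by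
      funext i; exact field01_add _ _ _
    rw [this]; exact Submodule.add_mem _ hv hw
  | smul a v hv' hv =>
    have : (fun i => field01 b ((a • v) i)) =
        a • (fun i => field01 b (v i)) + field01 b a • v := by
      funext i; exact field01_mul _ _ _
    rw [this]
    exact Submodule.add_mem _ (Submodule.smul_mem _ _ hv) (Submodule.smul_mem _ _ hv')

/-- Congruence of `v` modulo the ideal of `M` to an element of the module `E`. -/
def InDegeneracyModule [Fintype ι] (M : FormalHypersurface ι) (H : FormalMap ι κ)
    (ρ' : Series2 κ) (v : κ → Series2 ι) : Prop :=
  ∃ e ∈ degeneracyModule M H ρ', ∀ i, v i - e i ∈ M.ideal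

theorem InDegeneracyModule.field01 [Fintype ι] {M : FormalHypersurface ι} {H : FormalMap ι κ}
    {ρ' : Series2 κ} {b : ι → Series2 ι} (hb : IsCRField M b) {v : κ → Series2 ι}
    (hv : InDegeneracyModule M H ρ' v) :
    InDegeneracyModule M H ρ' fun i => field01 b (v i) := by
  obtain ⟨e, he, hve⟩ := hv
  refine ⟨_, field01_mem_degeneracyModule hb he, fun i => ?_⟩
  rw [← field01_sub]
  exact hb _ (hve i)

/-- The point `(H(Z), H̄(ζ))`. -/
def sharpVar (H : FormalMap ι κ) : κ ⊕ κ → Series2 ι :=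
  Sum.elim (fun i => inZ (H.toFun i)) fun i => inZeta (conj (H.toFun i))

@[simp] theorem sharpVar_inl (H : FormalMap ι κ) (i : κ) :
    sharpVar H (Sum.inl i) = inZ (H.toFun i) := rfl

@[simp] theorem sharpVar_inr (H : FormalMap ι κ) (i : κ) :
    sharpVar H (Sum.inr i) = inZeta (conj (H.toFun i)) := rfl

theorem sharp_eq (H : FormalMap ι κ) (φ : Series2 κ) : H.sharp φ = subst (sharpVar H) φ := rfl

theorem sharp_const [Finite ι] (H : FormalMap ι κ) (i : κ ⊕ κ) :
    constantCoeff (sharpVar H i) = 0 := by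
  rcases i with i | i
  · rw [sharpVar_inl, inZ, constantCoeff_subst_zero (by simp), H.map_zero]
  · rw [sharpVar_inr, inZeta, constantCoeff_subst_zero (by simp), constantCoeff_conj, H.map_zero,
      map_zero]

theorem sharp_mul [Finite ι] [Finite κ] (H : FormalMap ι κ) (φ ψ : Series2 κ) :
    H.sharp (φ * ψ) = H.sharp φ * H.sharp ψ :=
  subst_mul (hs (sharp_const H)) _ _

theorem sharp_add [Finite ι] [Finite κ] (H : FormalMap ι κ) (φ ψ : Series2 κ) :
    H.sharp (φ + ψ) = H.sharp φ + H.sharp ψ :=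
  subst_add (hs (sharp_const H)) _ _

/-- If φ = ρ′u, the term of ∂φ in which u is differentiated contains the factor ρ′, which pulls back
into the ideal of M. So modulo that ideal any element of the ideal of M′ may replace the defining
function used for E. -/
theorem inDegeneracyModule_pderiv [Fintype ι] [Fintype κ] {M : FormalHypersurface ι}
    {M' : FormalHypersurface κ} {H : FormalMap ι κ} (hH : H.MapsInto M M') {ρ' φ : Series2 κ}
    (hρ : IsDefiningFunction M'.ideal ρ') (hφ : φ ∈ M'.ideal) :
    InDegeneracyModule M H ρ' fun i => H.sharp (pderiv ℂ (Sum.inl i) φ) := by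
  have hφ' := hφ
  rw [hρ.generates, Ideal.mem_span_singleton] at hφ'
  obtain ⟨u, rfl⟩ := hφ'
  refine ⟨H.sharp u • fun i => H.sharp (pderiv ℂ (Sum.inl i) ρ'), Submodule.smul_mem _ _
    (Submodule.subset_span ⟨[], by simp, rfl⟩), fun i => ?_⟩
  simp only
  rw [Derivation.leibniz, smul_eq_mul, smul_eq_mul, sharp_add, sharp_mul, sharp_mul]
  simp only [Pi.smul_apply, smul_eq_mul, add_sub_cancel_right]
  refine M.ideal.mul_mem_right _ (hH _ ?_)
  rw [hρ.generates]
  exact Ideal.mem_span_singleton_self _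

theorem det_mem_of_sub_mem {R : Type*} [CommRing R] {I : Ideal R} {m : Type*} [Fintype m]
    [DecidableEq m] {A B : Matrix m m R} (h : ∀ i j, A i j - B i j ∈ I) (hB : B.det ∈ I) :
    A.det ∈ I := by
  rw [← Ideal.Quotient.eq_zero_iff_mem] at hB ⊢
  rw [RingHom.map_det] at hB ⊢
  convert hB using 2
  ext i j
  simpa [Ideal.Quotient.eq] using h i j

theorem reflect_sharp [Finite ι] [Finite κ] (H : FormalMap ι κ) (φ : Series2 κ) :
    reflect (H.sharp φ) = H.sharp (reflect φ) := by
  have hl : ∀ j : ι, constantCoeff (X (Sum.inl j) : Series2 ι) = 0 := by simp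
  have hr : ∀ j : ι, constantCoeff (X (Sum.inr j) : Series2 ι) = 0 := by simp
  have hX := subst_X (hs (swapVar_const (ι := ι))) (R := ℂ)
  have hX' := subst_X (hs (sharp_const H)) (R := ℂ)
  rw [sharp_eq, reflect_eq, conj_subst (sharp_const H), subst_subst _ swapVar_const, sharp_eq,
    reflect_eq, subst_subst swapVar_const (sharp_const H)]
  · congr 1
    funext i
    rcases i with i | i
    · rw [swapVar_inl, hX', sharpVar_inl, sharpVar_inr, inZ, inZeta, conj_subst hl]
      simp only [conj_X]
      rw [subst_subst hl swapVar_const]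
      simp only [hX, swapVar_inl]
    · rw [swapVar_inr, hX', sharpVar_inl, sharpVar_inr, inZ, inZeta, conj_subst hr, conj_conj]
      simp only [conj_X]
      rw [subst_subst hr swapVar_const]
      simp only [hX, swapVar_inr]
  · intro i
    rw [constantCoeff_conj, sharp_const, map_zero]

/-- Constant `1`-degeneracy, restricted to `M` after a reflection. -/
theorem det_iterate_eq_zero {M : FormalHypersurface (Fin (n + 1))}
    {M' : FormalHypersurface (Fin (n + 2))} {Q : Ser (CRVar n)} (hQ : constantCoeff Q = 0)
    (hM : M.ideal = Ideal.span {X (Sum.inl (Fin.last n)) - normalSubst Q})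
    {H : FormalMap (Fin (n + 1)) (Fin (n + 2))} (hH : H.MapsInto M M')
    (hdeg : H.ConstantlyDegenerate M M' 1) {ρ : Series2 (Fin (n + 2))} (hρ : ρ ∈ M'.ideal)
    (L : Fin (n + 2) → List (Fin n)) :
    (Matrix.of fun a m => (L a).foldr (fun j f => pderiv ℂ (Sum.inl j) f)
      (restrict Q (H.sharp (pderiv ℂ (Sum.inr m) ρ)))).det = 0 := by
  obtain ⟨ρ', hρ', l, hl, -, hminor⟩ := hdeg
  obtain ⟨ρM, hρM⟩ := M.exists_definingFunction
  have hiff : ∀ φ, restrict Q φ = 0 ↔ φ ∈ M.ideal := fun φ => by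
    rw [hM]; exact restrict_eq_zero_iff hQ φ
  obtain rfl : l = n + 1 := by simpa using hl
  -- E contains Z′-gradients, while the equations use ζ′-gradients. Starting from the reflected
  -- series makes the final reflection produce the latter.
  let v (a : Fin (n + 2)) (m : Fin (n + 2)) : Series2 (Fin (n + 1)) :=
    (L a).foldr (fun j f => field01 (crField Q j) f)
      (H.sharp (pderiv ℂ (Sum.inl m) (reflect ρ)))
  have hv : ∀ a, InDegeneracyModule M H ρ' (v a) := by
    intro a
    simp only [v]
    induction L a with
    | nil => exact inDegeneracyModule_pderiv hH hρ' (reflect_mem hρ' hρ)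
    | cons j L ih => exact ih.field01 (isCRField_crField hQ hM j)
  choose e he hve using hv
  have hdet : (Matrix.of v).det ∈ M.ideal :=
    det_mem_of_sub_mem (B := Matrix.of e) (fun a m => hve a m) (hminor e he id)
  have hr := reflect_mem hρM hdet
  rw [← hiff] at hr
  have hhom : ∀ {m : Type} [Fintype m] [DecidableEq m] (A : Matrix m m (Series2 (Fin (n + 1)))),
      restrict Q (reflect A.det) = (Matrix.of fun i j => restrict Q (reflect (A i j))).det := by
    intro m _ _ A
    let Φ : Series2 (Fin (n + 1)) →+* Ser (CRVar n) :=
      ((substAlgHom (hs (restrict_const hQ))).toRingHom.comp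
        (substAlgHom (hs (swapVar_const (ι := Fin (n + 1))))).toRingHom).comp
        (MvPowerSeries.map (starRingEnd ℂ))
    have hΦ : ∀ f, Φ f = restrict Q (reflect f) := fun f => by
      simp [Φ, restrict, reflect_eq, coe_substAlgHom, conj]
    rw [← hΦ, RingHom.map_det]
    congr 1
    ext i j
    simp [hΦ]
  rw [hhom] at hr
  rw [← hr]
  refine congrArg Matrix.det (Matrix.ext fun a m => ?_)
  simp only [Matrix.of_apply, v]
  induction L a with
  | nil =>
    simp only [List.foldr_nil]
    rw [reflect_sharp, ← pderiv_inr_reflect, reflect_reflect]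
  | cons j L ih =>
    simp only [List.foldr_cons]
    rw [ih, restrict_reflect_field01 hQ]

end Degeneracy

end

end FormalCR

namespace FormalCR

open MvPowerSeries

noncomputable section

/-! ### Taylor expansion in some of the indeterminates. -/

section Taylor

variable {σ τ : Type} [Finite σ] [DecidableEq σ]

/-- Setting to zero the indeterminates in `S`, as an algebra homomorphism. -/
def killHom (S : Finset σ) : Ser σ →ₐ[ℂ] Ser σ := substAlgHom (hs (kill_const S))

@[simp] theorem killHom_apply (S : Finset σ) (f : Ser σ) : killHom S f = kill S f := by
  rw [killHom, coe_substAlgHom, kill]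

theorem kill_X (S : Finset σ) (s : σ) : kill S (X s : Ser σ) = if s ∈ S then 0 else X s := by
  rw [kill, subst_X (hs (kill_const S))]

theorem kill_idem (S : Finset σ) (f : Ser σ) : kill S (kill S f) = kill S f := by
  rw [kill_kill, Finset.union_self]

theorem pderiv_kill {S : Finset σ} {s : σ} (hs' : s ∈ S) (f : Ser σ) :
    pderiv ℂ s (kill S f) = 0 := by
  cases nonempty_fintype σ
  rw [kill, pderiv_subst (kill_const S)]
  refine Finset.sum_eq_zero fun i _ => ?_
  split_ifs with h
  · rw [map_zero, mul_zero]
  · rw [pderiv_X_of_ne, mul_zero]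
    rintro rfl
    exact h hs'

theorem kill_pderiv {S : Finset σ} {s : σ} (hs' : s ∉ S) (f : Ser σ) :
    kill S (pderiv ℂ s f) = pderiv ℂ s (kill S f) := by
  cases nonempty_fintype σ
  have : pderiv ℂ s (kill S f) = ∑ i, kill S (pderiv ℂ i f) *
      pderiv ℂ s (if i ∈ S then 0 else (X i : Ser σ)) := pderiv_subst (kill_const S) s f
  rw [this, Finset.sum_eq_single s]
  · rw [if_neg hs', pderiv_X_self, mul_one]
  · intro i _ hi
    split_ifs with h
    · rw [map_zero, mul_zero]
    · rw [pderiv_X_of_ne hi, mul_zero]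
  · simp

theorem coeff_kill_of_forall (S : Finset σ) (f : Ser σ) {m : σ →₀ ℕ} (hm : ∀ s ∈ S, m s = 0) :
    coeff m (kill S f) = coeff m f := by
  induction S using Finset.induction_on with
  | empty => rw [kill_empty]
  | insert s S hsS ih =>
    rw [Finset.insert_eq, ← kill_kill, coeff_kill s _ (hm s (by simp)),
      ih fun t ht => hm t (Finset.mem_insert_of_mem ht)]

/-- Induction on the degree of an exponent in the indeterminates of `S`: a coefficient of positive
degree is a coefficient of a derivative divided by a positive integer. -/
theorem eq_zero_of_kill_iterate {ι : Type} {v : ι → σ} {S : Finset σ}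
    (hS : ∀ s, s ∈ S ↔ ∃ j, v j = s) {f : Ser σ}
    (h : ∀ L : List ι, kill S (L.foldr (fun j f => pderiv ℂ (v j) f) f) = 0) : f = 0 := by
  have key : ∀ (N : ℕ) (m : σ →₀ ℕ), ∑ s ∈ S, m s = N → ∀ L : List ι,
      coeff m (L.foldr (fun j f => pderiv ℂ (v j) f) f) = 0 := by
    intro N
    induction N with
    | zero =>
      intro m hm L
      rw [← coeff_kill_of_forall S _ (by simpa using hm), h, map_zero]
    | succ N ih =>
      intro m hm L
      have : ∃ s ∈ S, m s ≠ 0 := by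
        by_contra! hc
        rw [Finset.sum_eq_zero hc] at hm
        omega
      obtain ⟨s, hsS, hms⟩ := this
      obtain ⟨j, rfl⟩ := (hS s).mp hsS
      have hle : Finsupp.single (v j) 1 ≤ m := by
        rw [Finsupp.single_le_iff]; omega
      have hsum : ∑ s ∈ S, (m - Finsupp.single (v j) 1 : σ →₀ ℕ) s = N := by
        have h1 : ∑ s ∈ S, m s = ∑ s ∈ S, (m - Finsupp.single (v j) 1 : σ →₀ ℕ) s +
            ∑ s ∈ S, (Finsupp.single (v j) 1 : σ →₀ ℕ) s := by
          rw [← Finset.sum_add_distrib]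
          refine Finset.sum_congr rfl fun s _ => ?_
          rw [← Finsupp.add_apply, tsub_add_cancel_of_le hle]
        have h2 : ∑ s ∈ S, (Finsupp.single (v j) 1 : σ →₀ ℕ) s = 1 := by
          simp [Finsupp.single_apply, hsS]
        omega
      have := ih _ hsum (j :: L)
      rw [List.foldr_cons, coeff_pderiv, tsub_add_cancel_of_le hle] at this
      refine (mul_eq_zero.mp this).resolve_right ?_
      exact Nat.cast_add_one_ne_zero _
  ext m
  exact key _ m rfl []

end Taylor

/-! ### Generalized cross products. -/

section Cofactor

variable {R R' : Type*} [CommRing R] [CommRing R'] {m : ℕ}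

/-- The cofactors of the missing last row of a matrix. -/
def cofactor (b : Fin m → Fin (m + 1) → R) (i : Fin (m + 1)) : R :=
  (Matrix.of (Fin.lastCases (Pi.single i 1) b : Fin (m + 1) → Fin (m + 1) → R)).det

/-- Laplace expansion along the last row. Pairing a vector with the cofactors tests whether it
depends on the given rows. -/
theorem sum_cofactor_mul (b : Fin m → Fin (m + 1) → R) (x : Fin (m + 1) → R) :
    ∑ i, x i * cofactor b i =
      (Matrix.of (Fin.lastCases x b : Fin (m + 1) → Fin (m + 1) → R)).det := by
  rw [Matrix.det_eq_sum_mul_adjugate_row _ (Fin.last m)]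
  refine Finset.sum_congr rfl fun i _ => ?_
  congr 1
  · simp
  · rw [Matrix.adjugate_apply, cofactor]
    congr 1
    ext k l
    refine Fin.lastCases ?_ (fun k => ?_) k
    · simp
    · rw [Matrix.updateRow_ne (Fin.castSucc_lt_last k).ne]
      simp

theorem sum_row_mul_cofactor (b : Fin m → Fin (m + 1) → R) (k : Fin m) :
    ∑ i, b k i * cofactor b i = 0 := by
  rw [sum_cofactor_mul]
  apply Matrix.det_zero_of_row_eq (i := k.castSucc) (j := Fin.last m) (Fin.castSucc_lt_last k).ne
  funext i
  simp

theorem map_cofactor (φ : R →+* R') (b : Fin m → Fin (m + 1) → R) (i : Fin (m + 1)) :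
    φ (cofactor b i) = cofactor (fun k j => φ (b k j)) i := by
  rw [cofactor, RingHom.map_det, cofactor]
  congr 1
  ext k j
  refine Fin.lastCases ?_ (fun k => ?_) k
  · simp only [RingHom.mapMatrix_apply, Matrix.map_apply, Matrix.of_apply, Fin.lastCases_last]
    by_cases h : j = i
    · subst h; simp
    · simp [h]
  · simp

theorem IsTame.cofactor {P : ∀ σ : Type, Ser σ → Prop} (hP : IsTame P) {σ : Type}
    {b : Fin m → Fin (m + 1) → Ser σ} (hb : ∀ k i, P σ (b k i)) (i : Fin (m + 1)) :
    P σ (cofactor b i) := by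
  refine hP.det fun k j => ?_
  refine Fin.lastCases ?_ (fun k => ?_) k
  · simp only [Matrix.of_apply, Fin.lastCases_last]
    by_cases h : j = i
    · subst h; simpa using hP.one
    · simpa [h] using hP.zero
  · simpa using hb k j

/-- Independent rows are completed to a basis by a vector `x`. The determinant of the basis is the
pairing of `x` with the cofactors, which therefore do not all vanish. -/
theorem exists_cofactor_ne_zero {K : Type*} [Field K] {b : Fin m → Fin (m + 1) → K}
    (hb : LinearIndependent K b) : ∃ i, cofactor b i ≠ 0 := by
  have hspan : Submodule.span K (Set.range b) ≠ ⊤ := by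
    intro h
    have h1 := finrank_span_eq_card hb
    rw [h, finrank_top] at h1
    simp at h1
  obtain ⟨x, hx⟩ : ∃ x, x ∉ Submodule.span K (Set.range b) := by
    by_contra! h
    exact hspan (Submodule.eq_top_iff'.mpr h)
  have hli : LinearIndependent K (Fin.snoc b x : Fin (m + 1) → Fin (m + 1) → K) :=
    linearIndependent_finSnoc.mpr ⟨hb, hx⟩
  by_contra! h
  have h0 := sum_cofactor_mul b x
  simp only [h, mul_zero, Finset.sum_const_zero] at h0
  have : (Matrix.of (Fin.lastCases x b : Fin (m + 1) → Fin (m + 1) → K)) =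
      Matrix.of (Fin.snoc b x : Fin (m + 1) → Fin (m + 1) → K) := by
    ext k j
    refine Fin.lastCases ?_ (fun k => ?_) k <;> simp
  rw [this] at h0
  exact (Matrix.linearIndependent_rows_iff_isUnit.mp hli).map Matrix.detMonoidHom
    |>.ne_zero h0.symm

end Cofactor

/-! ### The equations satisfied by a transversal map of constant degeneracy one. -/

section Jets

variable {n : ℕ} {υ : Type}

/-- The indices of the indeterminates `z`. -/
def zSet (n : ℕ) : Finset (CRVar n) := Finset.univ.map ⟨Sum.inl, Sum.inl_injective⟩

theorem mem_zSet (i : CRVar n) : i ∈ zSet n ↔ ∃ j, Sum.inl j = i := by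
  simp [zSet]

/-- The point `(0, τ)`. -/
def tauVar : Fin (n + 1) → Ser (CRVar n) :=
  Fin.lastCases (X (Sum.inr (Sum.inr ()))) fun _ => 0

@[simp] theorem tauVar_last : (tauVar (Fin.last n) : Ser (CRVar n)) = X (Sum.inr (Sum.inr ())) := by
  simp [tauVar]

@[simp] theorem tauVar_castSucc (j : Fin n) : (tauVar j.castSucc : Ser (CRVar n)) = 0 := by
  simp [tauVar]

theorem tauVar_const (j : Fin (n + 1)) : constantCoeff (tauVar j : Ser (CRVar n)) = 0 := by
  refine Fin.lastCases ?_ (fun j => ?_) j <;> simp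

/-- `h(0, τ)`. -/
def atTau (h : Ser (Fin (n + 1))) : Ser (CRVar n) := subst tauVar h

/-- The point `(H(z, Q), H̄(χ, τ))`. -/
def jetVar {κ : Type} (Q : Ser (CRVar n)) (H : κ → Ser (Fin (n + 1))) : κ ⊕ κ → Ser (CRVar n) :=
  Sum.elim (fun i => subst (onZ Q) (H i)) fun i => subst onZeta (conj (H i))

@[simp] theorem jetVar_inl {κ : Type} (Q : Ser (CRVar n)) (H : κ → Ser (Fin (n + 1))) (i : κ) :
    jetVar Q H (Sum.inl i) = subst (onZ Q) (H i) := rfl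

@[simp] theorem jetVar_inr {κ : Type} (Q : Ser (CRVar n)) (H : κ → Ser (Fin (n + 1))) (i : κ) :
    jetVar Q H (Sum.inr i) = subst onZeta (conj (H i)) := rfl

theorem jetVar_const {κ : Type} {Q : Ser (CRVar n)} (hQ : constantCoeff Q = 0)
    {H : κ → Ser (Fin (n + 1))} (hH : ∀ i, constantCoeff (H i) = 0) (i : κ ⊕ κ) :
    constantCoeff (jetVar Q H i) = 0 := by
  rcases i with i | i
  · rw [jetVar_inl, constantCoeff_subst_zero (onZ_const hQ), hH]
  · rw [jetVar_inr, constantCoeff_subst_zero onZeta_const, constantCoeff_conj, hH, map_zero]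

theorem restrict_sharp {κ : Type} [Finite κ] {Q : Ser (CRVar n)} (hQ : constantCoeff Q = 0)
    (H : FormalMap (Fin (n + 1)) κ) (φ : Series2 κ) :
    restrict Q (H.sharp φ) = subst (jetVar Q H.toFun) φ := by
  rw [restrict, sharp_eq, subst_subst (sharp_const H) (restrict_const hQ)]
  have hX := subst_X (hs (restrict_const hQ)) (R := ℂ)
  congr 1
  funext i
  rcases i with i | i
  · rw [sharpVar_inl, inZ, subst_subst (by simp) (restrict_const hQ), jetVar_inl]
    simp only [hX, Sum.elim_inl]
  · rw [sharpVar_inr, inZeta, subst_subst (by simp) (restrict_const hQ), jetVar_inr]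
    simp only [hX, Sum.elim_inr]

/-- The rows `ρ_{ζ′}` and `∂_{z_k} ρ_{ζ′}` along `(S, h)`, where `p` is the Jacobian of `S` and `q`
is the gradient of `Q`. -/
def jetRow (ρ : Series2 (Fin (n + 2))) (e : Fin (n + 2) ⊕ Fin (n + 2) → Ser υ)
    (p : Fin (n + 2) → Fin (n + 1) → Ser υ) (q : Fin n → Ser υ) :
    Fin (n + 1) → Fin (n + 2) → Ser υ :=
  Fin.cases (fun m => subst e (pderiv ℂ (Sum.inr m) ρ)) fun k m =>
    ∑ i, subst e (pderiv ℂ (Sum.inl i) (pderiv ℂ (Sum.inr m) ρ)) *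
      (p i k.castSucc + q k * p i (Fin.last n))

theorem jetRow_zero (ρ : Series2 (Fin (n + 2))) (e : Fin (n + 2) ⊕ Fin (n + 2) → Ser υ)
    (p : Fin (n + 2) → Fin (n + 1) → Ser υ) (q : Fin n → Ser υ) (m : Fin (n + 2)) :
    jetRow ρ e p q 0 m = subst e (pderiv ℂ (Sum.inr m) ρ) := rfl

theorem jetRow_succ (ρ : Series2 (Fin (n + 2))) (e : Fin (n + 2) ⊕ Fin (n + 2) → Ser υ)
    (p : Fin (n + 2) → Fin (n + 1) → Ser υ) (q : Fin n → Ser υ) (k : Fin n) (m : Fin (n + 2)) :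
    jetRow ρ e p q k.succ m = ∑ i, subst e (pderiv ℂ (Sum.inl i) (pderiv ℂ (Sum.inr m) ρ)) *
      (p i k.castSucc + q k * p i (Fin.last n)) := rfl

/-- The vector orthogonal to the rows `jetRow`. -/
def jetNormal (ρ : Series2 (Fin (n + 2))) (e : Fin (n + 2) ⊕ Fin (n + 2) → Ser υ)
    (p : Fin (n + 2) → Fin (n + 1) → Ser υ) (q : Fin n → Ser υ) (m : Fin (n + 2)) : Ser υ :=
  cofactor (jetRow ρ e p q) m

theorem subst_jetNormal {υ' : Type} [Finite υ] {ρ : Series2 (Fin (n + 2))}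
    {e : Fin (n + 2) ⊕ Fin (n + 2) → Ser υ} (he : ∀ i, constantCoeff (e i) = 0)
    (p : Fin (n + 2) → Fin (n + 1) → Ser υ) (q : Fin n → Ser υ) {a : υ → Ser υ'}
    (ha : ∀ i, constantCoeff (a i) = 0) (m : Fin (n + 2)) :
    subst a (jetNormal ρ e p q m) = jetNormal ρ (fun i => subst a (e i))
      (fun i k => subst a (p i k)) (fun k => subst a (q k)) m := by
  have hA : ∀ f : Ser υ, (substAlgHom (hs ha)).toRingHom f = subst a f := fun f => by simp
  unfold jetNormal
  rw [← hA, map_cofactor]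
  congr 1
  funext k j
  refine Fin.cases ?_ (fun k => ?_) k
  · rw [jetRow_zero, jetRow_zero, hA, subst_subst he ha]
  · rw [jetRow_succ, jetRow_succ]
    simp only [hA, subst_sum ha, subst_mul (hs ha), subst_add (hs ha), subst_subst he ha]

theorem IsTame.jetNormal {P : ∀ σ : Type, Ser σ → Prop} (hP : IsTame P) [Finite υ]
    {ρ : Series2 (Fin (n + 2))} (hρ : P _ ρ)
    {e : Fin (n + 2) ⊕ Fin (n + 2) → Ser υ} (he : ∀ i, constantCoeff (e i) = 0)
    (heP : ∀ i, P υ (e i)) {p : Fin (n + 2) → Fin (n + 1) → Ser υ} (hp : ∀ i k, P υ (p i k))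
    {q : Fin n → Ser υ} (hq : ∀ k, P υ (q k)) (m : Fin (n + 2)) :
    P υ (jetNormal ρ e p q m) := by
  refine hP.cofactor (fun k j => ?_) m
  refine Fin.cases ?_ (fun k => ?_) k
  · exact hP.comp he heP (hP.pderiv _ hρ)
  · rw [jetRow_succ]
    exact hP.sum fun i _ => hP.mul (hP.comp he heP (hP.pderiv _ (hP.pderiv _ hρ)))
      (hP.add (hp _ _) (hP.mul (hq _) (hp _ _)))

/-- The equations that a transversal map `H : M → M′` of constant degeneracy one satisfies, for
`M` given by `w = Q` and `M′` given by `ρ = 0`. -/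
structure Realizes (Q : Ser (CRVar n)) (ρ : Series2 (Fin (n + 2)))
    (Λ : Matrix (Fin (n + 2)) (Fin (n + 1)) ℂ) (H : Fin (n + 2) → Ser (Fin (n + 1))) : Prop where
  const : ∀ i, constantCoeff (H i) = 0
  deriv : ∀ i k, constantCoeff (pderiv ℂ k (H i)) = Λ i k
  eq : subst (jetVar Q H) ρ = 0
  normal : ∑ m, subst (jetVar Q H) (pderiv ℂ (Sum.inr m) ρ) *
    jetNormal ρ (Sum.elim (fun i => atTau (H i)) fun i => subst onZeta (conj (H i)))
      (fun i k => atTau (pderiv ℂ k (H i))) (fun k => kill (zSet n) (pderiv ℂ (Sum.inl k) Q)) m = 0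

theorem kill_onZ {Q : Ser (CRVar n)} (hQ : constantCoeff Q = 0)
    (hQ0 : kill (zSet n) Q = X (Sum.inr (Sum.inr ()))) (f : Ser (Fin (n + 1))) :
    kill (zSet n) (subst (onZ Q) f) = atTau f := by
  rw [kill, subst_subst (onZ_const hQ) (kill_const _), atTau]
  congr 1
  funext j
  refine Fin.lastCases ?_ (fun j => ?_) j
  · rw [onZ_last, tauVar_last, ← hQ0]; rfl
  · rw [onZ_castSucc, tauVar_castSucc]
    exact (kill_X _ _).trans (if_pos ((mem_zSet _).mpr ⟨j, rfl⟩))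

theorem kill_onZeta (f : Ser (Fin (n + 1))) :
    kill (zSet n) (subst onZeta f) = subst onZeta f := by
  rw [kill, subst_subst onZeta_const (kill_const _)]
  congr 1
  funext j
  have := fun i => kill_X (zSet n) i
  unfold kill at this
  refine Fin.lastCases ?_ (fun j => ?_) j
  · rw [onZeta_last, this, if_neg (by simp [mem_zSet])]
  · rw [onZeta_castSucc, this, if_neg (by simp [mem_zSet])]

theorem pderiv_z_jet {κ : Type} [Fintype κ] {Q : Ser (CRVar n)} (hQ : constantCoeff Q = 0)
    {H : κ → Ser (Fin (n + 1))} (hH : ∀ i, constantCoeff (H i) = 0) (k : Fin n) (φ : Series2 κ) :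
    pderiv ℂ (Sum.inl k) (subst (jetVar Q H) φ) =
      ∑ i, subst (jetVar Q H) (pderiv ℂ (Sum.inl i) φ) *
        (subst (onZ Q) (pderiv ℂ k.castSucc (H i)) +
          pderiv ℂ (Sum.inl k) Q * subst (onZ Q) (pderiv ℂ (Fin.last n) (H i))) := by
  classical
  rw [pderiv_subst (jetVar_const hQ hH), Fintype.sum_sum_type]
  have h2 : ∀ i, pderiv ℂ (Sum.inl k) (jetVar Q H (Sum.inr i)) = 0 := by
    intro i
    rw [jetVar_inr, ← kill_onZeta]
    exact pderiv_kill ((mem_zSet _).mpr ⟨k, rfl⟩) _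
  simp only [h2, mul_zero, Finset.sum_const_zero, add_zero]
  refine Finset.sum_congr rfl fun i _ => ?_
  congr 1
  rw [jetVar_inl, pderiv_subst (onZ_const hQ), Fin.sum_univ_castSucc]
  simp [pderiv_X, Pi.single_apply, mul_comm]

theorem kill_jet {κ : Type} [Finite κ] {Q : Ser (CRVar n)} (hQ : constantCoeff Q = 0)
    (hQ0 : kill (zSet n) Q = X (Sum.inr (Sum.inr ())))
    {H : κ → Ser (Fin (n + 1))} (hH : ∀ i, constantCoeff (H i) = 0) (φ : Series2 κ) :
    kill (zSet n) (subst (jetVar Q H) φ) =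
      subst (Sum.elim (fun i => atTau (H i)) fun i => subst onZeta (conj (H i))) φ := by
  rw [kill, subst_subst (jetVar_const hQ hH) (kill_const _)]
  congr 1
  funext i
  rcases i with i | i
  · exact kill_onZ hQ hQ0 _
  · exact kill_onZeta _

/-- The vector W is the cross product of ρ_{ζ′} and its first z-derivatives at z = 0, hence
independent of z. A z-derivative of ρ_{ζ′}·W at z = 0 is the determinant with the corresponding
derivative of ρ_{ζ′} as additional row, which vanishes by degeneracy. All Taylor coefficients in z
being zero, ρ_{ζ′}·W = 0. -/
theorem realizes_of_degenerate {M : FormalHypersurface (Fin (n + 1))}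
    {M' : FormalHypersurface (Fin (n + 2))} {Q : Ser (CRVar n)} (hQ : constantCoeff Q = 0)
    (hQ0 : kill (zSet n) Q = X (Sum.inr (Sum.inr ())))
    (hM : M.ideal = Ideal.span {X (Sum.inl (Fin.last n)) - normalSubst Q})
    {H : FormalMap (Fin (n + 1)) (Fin (n + 2))} (hH : H.MapsInto M M')
    (hdeg : H.ConstantlyDegenerate M M' 1) {ρ : Series2 (Fin (n + 2))} (hρ : ρ ∈ M'.ideal) :
    Realizes Q ρ H.derivAtZero H.toFun where
  const := H.map_zero
  deriv i k := rfl
  eq := by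
    rw [← restrict_sharp hQ, restrict_eq_zero_iff hQ, ← hM]
    exact hH ρ hρ
  normal := by
    set s := fun m => subst (jetVar Q H.toFun) (pderiv ℂ (Sum.inr m) ρ) with hs'
    set W := jetNormal ρ (Sum.elim (fun i => atTau (H.toFun i)) fun i => subst onZeta (conj (H.toFun i)))
      (fun i k => atTau (pderiv ℂ k (H.toFun i))) (fun k => kill (zSet n) (pderiv ℂ (Sum.inl k) Q))
      with hW
    set b := jetRow ρ (Sum.elim (fun i => atTau (H.toFun i)) fun i => subst onZeta (conj (H.toFun i)))
      (fun i k => atTau (pderiv ℂ k (H.toFun i))) (fun k => kill (zSet n) (pderiv ℂ (Sum.inl k) Q))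
      with hb
    have hb0 : ∀ m, b 0 m = kill (zSet n) (s m) := fun m => by
      rw [hb, jetRow_zero, hs']
      exact (kill_jet hQ hQ0 H.map_zero _).symm
    have hbk : ∀ k m, b (Fin.succ k) m = kill (zSet n) (pderiv ℂ (Sum.inl k) (s m)) := fun k m => by
      rw [hb, jetRow_succ, hs']
      simp only
      rw [pderiv_z_jet hQ H.map_zero, ← killHom_apply (zSet n) (∑ i, _), map_sum]
      refine Finset.sum_congr rfl fun i _ => ?_
      rw [map_mul, map_add, map_mul]
      simp only [killHom_apply]
      rw [kill_jet hQ hQ0 H.map_zero, kill_onZ hQ hQ0, kill_onZ hQ hQ0]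
    have hkb : ∀ k m, kill (zSet n) (b k m) = b k m := by
      intro k m
      refine Fin.cases ?_ (fun k => ?_) k
      · rw [hb0, kill_idem]
      · rw [hbk, kill_idem]
    have hkW : ∀ m, kill (zSet n) (W m) = W m := by
      intro m
      have := map_cofactor (killHom (zSet n)).toRingHom b m
      simp only [AlgHom.toRingHom_eq_coe, RingHom.coe_coe, killHom_apply, hkb] at this
      exact this
    have hdW : ∀ k m, pderiv ℂ (Sum.inl k) (W m) = 0 := by
      intro k m
      rw [← hkW]
      exact pderiv_kill ((mem_zSet _).mpr ⟨k, rfl⟩) _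
    apply eq_zero_of_kill_iterate (v := Sum.inl) mem_zSet
    intro L
    have hfold : L.foldr (fun j f => pderiv ℂ (Sum.inl j) f) (∑ m, s m * W m) =
        ∑ m, L.foldr (fun j f => pderiv ℂ (Sum.inl j) f) (s m) * W m := by
      induction L with
      | nil => rfl
      | cons j L ih =>
        rw [List.foldr_cons, ih, map_sum]
        refine Finset.sum_congr rfl fun m _ => ?_
        rw [Derivation.leibniz, hdW, List.foldr_cons, smul_zero, zero_add, smul_eq_mul, mul_comm]
    rw [hfold, ← killHom_apply, map_sum]
    simp only [map_mul, killHom_apply, hkW]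
    -- The rows are ρ_{ζ′} itself, its first derivatives in each z_k, and the derivative along the
    -- arbitrary list `L` in the last place.
    have h1 := det_iterate_eq_zero hQ hM hH hdeg hρ
      (Fin.lastCases L (Fin.cases [] fun k => [k]))
    have h2 := congrArg (killHom (zSet n)).toRingHom h1
    rw [map_zero, RingHom.map_det] at h2
    rw [← h2]
    refine (sum_cofactor_mul b _).trans ?_
    refine congrArg Matrix.det (Matrix.ext fun a m => ?_)
    simp only [restrict_sharp hQ, RingHom.mapMatrix_apply, Matrix.map_apply, Matrix.of_apply,
      AlgHom.toRingHom_eq_coe, RingHom.coe_coe, killHom_apply]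
    refine Fin.lastCases ?_ (fun k => ?_) a
    · simp only [Fin.lastCases_last, hs']
    · simp only [Fin.lastCases_castSucc]
      refine Fin.cases ?_ (fun k => ?_) k
      · rw [hb0]; rfl
      · rw [hbk]; rfl

end Jets

end

end FormalCR

namespace FormalCR

open MvPowerSeries

noncomputable section

/-! ### Levi-nondegeneracy in bilinear form. -/

section Levi

variable {ι : Type} [Fintype ι]

/-- `ρ_Z(0)`. -/
def gradZ (ρ : Series2 ι) (i : ι) : ℂ := constantCoeff (pderiv ℂ (Sum.inl i) ρ)

/-- `ρ_ζ(0)`. -/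
def gradZeta (ρ : Series2 ι) (m : ι) : ℂ := constantCoeff (pderiv ℂ (Sum.inr m) ρ)

/-- `ρ_{Zζ}(0)`. -/
def mixedHess (ρ : Series2 ι) (i m : ι) : ℂ :=
  constantCoeff (pderiv ℂ (Sum.inl i) (pderiv ℂ (Sum.inr m) ρ))

/-- The Levi form has trivial left kernel. -/
def LeftNondegenerate (ρ : Series2 ι) : Prop :=
  ∀ (u : ι → ℂ) (s : ℂ), ∑ i, gradZ ρ i * u i = 0 →
    (∀ m, ∑ i, mixedHess ρ i m * u i = s * gradZeta ρ m) → u = 0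

/-- The Levi form has trivial right kernel. -/
def RightNondegenerate (ρ : Series2 ι) : Prop :=
  ∀ (v : ι → ℂ) (s : ℂ), ∑ m, gradZeta ρ m * v m = 0 →
    (∀ i, ∑ m, mixedHess ρ i m * v m = s * gradZ ρ i) → v = 0

theorem exists_unit_of_span_eq {σ : Type} {f g : Ser σ} (h : Ideal.span {f} = Ideal.span {g}) :
    ∃ u, f * u = g ∧ constantCoeff u ≠ 0 := by
  obtain ⟨u, hu⟩ := Ideal.span_singleton_eq_span_singleton.mp h
  exact ⟨u, hu, (u.isUnit.map (constantCoeff (R := ℂ))).ne_zero⟩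

omit [Fintype ι] in
theorem gradZ_mul {ρ : Series2 ι} (hρ : constantCoeff ρ = 0) (u : Series2 ι) (i : ι) :
    gradZ (ρ * u) i = constantCoeff u * gradZ ρ i := by
  simp [gradZ, Derivation.leibniz, hρ]

omit [Fintype ι] in
theorem gradZeta_mul {ρ : Series2 ι} (hρ : constantCoeff ρ = 0) (u : Series2 ι) (i : ι) :
    gradZeta (ρ * u) i = constantCoeff u * gradZeta ρ i := by
  simp [gradZeta, Derivation.leibniz, hρ]

omit [Fintype ι] in
theorem mixedHess_mul {ρ : Series2 ι} (hρ : constantCoeff ρ = 0) (u : Series2 ι) (i m : ι) :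
    mixedHess (ρ * u) i m = constantCoeff u * mixedHess ρ i m + gradZ u i * gradZeta ρ m +
      gradZeta u m * gradZ ρ i := by
  simp [gradZ, gradZeta, mixedHess, Derivation.leibniz, hρ]
  ring

/-- The reality condition writes the reflected series as ρu. Gradients at 0 then compare through
u(0), which is nonzero because the gradient of ρ is. -/
theorem IsDefiningFunction.exists_gradZeta {I : Ideal (Series2 ι)} {ρ : Series2 ι}
    (h : IsDefiningFunction I ρ) :
    ∃ a : ℂ, a ≠ 0 ∧ ∀ i, starRingEnd ℂ (gradZ ρ i) = a * gradZeta ρ i := by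
  have hr := h.real
  rw [h.generates, Ideal.mem_span_singleton] at hr
  obtain ⟨u, hu⟩ := hr
  have key : ∀ i, starRingEnd ℂ (gradZ ρ i) = constantCoeff u * gradZeta ρ i := by
    intro i
    rw [← gradZeta_mul h.zero_mem, ← hu, gradZeta, pderiv_inr_reflect, constantCoeff_reflect, gradZ]
  refine ⟨_, fun h0 => ?_, key⟩
  obtain ⟨j, hj⟩ := h.gradient_ne_zero
  have := key j
  rw [h0, zero_mul, _root_.map_eq_zero] at this
  exact hj this

/-- A multiple of ρ_ζ(0) pairs to zero with conjugates of complex tangent vectors, because ρ_ζ(0) is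
proportional to the conjugate of ρ_Z(0). The parameter s thus accounts for testing on the tangent
space only. -/
theorem leftNondegenerate_of_leviForm {I : Ideal (Series2 ι)} {ρ : Series2 ι}
    (h : IsDefiningFunction I ρ)
    (hL : ∀ u : ι → ℂ, IsComplexTangent ρ u →
      (∀ v : ι → ℂ, IsComplexTangent ρ v → leviForm ρ u v = 0) → u = 0) :
    LeftNondegenerate ρ := by
  obtain ⟨a, ha, hg⟩ := h.exists_gradZeta
  intro u s hu hs'
  refine hL u hu fun v hv => ?_
  have h1 : leviForm ρ u v = ∑ m, (∑ i, mixedHess ρ i m * u i) * starRingEnd ℂ (v m) := by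
    rw [leviForm, Finset.sum_comm]
    refine Finset.sum_congr rfl fun m _ => ?_
    rw [Finset.sum_mul]
    rfl
  rw [h1]
  simp only [hs']
  have h2 := congrArg (starRingEnd ℂ) hv
  rw [map_zero, map_sum] at h2
  have h3 : a * ∑ m, s * gradZeta ρ m * starRingEnd ℂ (v m) = s * 0 := by
    rw [← h2, Finset.mul_sum, Finset.mul_sum]
    refine Finset.sum_congr rfl fun m _ => ?_
    have := hg m
    rw [gradZ] at this
    rw [map_mul, this]
    ring
  rw [mul_zero] at h3
  exact (mul_eq_zero.mp h3).resolve_left ha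

/-- A unit factor changes the mixed Hessian by multiples of the two gradients. One of them vanishes
on tangent vectors and the other is absorbed into s. -/
theorem LeftNondegenerate.mul {ρ u : Series2 ι} (hρ : constantCoeff ρ = 0)
    (hu : constantCoeff u ≠ 0) (h : LeftNondegenerate ρ) : LeftNondegenerate (ρ * u) := by
  intro v s hv hs'
  simp only [gradZ_mul hρ, gradZeta_mul hρ, mixedHess_mul hρ] at hv hs'
  have hv' : ∑ i, gradZ ρ i * v i = 0 := by
    have : constantCoeff u * ∑ i, gradZ ρ i * v i = 0 := by
      rw [← hv, Finset.mul_sum]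
      exact Finset.sum_congr rfl fun i _ => by ring
    exact (mul_eq_zero.mp this).resolve_left hu
  refine h v ((constantCoeff u)⁻¹ * (s * constantCoeff u - ∑ i, gradZ u i * v i)) hv' fun m => ?_
  have h1 : ∑ i, (constantCoeff u * mixedHess ρ i m + gradZ u i * gradZeta ρ m +
      gradZeta u m * gradZ ρ i) * v i = constantCoeff u * ∑ i, mixedHess ρ i m * v i +
      (∑ i, gradZ u i * v i) * gradZeta ρ m + gradZeta u m * ∑ i, gradZ ρ i * v i := by
    rw [Finset.mul_sum, Finset.sum_mul, Finset.mul_sum, ← Finset.sum_add_distrib,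
      ← Finset.sum_add_distrib]
    exact Finset.sum_congr rfl fun i _ => by ring
  have h2 := hs' m
  rw [h1, hv', mul_zero, add_zero] at h2
  field_simp
  linear_combination h2

/-- Both conditions express invertibility of the Levi matrix bordered by the two gradients, and row
rank equals column rank. -/
theorem LeftNondegenerate.right {ρ : Series2 ι} (h : LeftNondegenerate ρ)
    (hg : ∃ m, gradZeta ρ m ≠ 0) : RightNondegenerate ρ := by
  classical
  let A : Matrix (Unit ⊕ ι) (Unit ⊕ ι) ℂ :=
    Matrix.fromBlocks 0 (Matrix.of fun _ m => gradZeta ρ m) (Matrix.of fun i _ => gradZ ρ i)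
      (Matrix.of (mixedHess ρ))
  have hdet : A.det ≠ 0 := by
    intro h0
    obtain ⟨v, hv, hvA⟩ := Matrix.exists_vecMul_eq_zero_iff.mpr h0
    have h1 : ∑ i, gradZ ρ i * v (Sum.inr i) = 0 := by
      have := congrFun hvA (Sum.inl ())
      simpa [A, Matrix.vecMul, dotProduct, mul_comm] using this
    have h2 : ∀ m, ∑ i, mixedHess ρ i m * v (Sum.inr i) = -v (Sum.inl ()) * gradZeta ρ m := by
      intro m
      have := congrFun hvA (Sum.inr m)
      simp only [A, Matrix.vecMul, dotProduct, Fintype.sum_sum_type, Finset.univ_unique,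
        Finset.sum_singleton, Matrix.fromBlocks_apply₁₂, Matrix.fromBlocks_apply₂₂,
        Matrix.of_apply, Pi.zero_apply, PUnit.default_eq_unit] at this
      rw [Finset.sum_congr rfl fun i _ => mul_comm (mixedHess ρ i m) (v (Sum.inr i))]
      linear_combination this
    have h3 := h _ _ h1 h2
    have h4 : v (Sum.inl ()) = 0 := by
      obtain ⟨m, hm⟩ := hg
      have := h2 m
      have h3' : ∀ i, v (Sum.inr i) = 0 := fun i => congrFun h3 i
      simp only [h3', mul_zero, Finset.sum_const_zero] at this
      have := (mul_eq_zero.mp this.symm).resolve_right hm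
      simpa using this
    apply hv
    funext i
    rcases i with i | i
    · exact h4
    · exact congrFun h3 i
  intro v s hv hs'
  by_contra hne
  apply hdet
  rw [← Matrix.exists_mulVec_eq_zero_iff]
  refine ⟨Sum.elim (fun _ => -s) v, fun h0 => hne ?_, ?_⟩
  · funext i
    exact congrFun h0 (Sum.inr i)
  · funext i
    rcases i with i | i
    · simpa [A, Matrix.mulVec, dotProduct] using hv
    · have := hs' i
      simp only [A, Matrix.mulVec, dotProduct, Fintype.sum_sum_type, Finset.univ_unique,
        Finset.sum_singleton, Matrix.fromBlocks_apply₂₁, Matrix.fromBlocks_apply₂₂,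
        Matrix.of_apply, Pi.zero_apply, Sum.elim_inl, Sum.elim_inr, this]
      ring

end Levi

/-! ### First-order data of the map at the origin. -/

section Model

variable {n : ℕ}

/-- The indices of the indeterminates `χ`. -/
def chiSet (n : ℕ) : Finset (CRVar n) :=
  Finset.univ.map ⟨fun j => Sum.inr (Sum.inl j), fun i j h => by simpa using h⟩

theorem mem_chiSet (i : CRVar n) : i ∈ chiSet n ↔ ∃ j, Sum.inr (Sum.inl j) = i := by
  simp only [chiSet, Finset.mem_map, Finset.mem_univ, true_and]
  rfl

/-- `Q_{z_k χ_j}(0)`. -/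
def leviMatrix (Q : Ser (CRVar n)) (k j : Fin n) : ℂ :=
  constantCoeff (pderiv ℂ (Sum.inl k) (pderiv ℂ (Sum.inr (Sum.inl j)) Q))

theorem IsNormal.const {Q : Ser (CRVar n)} (h : IsNormal Q) : constantCoeff Q = 0 := by
  have h1 := congrArg (constantCoeff (R := ℂ)) h.1
  rw [constantCoeff_subst_zero] at h1
  · simpa using h1
  · rintro (i | i | i) <;> simp

theorem IsNormal.kill_z {Q : Ser (CRVar n)} (h : IsNormal Q) :
    kill (zSet n) Q = X (Sum.inr (Sum.inr ())) := by
  refine Eq.trans ?_ h.2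
  rw [kill]
  congr 1
  funext i
  rcases i with i | i | i <;> simp [mem_zSet]

theorem IsNormal.kill_chi {Q : Ser (CRVar n)} (h : IsNormal Q) :
    kill (chiSet n) Q = X (Sum.inr (Sum.inr ())) := by
  refine Eq.trans ?_ h.1
  rw [kill]
  congr 1
  funext i
  rcases i with i | i | i <;> simp [mem_chiSet]

theorem constantCoeff_kill {σ : Type} [Finite σ] [DecidableEq σ] (S : Finset σ) (f : Ser σ) :
    constantCoeff (kill S f) = constantCoeff f :=
  constantCoeff_subst_zero (kill_const S) f

theorem IsNormal.pderiv_z {Q : Ser (CRVar n)} (h : IsNormal Q) (k : Fin n) :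
    constantCoeff (pderiv ℂ (Sum.inl k) Q) = 0 := by
  rw [← constantCoeff_kill (chiSet n), kill_pderiv (by simp [mem_chiSet]), h.kill_chi,
    pderiv_X_of_ne (by simp), map_zero]

theorem IsNormal.pderiv_chi {Q : Ser (CRVar n)} (h : IsNormal Q) (k : Fin n) :
    constantCoeff (pderiv ℂ (Sum.inr (Sum.inl k)) Q) = 0 := by
  rw [← constantCoeff_kill (zSet n), kill_pderiv (by simp [mem_zSet]), h.kill_z,
    pderiv_X_of_ne (by simp), map_zero]

theorem IsNormal.pderiv_tau {Q : Ser (CRVar n)} (h : IsNormal Q) :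
    constantCoeff (pderiv ℂ (Sum.inr (Sum.inr ())) Q) = 1 := by
  rw [← constantCoeff_kill (zSet n), kill_pderiv (by simp [mem_zSet]), h.kill_z,
    pderiv_X_self, map_one]

theorem pderiv_normalSubst_inl (Q : Ser (CRVar n)) (k : Fin n) :
    pderiv ℂ (Sum.inl k.castSucc) (normalSubst Q) = normalSubst (pderiv ℂ (Sum.inl k) Q) := by
  classical
  rw [normalSubst_eq, pderiv_subst normalVar_const, Fintype.sum_sum_type, Fintype.sum_sum_type]
  simp [pderiv_X, Pi.single_apply, normalSubst_eq]

theorem pderiv_normalSubst_inr (Q : Ser (CRVar n)) (k : Fin n) :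
    pderiv ℂ (Sum.inr k.castSucc) (normalSubst Q) =
      normalSubst (pderiv ℂ (Sum.inr (Sum.inl k)) Q) := by
  classical
  rw [normalSubst_eq, pderiv_subst normalVar_const, Fintype.sum_sum_type, Fintype.sum_sum_type]
  simp [pderiv_X, Pi.single_apply, normalSubst_eq, (Fin.castSucc_lt_last _).ne']

theorem pderiv_normalSubst_tau (Q : Ser (CRVar n)) :
    pderiv ℂ (Sum.inr (Fin.last n)) (normalSubst Q) =
      normalSubst (pderiv ℂ (Sum.inr (Sum.inr ())) Q) := by
  classical
  rw [normalSubst_eq, pderiv_subst normalVar_const, Fintype.sum_sum_type, Fintype.sum_sum_type]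
  simp [normalSubst_eq, (Fin.castSucc_lt_last _).ne]

theorem pderiv_normalSubst_w (Q : Ser (CRVar n)) :
    pderiv ℂ (Sum.inl (Fin.last n)) (normalSubst Q) = 0 := by
  classical
  rw [normalSubst_eq, pderiv_subst normalVar_const, Fintype.sum_sum_type, Fintype.sum_sum_type]
  simp [(Fin.castSucc_lt_last _).ne]

theorem constantCoeff_normalSubst (Q : Ser (CRVar n)) :
    constantCoeff (normalSubst Q) = constantCoeff Q :=
  constantCoeff_subst_zero normalVar_const Q

/-- The defining function `w - Q(z, χ, τ)`. -/
def normalFn (Q : Ser (CRVar n)) : Series2 (Fin (n + 1)) :=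
  X (Sum.inl (Fin.last n)) - normalSubst Q

section NormalFn

variable {Q : Ser (CRVar n)} (h : IsNormal Q)
include h

theorem constantCoeff_normalFn : constantCoeff (normalFn Q) = 0 := by
  simp [normalFn, constantCoeff_normalSubst, h.const]

theorem gradZ_normalFn_castSucc (k : Fin n) : gradZ (normalFn Q) k.castSucc = 0 := by
  rw [gradZ, normalFn, map_sub, pderiv_normalSubst_inl, map_sub, constantCoeff_normalSubst,
    h.pderiv_z, pderiv_X_of_ne, map_zero, sub_zero]
  simpa using (Fin.castSucc_lt_last k).ne'

omit h in
theorem gradZ_normalFn_last : gradZ (normalFn Q) (Fin.last n) = 1 := by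
  rw [gradZ, normalFn, map_sub, pderiv_normalSubst_w, map_sub, pderiv_X_self, map_zero, map_one,
    sub_zero]

theorem gradZeta_normalFn_castSucc (k : Fin n) : gradZeta (normalFn Q) k.castSucc = 0 := by
  rw [gradZeta, normalFn, map_sub, pderiv_normalSubst_inr, map_sub, constantCoeff_normalSubst,
    h.pderiv_chi, pderiv_X_of_ne (by simp), map_zero, sub_zero]

theorem gradZeta_normalFn_last : gradZeta (normalFn Q) (Fin.last n) = -1 := by
  rw [gradZeta, normalFn, map_sub, pderiv_normalSubst_tau, map_sub, constantCoeff_normalSubst,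
    h.pderiv_tau, pderiv_X_of_ne (by simp), map_zero, zero_sub]

omit h in
theorem mixedHess_normalFn (k j : Fin n) :
    mixedHess (normalFn Q) k.castSucc j.castSucc = -leviMatrix Q k j := by
  rw [mixedHess, normalFn, map_sub, pderiv_normalSubst_inr, pderiv_X_of_ne (by simp), zero_sub,
    map_neg, map_neg, pderiv_normalSubst_inl, constantCoeff_normalSubst, leviMatrix]

theorem leviMatrix_nondegenerate (hL : LeftNondegenerate (normalFn Q)) {u : Fin n → ℂ}
    (hu : ∀ j, ∑ k, leviMatrix Q k j * u k = 0) : u = 0 := by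
  -- The multiplier is forced by the τ-component, where the gradient of w − Q equals −1.
  have := hL (Fin.lastCases 0 u)
    (-∑ i, mixedHess (normalFn Q) i (Fin.last n) * (Fin.lastCases 0 u : Fin (n + 1) → ℂ) i) ?_ ?_
  · funext k
    simpa using congrFun this k.castSucc
  · rw [Fin.sum_univ_castSucc]
    simp [gradZ_normalFn_castSucc h]
  · intro m
    refine Fin.lastCases ?_ (fun j => ?_) m
    · rw [gradZeta_normalFn_last h]; ring
    · rw [gradZeta_normalFn_castSucc h, mul_zero, Fin.sum_univ_castSucc]
      simp [mixedHess_normalFn, hu]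

end NormalFn

/-- The first-order data at the origin of a transversal map with Jacobian `Λ` from `w = Q` to
`ρ = 0`. -/
structure IsModel (Q : Ser (CRVar n)) (ρ : Series2 (Fin (n + 2)))
    (Λ : Matrix (Fin (n + 2)) (Fin (n + 1)) ℂ) (c : ℂ) : Prop where
  normal : IsNormal Q
  nondeg : ∀ u : Fin n → ℂ, (∀ j, ∑ k, leviMatrix Q k j * u k = 0) → u = 0
  const : constantCoeff ρ = 0
  ne_zero : c ≠ 0
  cotangent : ∀ j : Fin n, ∑ m, gradZeta ρ m * starRingEnd ℂ (Λ m j.castSucc) = 0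
  transversal : ∑ m, gradZeta ρ m * starRingEnd ℂ (Λ m (Fin.last n)) = -c
  levi : ∀ k j : Fin n, ∑ i, ∑ m, mixedHess ρ i m * Λ i k.castSucc *
    starRingEnd ℂ (Λ m j.castSucc) = -c * leviMatrix Q k j
  right : RightNondegenerate ρ
  grad : ∃ i, gradZ ρ i ≠ 0

theorem pderiv_inl_inZ {ι : Type} [Fintype ι] (k : ι) (f : Ser ι) :
    pderiv ℂ (Sum.inl k) (inZ f) = inZ (pderiv ℂ k f) := by
  classical
  rw [inZ, pderiv_subst (by simp)]
  simp [pderiv_X, Pi.single_apply, inZ]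

theorem pderiv_inr_inZ {ι : Type} [Fintype ι] (k : ι) (f : Ser ι) :
    pderiv ℂ (Sum.inr k) (inZ f) = 0 := by
  classical
  rw [inZ, pderiv_subst (by simp)]
  simp

theorem pderiv_inr_inZeta {ι : Type} [Fintype ι] (k : ι) (f : Ser ι) :
    pderiv ℂ (Sum.inr k) (inZeta f) = inZeta (pderiv ℂ k f) := by
  classical
  rw [inZeta, pderiv_subst (by simp)]
  simp [pderiv_X, Pi.single_apply, inZeta]

theorem pderiv_inl_inZeta {ι : Type} [Fintype ι] (k : ι) (f : Ser ι) :
    pderiv ℂ (Sum.inl k) (inZeta f) = 0 := by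
  classical
  rw [inZeta, pderiv_subst (by simp)]
  simp

theorem constantCoeff_inZ {ι : Type} [Finite ι] (f : Ser ι) :
    constantCoeff (inZ f) = constantCoeff f := constantCoeff_subst_zero (by simp) f

theorem constantCoeff_inZeta {ι : Type} [Finite ι] (f : Ser ι) :
    constantCoeff (inZeta f) = constantCoeff f := constantCoeff_subst_zero (by simp) f

theorem constantCoeff_sharp {ι κ : Type} [Finite ι] [Finite κ] (H : FormalMap ι κ)
    (φ : Series2 κ) : constantCoeff (H.sharp φ) = constantCoeff φ :=
  constantCoeff_subst_zero (sharp_const H) φ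

theorem pderiv_inl_sharp {ι κ : Type} [Fintype ι] [Fintype κ] (H : FormalMap ι κ) (k : ι)
    (φ : Series2 κ) : pderiv ℂ (Sum.inl k) (H.sharp φ) =
      ∑ i, H.sharp (pderiv ℂ (Sum.inl i) φ) * inZ (pderiv ℂ k (H.toFun i)) := by
  rw [sharp_eq, pderiv_subst (sharp_const H), Fintype.sum_sum_type]
  simp [pderiv_inl_inZ, pderiv_inl_inZeta, sharp_eq]

theorem pderiv_inr_sharp {ι κ : Type} [Fintype ι] [Fintype κ] (H : FormalMap ι κ) (k : ι)
    (φ : Series2 κ) : pderiv ℂ (Sum.inr k) (H.sharp φ) =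
      ∑ i, H.sharp (pderiv ℂ (Sum.inr i) φ) * inZeta (conj (pderiv ℂ k (H.toFun i))) := by
  rw [sharp_eq, pderiv_subst (sharp_const H), Fintype.sum_sum_type]
  simp [pderiv_inr_inZ, pderiv_inr_inZeta, sharp_eq, pderiv_conj]

/-- Transversality says that the pullback of ρ is w − Q times a unit. Comparing first derivatives in
ζ and mixed second derivatives in (z,χ) at the origin gives the relations; derivatives of the unit
drop out because w − Q is critical in z and χ there. -/
theorem isModel_of_transversal {M : FormalHypersurface (Fin (n + 1))}
    {M' : FormalHypersurface (Fin (n + 2))} (hM : M.LeviNondegenerate)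
    (hM' : M'.LeviNondegenerate) {Q : Ser (CRVar n)} (hQ : IsNormal Q)
    (hMQ : M.ideal = Ideal.span {X (Sum.inl (Fin.last n)) - normalSubst Q})
    {ρ : Series2 (Fin (n + 2))} (hρ : M'.ideal = Ideal.span {ρ}) (hρ0 : constantCoeff ρ = 0)
    {H : FormalMap (Fin (n + 1)) (Fin (n + 2))} (hH : H.Transversal M M') :
    ∃ c, IsModel Q ρ H.derivAtZero c := by
  obtain ⟨ρ1, hρ1, hL1⟩ := hM
  obtain ⟨ρ2, hρ2, hL2⟩ := hM'
  obtain ⟨ρ3, hρ3, hT⟩ := hH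
  have hLM : LeftNondegenerate (normalFn Q) := by
    obtain ⟨u, hu, hu0⟩ := exists_unit_of_span_eq (hρ1.generates.symm.trans hMQ)
    rw [normalFn, ← hu]
    exact (leftNondegenerate_of_leviForm hρ1 hL1).mul hρ1.zero_mem hu0
  obtain ⟨u, hu, hu0⟩ := exists_unit_of_span_eq (hρ2.generates.symm.trans hρ)
  have hLM' : LeftNondegenerate ρ := by
    rw [← hu]
    exact (leftNondegenerate_of_leviForm hρ2 hL2).mul hρ2.zero_mem hu0
  have hgradZ : ∃ i, gradZ ρ i ≠ 0 := by
    obtain ⟨i, hi⟩ := hρ2.gradient_ne_zero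
    refine ⟨i, ?_⟩
    rw [← hu, gradZ_mul hρ2.zero_mem]
    exact mul_ne_zero hu0 hi
  have hgradZeta : ∃ i, gradZeta ρ i ≠ 0 := by
    obtain ⟨i, hi⟩ := hρ2.gradient_ne_zero
    obtain ⟨a, -, hg⟩ := hρ2.exists_gradZeta
    refine ⟨i, ?_⟩
    rw [← hu, gradZeta_mul hρ2.zero_mem]
    refine mul_ne_zero hu0 fun h0 => hi ?_
    have := hg i
    rw [h0, mul_zero, _root_.map_eq_zero] at this
    exact this
  have hspan : Ideal.span {normalFn Q} = Ideal.span {H.sharp ρ} := by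
    obtain ⟨v, hv, hv0⟩ := exists_unit_of_span_eq (hρ3.generates.symm.trans hρ)
    rw [← hv, sharp_mul, Ideal.span_singleton_mul_right_unit, hT, hMQ]
    · rfl
    · apply isUnit_of_constantCoeff
      rwa [constantCoeff_sharp]
  obtain ⟨c, hc, hc0⟩ := exists_unit_of_span_eq hspan
  have hN := constantCoeff_normalFn hQ
  have e1 : ∀ k, ∑ i, gradZeta ρ i * starRingEnd ℂ (H.derivAtZero i k) =
      constantCoeff c * gradZeta (normalFn Q) k := by
    intro k
    rw [← gradZeta_mul hN, hc, gradZeta, pderiv_inr_sharp, map_sum]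
    simp only [map_mul, constantCoeff_sharp, constantCoeff_inZeta, constantCoeff_conj]
    rfl
  refine ⟨constantCoeff c, hQ, fun u hu => leviMatrix_nondegenerate hQ hLM hu, hρ0, hc0,
    fun k => ?_, ?_, fun k j => ?_, hLM'.right hgradZeta, hgradZ⟩
  · rw [e1, gradZeta_normalFn_castSucc hQ, mul_zero]
  · rw [e1, gradZeta_normalFn_last hQ, mul_neg_one]
  · have h1 : mixedHess (H.sharp ρ) k.castSucc j.castSucc =
        ∑ i, ∑ m, mixedHess ρ i m * H.derivAtZero i k.castSucc *
          starRingEnd ℂ (H.derivAtZero m j.castSucc) := by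
      rw [mixedHess, pderiv_inr_sharp, map_sum, map_sum, Finset.sum_comm]
      refine Finset.sum_congr rfl fun m _ => ?_
      rw [Derivation.leibniz, pderiv_inl_inZeta, smul_zero, zero_add, smul_eq_mul, map_mul,
        constantCoeff_inZeta, constantCoeff_conj, pderiv_inl_sharp, map_sum, Finset.mul_sum]
      refine Finset.sum_congr rfl fun i _ => ?_
      rw [map_mul, constantCoeff_sharp, constantCoeff_inZ, mul_comm]
      rfl
    rw [← h1, ← hc, mixedHess_mul hN, mixedHess_normalFn, gradZ_normalFn_castSucc hQ,
      gradZeta_normalFn_castSucc hQ]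
    ring

end Model

/-! ### Defining functions in graph form. -/

section Canonical

variable {σ : Type} [Finite σ] [DecidableEq σ]

omit [Finite σ] in
theorem update_const {s : σ} {g : Ser σ} (hg : constantCoeff g = 0) (i : σ) :
    constantCoeff (Function.update (fun i => (X i : Ser σ)) s g i) = 0 := by
  by_cases h : i = s
  · subst h; simpa using hg
  · simp [h]

/-- The series `f` with the indeterminate `x_s` replaced by a new one. -/
def freshVar (s : σ) : σ → Ser (σ ⊕ Unit) :=
  Function.update (fun i => X (Sum.inl i)) s (X (Sum.inr ()))

omit [Finite σ] in
theorem freshVar_const (s i : σ) : constantCoeff (freshVar s i) = 0 := by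
  unfold freshVar
  by_cases h : i = s
  · subst h; simp
  · simp [h]

theorem subst_freshVar (s : σ) {g : Ser σ} (hg : constantCoeff g = 0) (f : Ser σ) :
    subst (Sum.elim (fun i => (X i : Ser σ)) fun _ => g) (subst (freshVar s) f) =
      subst (Function.update (fun i => (X i : Ser σ)) s g) f := by
  have he := elim_const (X_const (σ := σ)) (b := fun _ : Unit => g) (fun _ => hg)
  rw [subst_subst (freshVar_const s) he]
  congr 1
  funext i
  unfold freshVar
  by_cases h : i = s
  · subst h
    rw [Function.update_self, Function.update_self, subst_X (hs he), Sum.elim_inr]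
  · rw [Function.update_of_ne h, Function.update_of_ne h, subst_X (hs he), Sum.elim_inl]

theorem constantCoeff_pderiv_freshVar (s : σ) (f : Ser σ) :
    constantCoeff (pderiv ℂ (Sum.inr ()) (subst (freshVar s) f)) =
      constantCoeff (pderiv ℂ s f) := by
  cases nonempty_fintype σ
  rw [pderiv_subst (freshVar_const s), map_sum, Finset.sum_eq_single s]
  · rw [map_mul, constantCoeff_subst_zero (freshVar_const s), freshVar, Function.update_self,
      pderiv_X_self, map_one, mul_one]
  · intro i _ hi
    rw [freshVar, Function.update_of_ne hi, pderiv_X_of_ne (by simp), mul_zero, map_zero]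
  · simp

/-- The implicit function is produced in a ring that still contains x_s. Setting x_s to zero
afterwards preserves the equation, since x_s has been substituted away in `f`. -/
theorem exists_graph {f : Ser σ} (hf : constantCoeff f = 0) {s : σ}
    (hs' : constantCoeff (pderiv ℂ s f) ≠ 0) :
    ∃ g : Ser σ, constantCoeff g = 0 ∧ kill {s} g = g ∧
      subst (Function.update (fun i => (X i : Ser σ)) s g) f = 0 := by
  obtain ⟨g, hg, hfg⟩ := exists_implicit (f := subst (freshVar s) f)
    (by rw [constantCoeff_subst_zero (freshVar_const s), hf])
    (by rwa [constantCoeff_pderiv_freshVar])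
  have hk : constantCoeff (kill {s} g) = 0 := by rw [constantCoeff_kill, hg]
  refine ⟨kill {s} g, hk, kill_idem _ _, ?_⟩
  rw [subst_freshVar s hg] at hfg
  have h1 := congrArg (kill {s}) hfg
  have hkX := fun i => kill_X ({s} : Finset σ) i
  unfold kill at h1 hkX
  rw [subst_subst (update_const hg) (kill_const _), subst_zero' (kill_const _)] at h1
  rw [← h1]
  congr 1
  funext i
  by_cases h : i = s
  · subst h
    rw [Function.update_self, Function.update_self]
    rfl
  · rw [Function.update_of_ne h, Function.update_of_ne h, hkX, if_neg (by simpa using h)]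

theorem IsTame.of_graph {P : ∀ σ : Type, Ser σ → Prop} (hP : IsTame P) {f g : Ser σ} {s : σ}
    (hs' : constantCoeff (MvPowerSeries.pderiv ℂ s f) ≠ 0) (hg : constantCoeff g = 0)
    (hfg : subst (Function.update (fun i => (X i : Ser σ)) s g) f = 0) (hf : P σ f) : P σ g := by
  rw [← subst_freshVar s hg] at hfg
  refine hP.implicit hg (by rwa [constantCoeff_pderiv_freshVar]) hfg (hP.comp (freshVar_const s) ?_ hf)
  intro i
  unfold freshVar
  by_cases h : i = s
  · subst h; simpa using hP.var _
  · simpa [h] using hP.var _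

theorem subst_update_kill (s : σ) {g : Ser σ} (hg : constantCoeff g = 0) (f : Ser σ) :
    subst (Function.update (fun i => (X i : Ser σ)) s g) (kill {s} f) = kill {s} f := by
  have hu := update_const (s := s) hg
  rw [kill, subst_subst (kill_const _) hu]
  congr 1
  funext j
  by_cases h : j = s
  · rw [if_pos (by simpa using h), subst_zero' hu]
  · rw [if_neg (by simpa using h), subst_X (hs hu), Function.update_of_ne h]

/-- In the form x_s − g the function g is the implicit solution for every defining function. So it
inherits the regularity of whichever of them is regular, and a single ρ serves all regularity
classes. -/
theorem exists_canonical {ι : Type} [Finite ι] (M : FormalHypersurface ι) :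
    ∃ ρ : Series2 ι, M.ideal = Ideal.span {ρ} ∧ constantCoeff ρ = 0 ∧
      ∀ P : ∀ σ : Type, Ser σ → Prop, IsTame P →
        (∃ ρ', IsDefiningFunction M.ideal ρ' ∧ P _ ρ') → P _ ρ := by
  classical
  obtain ⟨ρ', hρ'⟩ := M.exists_definingFunction
  cases nonempty_fintype ι
  obtain ⟨i, hi⟩ := hρ'.gradient_ne_zero
  obtain ⟨g, hg, hgk, hgρ⟩ := exists_graph hρ'.zero_mem hi
  set s : ι ⊕ ι := Sum.inl i
  have hu := update_const (s := s) hg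
  have hmem : ρ' ∈ Ideal.span {(X s : Series2 ι) - g} := by
    have := subst_sub_mem ρ' X_const hu (I := Ideal.span {(X s : Series2 ι) - g}) ?_
    · rwa [hgρ, sub_zero, subst_X_eq] at this
    · intro j
      by_cases h : j = s
      · subst h
        rw [Function.update_self]
        exact Ideal.mem_span_singleton_self _
      · simp [h]
  obtain ⟨u, hu'⟩ := Ideal.mem_span_singleton.mp hmem
  have hc : constantCoeff ((X s : Series2 ι) - g) = 0 := by simp [hg]
  have hu0 : constantCoeff u ≠ 0 := by
    intro h0
    have := gradZ_mul hc u i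
    rw [← hu', h0, zero_mul] at this
    exact hi this
  have hgen : M.ideal = Ideal.span {(X s : Series2 ι) - g} := by
    rw [hρ'.generates, hu', Ideal.span_singleton_mul_right_unit (isUnit_of_constantCoeff hu0)]
  refine ⟨X s - g, hgen, hc, fun P hP ⟨ρ2, hρ2, hPρ2⟩ => hP.sub (hP.var _) ?_⟩
  obtain ⟨v, hv, hv0⟩ := exists_unit_of_span_eq (hgen.symm.trans hρ2.generates)
  have hsub : subst (Function.update (fun i => (X i : Series2 ι)) s g) g = g := by
    have := subst_update_kill s hg g
    rwa [hgk] at this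
  refine hP.of_graph (s := s) (f := ρ2) ?_ hg ?_ hPρ2
  · have h1 : constantCoeff (pderiv ℂ s ((X s : Series2 ι) - g)) = 1 := by
      rw [map_sub, pderiv_X_self, ← hgk, pderiv_kill (by simp)]
      simp
    have h2 := gradZ_mul hc v i
    rw [gradZ, gradZ, h1, mul_one, hv] at h2
    rw [h2]
    exact hv0
  · rw [← hv, subst_mul (hs hu), subst_sub (hs hu), hsub, subst_X (hs hu), Function.update_self,
      sub_self, zero_mul]

theorem IsTame.of_normalFn {n : ℕ} {P : ∀ σ : Type, Ser σ → Prop} (hP : IsTame P)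
    {M : FormalHypersurface (Fin (n + 1))} {Q : Ser (CRVar n)} (hQ : IsNormal Q)
    (hMQ : M.ideal = Ideal.span {X (Sum.inl (Fin.last n)) - normalSubst Q})
    (h : ∃ ρ', IsDefiningFunction M.ideal ρ' ∧ P _ ρ') : P _ Q := by
  obtain ⟨ρ2, hρ2, hPρ2⟩ := h
  obtain ⟨v, hv, hv0⟩ := exists_unit_of_span_eq (hMQ.symm.trans hρ2.generates)
  have hQc : constantCoeff (normalSubst Q) = 0 := by rw [constantCoeff_normalSubst, hQ.const]
  have hu := update_const (s := Sum.inl (Fin.last n)) hQc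
  have key : P _ (normalSubst Q) := by
    refine hP.of_graph (s := Sum.inl (Fin.last n)) (f := ρ2) ?_ hQc ?_ hPρ2
    · have := gradZ_mul (constantCoeff_normalFn hQ) v (Fin.last n)
      rw [gradZ_normalFn_last, mul_one] at this
      rw [← hv]
      rw [gradZ, normalFn] at this
      rw [this]
      exact hv0
    · have hsub : subst (Function.update (fun i => (X i : Series2 (Fin (n + 1))))
          (Sum.inl (Fin.last n)) (normalSubst Q)) (normalSubst Q) = normalSubst Q := by
        conv_lhs => rw [normalSubst_eq Q]
        rw [← normalSubst_eq Q, normalSubst_eq Q, subst_subst normalVar_const]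
        · congr 1
          funext j
          rw [← normalSubst_eq Q]
          rcases j with j | j | j
          · rw [normalVar_inl, subst_X (hs hu), Function.update_of_ne]
            simp
          · rw [normalVar_inr_inl, subst_X (hs hu), Function.update_of_ne (by simp)]
          · rw [normalVar_inr_inr, subst_X (hs hu), Function.update_of_ne (by simp)]
        · rw [← normalSubst_eq]; exact hu
      rw [← hv, subst_mul (hs hu), subst_sub (hs hu), hsub, subst_X (hs hu), Function.update_self,
        sub_self, zero_mul]
  -- Restriction along w = 0 suffices to undo the renaming, because the renamed series does not
  -- involve w.
  have h0 : constantCoeff (0 : Ser (CRVar n)) = 0 := map_zero _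
  rw [← restrict_normalSubst h0 Q]
  refine hP.comp (restrict_const h0) ?_ key
  rintro (i | i)
  · refine Fin.lastCases ?_ (fun j => ?_) i
    · simpa using hP.zero
    · simpa using hP.var _
  · refine Fin.lastCases ?_ (fun j => ?_) i
    · simpa using hP.var _
    · simpa using hP.var _

end Canonical

end

end FormalCR

namespace FormalCR

open MvPowerSeries

noncomputable section

/-! ### Nonsingularity and solution of the basic system. -/

section BaseSolution

variable {n : ℕ}

/-- The values at the origin of the rows `jetRow`. -/
def jetRow0 (ρ : Series2 (Fin (n + 2))) (Λ : Matrix (Fin (n + 2)) (Fin (n + 1)) ℂ) :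
    Fin (n + 1) → Fin (n + 2) → ℂ :=
  Fin.cases (gradZeta ρ) fun k m => ∑ i, mixedHess ρ i m * Λ i k.castSucc

/-- The value at the origin of `jetNormal`. -/
def jetNormal0 (ρ : Series2 (Fin (n + 2))) (Λ : Matrix (Fin (n + 2)) (Fin (n + 1)) ℂ)
    (m : Fin (n + 2)) : ℂ := cofactor (jetRow0 ρ Λ) m

theorem constantCoeff_jetNormal {υ : Type} {ρ : Series2 (Fin (n + 2))}
    {Λ : Matrix (Fin (n + 2)) (Fin (n + 1)) ℂ} {e : Fin (n + 2) ⊕ Fin (n + 2) → Ser υ}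
    (he : ∀ i, constantCoeff (e i) = 0) {p : Fin (n + 2) → Fin (n + 1) → Ser υ}
    (hp : ∀ i k, constantCoeff (p i k) = Λ i k) {q : Fin n → Ser υ}
    (hq : ∀ k, constantCoeff (q k) = 0) (m : Fin (n + 2)) :
    constantCoeff (jetNormal ρ e p q m) = jetNormal0 ρ Λ m := by
  rw [jetNormal, map_cofactor, jetNormal0]
  congr 1
  funext k j
  refine Fin.cases ?_ (fun k => ?_) k
  · rw [jetRow_zero, constantCoeff_subst_zero he]; rfl
  · rw [jetRow_succ, map_sum]
    refine Finset.sum_congr rfl fun i _ => ?_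
    rw [map_mul, map_add, map_mul, constantCoeff_subst_zero he, hp, hq, zero_mul, add_zero]
    rfl

/-- The values at the origin of the vectors annihilated by `ρ_{ζ′}`. -/
def frame0 (ρ : Series2 (Fin (n + 2))) (Λ : Matrix (Fin (n + 2)) (Fin (n + 1)) ℂ) :
    Fin (n + 1) → Fin (n + 2) → ℂ :=
  Fin.lastCases (jetNormal0 ρ Λ) fun j m => starRingEnd ℂ (Λ m j.castSucc)

@[simp] theorem frame0_last (ρ : Series2 (Fin (n + 2))) (Λ : Matrix (Fin (n + 2)) (Fin (n + 1)) ℂ) :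
    frame0 ρ Λ (Fin.last n) = jetNormal0 ρ Λ := by simp [frame0]

@[simp] theorem frame0_castSucc (ρ : Series2 (Fin (n + 2)))
    (Λ : Matrix (Fin (n + 2)) (Fin (n + 1)) ℂ) (j : Fin n) (m : Fin (n + 2)) :
    frame0 ρ Λ j.castSucc m = starRingEnd ℂ (Λ m j.castSucc) := by simp [frame0]

namespace IsModel

variable {Q : Ser (CRVar n)} {ρ : Series2 (Fin (n + 2))}
  {Λ : Matrix (Fin (n + 2)) (Fin (n + 1)) ℂ} {c : ℂ} (h : IsModel Q ρ Λ c)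
include h

theorem nondeg' {u : Fin n → ℂ} (hu : ∀ k, ∑ j, leviMatrix Q k j * u j = 0) : u = 0 := by
  by_contra hne
  have hdet : (Matrix.of (leviMatrix Q)).det = 0 :=
    Matrix.exists_mulVec_eq_zero_iff.mp ⟨u, hne, funext hu⟩
  obtain ⟨v, hv, hv'⟩ := Matrix.exists_vecMul_eq_zero_iff.mpr hdet
  refine hv (h.nondeg v fun j => ?_)
  refine Eq.trans ?_ (congrFun hv' j)
  exact Finset.sum_congr rfl fun k _ => mul_comm _ _

omit h in
theorem gradZeta_jetNormal0 : ∑ m, gradZeta ρ m * jetNormal0 ρ Λ m = 0 :=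
  sum_row_mul_cofactor (jetRow0 ρ Λ) 0

omit h in
theorem mixedHess_jetNormal0 (k : Fin n) :
    ∑ m, (∑ i, mixedHess ρ i m * Λ i k.castSucc) * jetNormal0 ρ Λ m = 0 :=
  sum_row_mul_cofactor (jetRow0 ρ Λ) k.succ

theorem levi' (k j : Fin n) : ∑ m, (∑ i, mixedHess ρ i m * Λ i k.castSucc) *
    starRingEnd ℂ (Λ m j.castSucc) = -c * leviMatrix Q k j := by
  rw [← h.levi, Finset.sum_comm]
  exact Finset.sum_congr rfl fun m _ => Finset.sum_mul _ _ _

/-- The rows at 0 are independent. Pairing a relation with the conjugate tangent columns of `Λ`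
gives the Levi matrix of M and removes the differentiated rows; transversality then removes ρ_{ζ′}.
-/
theorem jetNormal0_ne_zero : jetNormal0 ρ Λ ≠ 0 := by
  have hli : LinearIndependent ℂ (jetRow0 ρ Λ) := by
    rw [Fintype.linearIndependent_iff]
    intro g hg
    have hg' : ∀ m, g 0 * gradZeta ρ m +
        ∑ k : Fin n, g k.succ * ∑ i, mixedHess ρ i m * Λ i k.castSucc = 0 := by
      intro m
      have := congrFun hg m
      rw [Fin.sum_univ_succ] at this
      simpa [jetRow0] using this
    have hk : (fun k : Fin n => g k.succ) = 0 := by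
      apply h.nondeg
      intro j
      have h1 : g 0 * ∑ m, gradZeta ρ m * starRingEnd ℂ (Λ m j.castSucc) +
          ∑ k : Fin n, g k.succ * ∑ m, (∑ i, mixedHess ρ i m * Λ i k.castSucc) *
            starRingEnd ℂ (Λ m j.castSucc) = 0 := by
        have : ∑ m, (g 0 * gradZeta ρ m +
            ∑ k : Fin n, g k.succ * ∑ i, mixedHess ρ i m * Λ i k.castSucc) *
              starRingEnd ℂ (Λ m j.castSucc) = 0 := by simp [hg']
        rw [← this]
        simp only [add_mul, Finset.sum_add_distrib, Finset.mul_sum, Finset.sum_mul]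
        congr 1
        · exact Finset.sum_congr rfl fun _ _ => by ring
        · rw [Finset.sum_comm]
          exact Finset.sum_congr rfl fun _ _ => Finset.sum_congr rfl fun _ _ =>
            Finset.sum_congr rfl fun _ _ => by ring
      rw [h.cotangent, mul_zero, zero_add] at h1
      have h2 : ∀ k : Fin n, ∑ m, (∑ i, mixedHess ρ i m * Λ i k.castSucc) *
        starRingEnd ℂ (Λ m j.castSucc) = -c * leviMatrix Q k j := fun k => h.levi' k j
      simp only [h2] at h1
      have h3 : -c * ∑ k, leviMatrix Q k j * g k.succ = 0 := by
        rw [← h1, Finset.mul_sum]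
        exact Finset.sum_congr rfl fun k _ => by ring
      exact (mul_eq_zero.mp h3).resolve_left (neg_ne_zero.mpr h.ne_zero)
    have hk' : ∀ k : Fin n, g k.succ = 0 := fun k => congrFun hk k
    intro i
    refine Fin.cases ?_ hk' i
    by_contra hne
    have h0 : ∀ m, gradZeta ρ m = 0 := by
      intro m
      have := hg' m
      simp only [hk', zero_mul, Finset.sum_const_zero, add_zero] at this
      exact (mul_eq_zero.mp this).resolve_left hne
    have := h.transversal
    simp only [h0, zero_mul, Finset.sum_const_zero] at this
    exact h.ne_zero (neg_eq_zero.mp this.symm)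
  obtain ⟨i, hi⟩ := exists_cofactor_ne_zero hli
  intro h0
  exact hi (congrFun h0 i)

/-- Pairing a relation with the differentiated rows annihilates the normal and turns the tangent
columns into the Levi matrix of M. What remains is a multiple of the normal, which is not zero. -/
theorem frame0_independent {v : Fin (n + 1) → ℂ} (hv : ∀ m, ∑ l, v l * frame0 ρ Λ l m = 0) :
    v = 0 := by
  have hv' : ∀ m, ∑ j : Fin n, v j.castSucc * starRingEnd ℂ (Λ m j.castSucc) +
      v (Fin.last n) * jetNormal0 ρ Λ m = 0 := by
    intro m
    have := hv m
    rw [Fin.sum_univ_castSucc] at this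
    simpa using this
  have hj : (fun j : Fin n => v j.castSucc) = 0 := by
    apply h.nondeg'
    intro k
    have h1 : ∑ m, (∑ i, mixedHess ρ i m * Λ i k.castSucc) *
        (∑ j : Fin n, v j.castSucc * starRingEnd ℂ (Λ m j.castSucc) +
          v (Fin.last n) * jetNormal0 ρ Λ m) = 0 := by simp [hv']
    simp only [mul_add, Finset.sum_add_distrib] at h1
    have h2 : ∑ m, (∑ i, mixedHess ρ i m * Λ i k.castSucc) *
        (v (Fin.last n) * jetNormal0 ρ Λ m) = 0 := by
      simp only [mul_left_comm _ (v (Fin.last n))]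
      rw [← Finset.mul_sum, mixedHess_jetNormal0 k, mul_zero]
    rw [h2, add_zero] at h1
    simp only [Finset.mul_sum (s := (Finset.univ : Finset (Fin n))),
      mul_left_comm _ (v (Fin.castSucc _))] at h1
    rw [Finset.sum_comm] at h1
    simp only [← Finset.mul_sum, h.levi'] at h1
    have h3 : -c * ∑ j, leviMatrix Q k j * v j.castSucc = 0 := by
      rw [← h1, Finset.mul_sum]
      exact Finset.sum_congr rfl fun k _ => by ring
    exact (mul_eq_zero.mp h3).resolve_left (neg_ne_zero.mpr h.ne_zero)
  have hj' : ∀ j : Fin n, v j.castSucc = 0 := fun j => congrFun hj j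
  funext l
  refine Fin.lastCases ?_ hj' l
  by_contra hne
  apply h.jetNormal0_ne_zero
  funext m
  have := hv' m
  simp only [hj', zero_mul, Finset.sum_const_zero, zero_add] at this
  exact (mul_eq_zero.mp this).resolve_left hne

theorem gradZeta_frame0 (l : Fin (n + 1)) : ∑ m, gradZeta ρ m * frame0 ρ Λ l m = 0 := by
  refine Fin.lastCases ?_ (fun j => ?_) l
  · rw [frame0_last]; exact gradZeta_jetNormal0
  · simp only [frame0_castSucc]; exact h.cotangent j

/-- A left kernel vector combines the frame into a vector annihilated by ρ_{ζ′} whose image under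
the mixed Hessian is a multiple of ρ_{Z′}. Right nondegeneracy of ρ makes that combination zero, so
independence of the frame leaves only a multiple of ρ_{Z′}, which is nonzero. -/
theorem jacobian_injective {u : Fin (n + 2) → ℂ} (h0 : ∑ i, gradZ ρ i * u i = 0)
    (hl : ∀ l, ∑ i, (∑ m, mixedHess ρ i m * frame0 ρ Λ l m) * u i = 0) : u = 0 := by
  let J : Matrix (Fin (n + 2)) (Fin (n + 2)) ℂ :=
    Matrix.of (Fin.cases (gradZ ρ) fun l i => ∑ m, mixedHess ρ i m * frame0 ρ Λ l m)
  by_contra hne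
  have hdet : J.det = 0 := by
    refine Matrix.exists_mulVec_eq_zero_iff.mp ⟨u, hne, funext fun l => ?_⟩
    refine Fin.cases ?_ (fun l => ?_) l
    · exact h0
    · exact hl l
  obtain ⟨v, hv, hv'⟩ := Matrix.exists_vecMul_eq_zero_iff.mpr hdet
  have h1 : ∀ i, ∑ m, mixedHess ρ i m * (∑ l, v (Fin.succ l) * frame0 ρ Λ l m) =
      -v 0 * gradZ ρ i := by
    intro i
    have := congrFun hv' i
    rw [Matrix.vecMul, dotProduct, Fin.sum_univ_succ] at this
    simp only [J, Matrix.of_apply, Fin.cases_zero, Fin.cases_succ, Pi.zero_apply] at this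
    simp only [Finset.mul_sum, mul_left_comm _ (v (Fin.succ _))] at this ⊢
    rw [Finset.sum_comm]
    linear_combination this
  have h2 := h.right (fun m => ∑ l, v (Fin.succ l) * frame0 ρ Λ l m) (-v 0) (by
    simp only [Finset.mul_sum, mul_left_comm _ (v (Fin.succ _))]
    rw [Finset.sum_comm]
    simp only [← Finset.mul_sum, h.gradZeta_frame0, mul_zero, Finset.sum_const_zero]) h1
  have h3 := h.frame0_independent (v := fun l => v l.succ) fun m => congrFun h2 m
  have h4 : v 0 = 0 := by
    obtain ⟨i, hi⟩ := h.grad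
    have := h1 i
    have h2' : ∀ m, ∑ l, v (Fin.succ l) * frame0 ρ Λ l m = 0 := fun m => congrFun h2 m
    simp only [h2', mul_zero, Finset.sum_const_zero] at this
    simpa using (mul_eq_zero.mp this.symm).resolve_right hi
  apply hv
  funext l
  exact Fin.cases h4 (fun l => congrFun h3 l) l

end IsModel

/-- The unknowns `h̄` and `Y` of the basic system. -/
abbrev BaseVar (n : ℕ) : Type := Fin (n + 2) ⊕ (Fin (n + 1) × Fin (n + 2))

/-- The point `(U, h̄)`. -/
def basePt : Fin (n + 2) ⊕ Fin (n + 2) → Ser (BaseVar n ⊕ Fin (n + 2)) :=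
  Sum.elim (fun i => X (Sum.inr i)) fun m => X (Sum.inl (Sum.inl m))

theorem basePt_const (i : Fin (n + 2) ⊕ Fin (n + 2)) :
    constantCoeff (basePt i : Ser (BaseVar n ⊕ Fin (n + 2))) = 0 := by
  rcases i with i | i <;> simp [basePt]

/-- The equations `ρ(U, h̄) = 0` and `∑ ρ_{ζ′_m}(U, h̄) Y_{lm} = 0`. -/
def baseSystem (ρ : Series2 (Fin (n + 2))) (Λ : Matrix (Fin (n + 2)) (Fin (n + 1)) ℂ) :
    Fin (n + 2) → Ser (BaseVar n ⊕ Fin (n + 2)) :=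
  Fin.cases (subst basePt ρ) fun l => ∑ m, subst basePt (pderiv ℂ (Sum.inr m) ρ) *
    (C (frame0 ρ Λ l m) + X (Sum.inl (Sum.inr (l, m))))

theorem pderiv_basePt (φ : Series2 (Fin (n + 2))) (i : Fin (n + 2)) :
    constantCoeff (pderiv ℂ (Sum.inr i) (subst basePt φ : Ser (BaseVar n ⊕ Fin (n + 2)))) =
      constantCoeff (pderiv ℂ (Sum.inl i) φ) := by
  classical
  rw [pderiv_subst basePt_const, Fintype.sum_sum_type]
  simp only [map_add, map_sum, map_mul, constantCoeff_subst_zero basePt_const]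
  simp [basePt, pderiv_X, Pi.single_apply]

/-- The vectors Y are treated as free parameters near their values at the origin. The implicit
solution then depends on ρ and `Λ` only, and uniqueness identifies every actual solution with a
specialization of it. -/
theorem exists_base_solution {Q : Ser (CRVar n)} {ρ : Series2 (Fin (n + 2))}
    {Λ : Matrix (Fin (n + 2)) (Fin (n + 1)) ℂ} {c : ℂ} (h : IsModel Q ρ Λ c) :
    ∃ Ψ : Fin (n + 2) → Ser (BaseVar n), (∀ i, constantCoeff (Ψ i) = 0) ∧
      (∀ P, IsTame P → P _ ρ → ∀ i, P _ (Ψ i)) ∧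
      ∀ {υ : Type} [Finite υ] (U g : Fin (n + 2) → Ser υ) (Y : Fin (n + 1) → Fin (n + 2) → Ser υ),
        (∀ i, constantCoeff (U i) = 0) → (∀ i, constantCoeff (g i) = 0) →
        (∀ l m, constantCoeff (Y l m) = frame0 ρ Λ l m) →
        subst (Sum.elim U g) ρ = 0 →
        (∀ l, ∑ m, subst (Sum.elim U g) (pderiv ℂ (Sum.inr m) ρ) * Y l m = 0) →
        ∀ i, U i = subst (Sum.elim g fun p => Y p.1 p.2 - C (frame0 ρ Λ p.1 p.2)) (Ψ i) := by
  have hJ : ∀ u : Fin (n + 2) → ℂ, (∀ i, ∑ j, constantCoeff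
      (pderiv ℂ (Sum.inr j) (baseSystem ρ Λ i)) * u j = 0) → u = 0 := by
    intro u hu
    refine h.jacobian_injective (u := u) ?_ fun l => ?_
    · have := hu 0
      simp only [baseSystem, Fin.cases_zero, pderiv_basePt] at this
      exact this
    · rw [← hu l.succ]
      refine Finset.sum_congr rfl fun i _ => ?_
      congr 1
      simp only [baseSystem, Fin.cases_succ, map_sum]
      refine Finset.sum_congr rfl fun m _ => ?_
      rw [Derivation.leibniz, map_add, map_add, pderiv_C, pderiv_X_of_ne (by simp), smul_eq_mul,
        smul_eq_mul, map_mul, map_mul, pderiv_basePt, mixedHess]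
      simp [mul_comm]
  obtain ⟨Ψ, hΨ, hsol, hP⟩ := exists_implicit_system (baseSystem ρ Λ) (fun i => by
    refine Fin.cases ?_ (fun l => ?_) i
    · rw [baseSystem, Fin.cases_zero, constantCoeff_subst_zero basePt_const, h.const]
    · simp only [baseSystem, Fin.cases_succ, map_sum, map_mul, map_add,
        constantCoeff_subst_zero basePt_const, constantCoeff_C, constantCoeff_X, add_zero]
      exact h.gradZeta_frame0 l) hJ
  refine ⟨Ψ, hΨ, fun P hT hρ => hP P hT fun i => ?_, ?_⟩
  · have hbP : ∀ i : Fin (n + 2) ⊕ Fin (n + 2), P (BaseVar n ⊕ Fin (n + 2)) (basePt i) := by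
      rintro (i | i)
      · exact hT.var _
      · exact hT.var _
    refine Fin.cases ?_ (fun l => ?_) i
    · exact hT.comp basePt_const hbP hρ
    · rw [baseSystem, Fin.cases_succ]
      exact hT.sum fun m _ => hT.mul (hT.comp basePt_const hbP (hT.pderiv _ hρ))
        (hT.add (hT.const _) (hT.var _))
  · intro υ _ U g Y hU hg hY h0 hl i
    set a : BaseVar n → Ser υ := Sum.elim g fun p => Y p.1 p.2 - C (frame0 ρ Λ p.1 p.2) with ha'
    have ha : ∀ i, constantCoeff (a i) = 0 := by
      rintro (i | i)
      · exact hg i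
      · simp [a, hY]
    have hb : ∀ i, constantCoeff (subst a (Ψ i)) = 0 := fun i => by
      rw [constantCoeff_subst_zero ha, hΨ]
    have := implicit_unique hJ ha hU hb (fun i => ?_) (fun i => ?_)
    · exact congrFun this i
    · have he := elim_const ha hU
      have hpt : ∀ φ : Series2 (Fin (n + 2)), subst (Sum.elim a U) (subst basePt φ) =
          subst (Sum.elim U g) φ := by
        intro φ
        rw [subst_subst basePt_const he]
        congr 1
        funext i
        have hX := subst_X (hs he) (R := ℂ)
        rcases i with i | i
        · exact hX _
        · exact hX _
      refine Fin.cases ?_ (fun l => ?_) i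
      · rw [baseSystem, Fin.cases_zero, hpt, h0]
      · rw [baseSystem, Fin.cases_succ, subst_sum he, ← hl l]
        refine Finset.sum_congr rfl fun m _ => ?_
        rw [subst_mul (hs he), subst_add (hs he), hpt, subst_C', subst_X (hs he)]
        simp [a]
    · have he := elim_const (X_const (σ := BaseVar n)) hΨ
      have h1 := congrArg (subst a) (hsol i)
      rw [subst_subst he ha, subst_zero' ha] at h1
      rw [← h1]
      congr 1
      funext j
      rcases j with j | j
      · exact (subst_X (hs ha) j).symm
      · rfl

end BaseSolution

/-! ### The basic system along a given map. -/

section BasicSystem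

variable {n : ℕ} {Q : Ser (CRVar n)} {ρ : Series2 (Fin (n + 2))}
  {Λ : Matrix (Fin (n + 2)) (Fin (n + 1)) ℂ} {c : ℂ} {H : Fin (n + 2) → Ser (Fin (n + 1))}

theorem pderiv_chi_onZeta (f : Ser (Fin (n + 1))) (j : Fin n) :
    pderiv ℂ (Sum.inr (Sum.inl j)) (subst onZeta f : Ser (CRVar n)) =
      subst onZeta (pderiv ℂ j.castSucc f) := by
  classical
  rw [pderiv_subst onZeta_const, Fin.sum_univ_castSucc]
  simp [pderiv_X, Pi.single_apply]

theorem pderiv_tau_onZeta (f : Ser (Fin (n + 1))) :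
    pderiv ℂ (Sum.inr (Sum.inr ())) (subst onZeta f : Ser (CRVar n)) =
      subst onZeta (pderiv ℂ (Fin.last n) f) := by
  classical
  rw [pderiv_subst onZeta_const, Fin.sum_univ_castSucc]
  simp

theorem pderiv_zeta_onZ (hQ : constantCoeff Q = 0) (f : Ser (Fin (n + 1))) (s : Fin n ⊕ Unit) :
    pderiv ℂ (Sum.inr s) (subst (onZ Q) f) =
      subst (onZ Q) (pderiv ℂ (Fin.last n) f) * pderiv ℂ (Sum.inr s) Q := by
  classical
  rw [pderiv_subst (onZ_const hQ), Fin.sum_univ_castSucc]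
  simp

/-- The vector `Q_τ ∂_{χ_j} H̄ - Q_{χ_j} ∂_τ H̄`, where `p` is the Jacobian of `H̄`. -/
def crRow {υ : Type} (qτ qχ : Ser υ) (pχ pτ : Ser υ) : Ser υ := qτ * pχ - qχ * pτ

/-- The field Q_τ ∂_{χ_j} − Q_{χ_j} ∂_τ annihilates z and Q, hence H(z,Q). Applied to ρ(H,H̄) = 0 it
leaves only the terms in which H̄ is differentiated. -/
theorem sum_crRow (h : IsNormal Q) (hH : Realizes Q ρ Λ H) (j : Fin n) :
    ∑ m, subst (jetVar Q H) (pderiv ℂ (Sum.inr m) ρ) *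
      crRow (pderiv ℂ (Sum.inr (Sum.inr ())) Q) (pderiv ℂ (Sum.inr (Sum.inl j)) Q)
        (subst onZeta (conj (pderiv ℂ j.castSucc (H m))))
        (subst onZeta (conj (pderiv ℂ (Fin.last n) (H m)))) = 0 := by
  have hc := jetVar_const h.const hH.const
  have e1 := congrArg (pderiv ℂ (Sum.inr (Sum.inl j))) hH.eq
  have e2 := congrArg (pderiv ℂ (Sum.inr (Sum.inr ()))) hH.eq
  rw [map_zero, pderiv_subst hc, Fintype.sum_sum_type] at e1 e2
  simp only [jetVar_inl, jetVar_inr, pderiv_zeta_onZ h.const, pderiv_chi_onZeta,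
    pderiv_tau_onZeta, pderiv_conj] at e1 e2
  have e3 : (pderiv ℂ (Sum.inr (Sum.inr ())) Q) * (∑ i, subst (jetVar Q H) (pderiv ℂ (Sum.inl i) ρ) *
      (subst (onZ Q) (pderiv ℂ (Fin.last n) (H i)) * pderiv ℂ (Sum.inr (Sum.inl j)) Q)) =
      (pderiv ℂ (Sum.inr (Sum.inl j)) Q) * (∑ i, subst (jetVar Q H) (pderiv ℂ (Sum.inl i) ρ) *
      (subst (onZ Q) (pderiv ℂ (Fin.last n) (H i)) * pderiv ℂ (Sum.inr (Sum.inr ())) Q)) := by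
    rw [Finset.mul_sum, Finset.mul_sum]
    exact Finset.sum_congr rfl fun i _ => by ring
  have e4 : ∑ m, subst (jetVar Q H) (pderiv ℂ (Sum.inr m) ρ) *
      crRow (pderiv ℂ (Sum.inr (Sum.inr ())) Q) (pderiv ℂ (Sum.inr (Sum.inl j)) Q)
        (subst onZeta (conj (pderiv ℂ j.castSucc (H m))))
        (subst onZeta (conj (pderiv ℂ (Fin.last n) (H m)))) =
      (pderiv ℂ (Sum.inr (Sum.inr ())) Q) * (∑ m, subst (jetVar Q H) (pderiv ℂ (Sum.inr m) ρ) *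
        subst onZeta (conj (pderiv ℂ j.castSucc (H m)))) -
      (pderiv ℂ (Sum.inr (Sum.inl j)) Q) * (∑ m, subst (jetVar Q H) (pderiv ℂ (Sum.inr m) ρ) *
        subst onZeta (conj (pderiv ℂ (Fin.last n) (H m)))) := by
    rw [Finset.mul_sum, Finset.mul_sum, ← Finset.sum_sub_distrib]
    exact Finset.sum_congr rfl fun i _ => by rw [crRow]; ring
  rw [e4]
  linear_combination (pderiv ℂ (Sum.inr (Sum.inr ())) Q) * e1 -
    (pderiv ℂ (Sum.inr (Sum.inl j)) Q) * e2 - e3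

/-- The vectors annihilated by `ρ_{ζ′}(H, H̄)`, for a map `H`. -/
def frame (Q : Ser (CRVar n)) (ρ : Series2 (Fin (n + 2))) (H : Fin (n + 2) → Ser (Fin (n + 1))) :
    Fin (n + 1) → Fin (n + 2) → Ser (CRVar n) :=
  Fin.lastCases (jetNormal ρ (Sum.elim (fun i => atTau (H i)) fun i => subst onZeta (conj (H i)))
      (fun i k => atTau (pderiv ℂ k (H i))) (fun k => kill (zSet n) (pderiv ℂ (Sum.inl k) Q)))
    fun j m => crRow (pderiv ℂ (Sum.inr (Sum.inr ())) Q) (pderiv ℂ (Sum.inr (Sum.inl j)) Q)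
        (subst onZeta (conj (pderiv ℂ j.castSucc (H m))))
        (subst onZeta (conj (pderiv ℂ (Fin.last n) (H m))))

theorem sum_frame (h : IsNormal Q) (hH : Realizes Q ρ Λ H) (l : Fin (n + 1)) :
    ∑ m, subst (jetVar Q H) (pderiv ℂ (Sum.inr m) ρ) * frame Q ρ H l m = 0 := by
  refine Fin.lastCases ?_ (fun j => ?_) l
  · simp only [frame, Fin.lastCases_last]
    exact hH.normal
  · simp only [frame, Fin.lastCases_castSucc]
    exact sum_crRow h hH j

theorem frame_const (h : IsNormal Q) (hH : Realizes Q ρ Λ H) (l : Fin (n + 1)) (m : Fin (n + 2)) :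
    constantCoeff (frame Q ρ H l m) = frame0 ρ Λ l m := by
  refine Fin.lastCases ?_ (fun j => ?_) l
  · simp only [frame, Fin.lastCases_last, frame0_last]
    refine constantCoeff_jetNormal ?_ (fun i k => ?_) (fun k => ?_) m
    · refine elim_const (fun i => ?_) fun i => ?_
      · rw [atTau, constantCoeff_subst_zero tauVar_const, hH.const]
      · rw [constantCoeff_subst_zero onZeta_const, constantCoeff_conj, hH.const, map_zero]
    · rw [atTau, constantCoeff_subst_zero tauVar_const, hH.deriv]
    · rw [constantCoeff_kill, h.pderiv_z]
  · simp only [frame, Fin.lastCases_castSucc, frame0_castSucc, crRow, map_sub, map_mul,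
      h.pderiv_tau, h.pderiv_chi, constantCoeff_subst_zero onZeta_const, constantCoeff_conj,
      hH.deriv]
    ring

end BasicSystem

end

end FormalCR

namespace FormalCR

open MvPowerSeries

noncomputable section

/-! ### Values at χ = τ = 0 and at τ = 0; the slice H(z,0). -/

section Slices

variable {n : ℕ}

/-- The point `(z, 0, 0)`. -/
def zVar : CRVar n → Ser (Fin n) := Sum.elim (fun j => X j) fun _ => 0

@[simp] theorem zVar_inl (j : Fin n) : (zVar (Sum.inl j) : Ser (Fin n)) = X j := rfl

@[simp] theorem zVar_inr (j : Fin n ⊕ Unit) : (zVar (Sum.inr j) : Ser (Fin n)) = 0 := rfl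

theorem zVar_const (i : CRVar n) : constantCoeff (zVar i : Ser (Fin n)) = 0 := by
  rcases i with i | i <;> simp

/-- `f(z, 0, 0)`. -/
def atZ (f : Ser (CRVar n)) : Ser (Fin n) := subst zVar f

/-- The point `(z, 0)`. -/
def sliceVar : Fin (n + 1) → Ser (Fin n) := Fin.lastCases 0 fun j => X j

@[simp] theorem sliceVar_last : (sliceVar (Fin.last n) : Ser (Fin n)) = 0 := by simp [sliceVar]

@[simp] theorem sliceVar_castSucc (j : Fin n) : (sliceVar j.castSucc : Ser (Fin n)) = X j := by
  simp [sliceVar]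

theorem sliceVar_const (i : Fin (n + 1)) : constantCoeff (sliceVar i : Ser (Fin n)) = 0 := by
  refine Fin.lastCases ?_ (fun j => ?_) i <;> simp

/-- `f(z, 0)`. -/
def slice (f : Ser (Fin (n + 1))) : Ser (Fin n) := subst sliceVar f

/-- `f(χ)`. -/
def inChi (f : Ser (Fin n)) : Ser (CRVar n) := subst (fun j => X (Sum.inr (Sum.inl j))) f

theorem inChi_const (j : Fin n) :
    constantCoeff (X (Sum.inr (Sum.inl j)) : Ser (CRVar n)) = 0 := by simp

theorem atZ_add (f g : Ser (CRVar n)) : atZ (f + g) = atZ f + atZ g := subst_add (hs zVar_const) _ _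

theorem atZ_sub (f g : Ser (CRVar n)) : atZ (f - g) = atZ f - atZ g := subst_sub (hs zVar_const) _ _

theorem atZ_mul (f g : Ser (CRVar n)) : atZ (f * g) = atZ f * atZ g := subst_mul (hs zVar_const) _ _

theorem atZ_zero : atZ (0 : Ser (CRVar n)) = 0 := subst_zero' zVar_const

theorem atZ_C (c : ℂ) : atZ (C c : Ser (CRVar n)) = C c := subst_C' _ _

theorem atZ_sum {ι : Type*} (s : Finset ι) (f : ι → Ser (CRVar n)) :
    atZ (∑ i ∈ s, f i) = ∑ i ∈ s, atZ (f i) := subst_sum zVar_const _ _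

theorem constantCoeff_atZ (f : Ser (CRVar n)) : constantCoeff (atZ f) = constantCoeff f :=
  constantCoeff_subst_zero zVar_const f

theorem constantCoeff_slice (f : Ser (Fin (n + 1))) : constantCoeff (slice f) = constantCoeff f :=
  constantCoeff_subst_zero sliceVar_const f

theorem atZ_kill {S : Finset (CRVar n)} (hS : ∀ i ∈ S, (zVar i : Ser (Fin n)) = 0)
    (f : Ser (CRVar n)) : atZ (kill S f) = atZ f := by
  rw [atZ, kill, subst_subst (kill_const S) zVar_const, atZ]
  congr 1
  funext i
  split_ifs with h
  · rw [hS i h, subst_zero' zVar_const]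
  · rw [subst_X (hs zVar_const)]

theorem atZ_onZeta (f : Ser (Fin (n + 1))) : atZ (subst onZeta f) = C (constantCoeff f) := by
  rw [atZ, subst_subst onZeta_const zVar_const, ← subst_zero_args]
  congr 1
  funext j
  refine Fin.lastCases ?_ (fun j => ?_) j
  · rw [onZeta_last, subst_X (hs zVar_const), zVar_inr]
  · rw [onZeta_castSucc, subst_X (hs zVar_const), zVar_inr]

theorem atZ_atTau (f : Ser (Fin (n + 1))) : atZ (atTau f) = C (constantCoeff f) := by
  rw [atZ, atTau, subst_subst tauVar_const zVar_const, ← subst_zero_args]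
  congr 1
  funext j
  refine Fin.lastCases ?_ (fun j => ?_) j
  · rw [tauVar_last, subst_X (hs zVar_const), zVar_inr]
  · rw [tauVar_castSucc, subst_zero' zVar_const]

theorem zVar_eq_zero_of_mem_chiSet (i : CRVar n) (hi : i ∈ chiSet n) :
    (zVar i : Ser (Fin n)) = 0 := by
  obtain ⟨j, rfl⟩ := (mem_chiSet i).mp hi
  rfl

section Normal

variable {Q : Ser (CRVar n)} (h : IsNormal Q)
include h

theorem IsNormal.atZ : atZ Q = 0 := by
  rw [← atZ_kill zVar_eq_zero_of_mem_chiSet, h.kill_chi, FormalCR.atZ, subst_X (hs zVar_const),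
    zVar_inr]

theorem IsNormal.atZ_pderiv_tau : FormalCR.atZ (pderiv ℂ (Sum.inr (Sum.inr ())) Q) = 1 := by
  rw [← atZ_kill zVar_eq_zero_of_mem_chiSet, kill_pderiv (by simp [mem_chiSet]), h.kill_chi,
    pderiv_X_self, ← map_one (C (R := ℂ)), atZ_C, map_one]

theorem IsNormal.atZ_onZ (f : Ser (Fin (n + 1))) : FormalCR.atZ (subst (onZ Q) f) = slice f := by
  rw [FormalCR.atZ, subst_subst (onZ_const h.const) zVar_const, slice]
  congr 1
  funext j
  refine Fin.lastCases ?_ (fun j => ?_) j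
  · rw [onZ_last, sliceVar_last]; exact h.atZ
  · rw [onZ_castSucc, subst_X (hs zVar_const), sliceVar_castSucc, zVar_inl]

end Normal

theorem slice_pderiv (j : Fin n) (f : Ser (Fin (n + 1))) :
    slice (pderiv ℂ j.castSucc f) = pderiv ℂ j (slice f) := by
  classical
  unfold slice
  rw [pderiv_subst sliceVar_const, Fin.sum_univ_castSucc]
  simp [pderiv_X, Pi.single_apply]

/-- The index of the indeterminate `τ`. -/
abbrev tauSet (n : ℕ) : Finset (CRVar n) := {Sum.inr (Sum.inr ())}

theorem kill_tau_onZeta (f : Ser (Fin (n + 1))) :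
    kill (tauSet n) (subst onZeta f) = inChi (slice f) := by
  rw [kill, subst_subst onZeta_const (kill_const _), inChi, slice,
    subst_subst sliceVar_const inChi_const]
  have hX := subst_X (hs (kill_const (tauSet n))) (R := ℂ)
  congr 1
  funext j
  refine Fin.lastCases ?_ (fun j => ?_) j
  · rw [onZeta_last, hX, if_pos (by simp), sliceVar_last, subst_zero' inChi_const]
  · rw [onZeta_castSucc, hX, if_neg (by simp), sliceVar_castSucc, subst_X (hs inChi_const)]

theorem kill_tau_atTau (f : Ser (Fin (n + 1))) :
    kill (tauSet n) (atTau f) = C (constantCoeff f) := by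
  rw [kill, atTau, subst_subst tauVar_const (kill_const _), ← subst_zero_args]
  have hX := subst_X (hs (kill_const (tauSet n))) (R := ℂ)
  congr 1
  funext j
  refine Fin.lastCases ?_ (fun j => ?_) j
  · rw [tauVar_last, hX, if_pos (by simp)]
  · rw [tauVar_castSucc, subst_zero' (kill_const _)]

theorem slice_conj (f : Ser (Fin (n + 1))) : slice (conj f) = conj (slice f) := by
  unfold slice
  rw [conj_subst sliceVar_const]
  congr 1
  funext j
  refine Fin.lastCases ?_ (fun j => ?_) j
  · rw [sliceVar_last, conj_zero]
  · rw [sliceVar_castSucc, conj_X]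

/-- The restriction of `frame` to `τ = 0`, for a map with `H̄(χ, 0) = g` and `H̄_w(χ, 0) = v`. -/
def frameTau (Q : Ser (CRVar n)) (ρ : Series2 (Fin (n + 2)))
    (Λ : Matrix (Fin (n + 2)) (Fin (n + 1)) ℂ) (g v : Fin (n + 2) → Ser (Fin n)) :
    Fin (n + 1) → Fin (n + 2) → Ser (CRVar n) :=
  Fin.lastCases (jetNormal ρ (Sum.elim (fun _ => 0) fun i => inChi (g i))
      (fun i k => C (Λ i k)) (fun k => kill (tauSet n) (kill (zSet n) (pderiv ℂ (Sum.inl k) Q))))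
    fun j m => crRow (kill (tauSet n) (pderiv ℂ (Sum.inr (Sum.inr ())) Q))
      (kill (tauSet n) (pderiv ℂ (Sum.inr (Sum.inl j)) Q)) (inChi (pderiv ℂ j (g m))) (inChi (v m))

variable {Q : Ser (CRVar n)} {ρ : Series2 (Fin (n + 2))}
  {Λ : Matrix (Fin (n + 2)) (Fin (n + 1)) ℂ} {c : ℂ} {H H' : Fin (n + 2) → Ser (Fin (n + 1))}

theorem frameTau_last (g v : Fin (n + 2) → Ser (Fin n)) (m : Fin (n + 2)) :
    frameTau Q ρ Λ g v (Fin.last n) m = jetNormal ρ (Sum.elim (fun _ => 0) fun i => inChi (g i))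
      (fun i k => C (Λ i k))
      (fun k => kill (tauSet n) (kill (zSet n) (pderiv ℂ (Sum.inl k) Q))) m := by
  simp [frameTau]

theorem frameTau_castSucc (g v : Fin (n + 2) → Ser (Fin n)) (j : Fin n) (m : Fin (n + 2)) :
    frameTau Q ρ Λ g v j.castSucc m = kill (tauSet n) (pderiv ℂ (Sum.inr (Sum.inr ())) Q) *
      inChi (pderiv ℂ j (g m)) - kill (tauSet n) (pderiv ℂ (Sum.inr (Sum.inl j)) Q) *
        inChi (v m) := by
  simp [frameTau, crRow]

/-- `H_w(z, 0)`. -/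
def transverse (H : Fin (n + 2) → Ser (Fin (n + 1))) (i : Fin (n + 2)) : Ser (Fin n) :=
  slice (pderiv ℂ (Fin.last n) (H i))

theorem Realizes.constantCoeff_transverse (hH : Realizes Q ρ Λ H) (i : Fin (n + 2)) :
    constantCoeff (transverse H i) = Λ i (Fin.last n) := by
  rw [transverse, constantCoeff_slice, hH.deriv]

/-- At τ = 0 the jet of H along z = 0 reduces to its value at the origin. The frame then involves
only H̄(χ,0), its χ-derivatives and H̄_w(χ,0). -/
theorem kill_tau_frame (hH : Realizes Q ρ Λ H) (l : Fin (n + 1)) (m : Fin (n + 2)) :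
    kill (tauSet n) (frame Q ρ H l m) =
      frameTau Q ρ Λ (fun i => conj (slice (H i))) (fun i => conj (transverse H i)) l m := by
  have hk := kill_const (tauSet n)
  refine Fin.lastCases ?_ (fun j => ?_) l
  · simp only [frame, frameTau, Fin.lastCases_last]
    rw [kill, subst_jetNormal _ _ _ hk]
    · congr 1
      · funext i
        rcases i with i | i
        · exact (kill_tau_atTau (H i)).trans (by rw [hH.const, map_zero]; rfl)
        · exact (kill_tau_onZeta (conj (H i))).trans (by rw [slice_conj]; rfl)
      · funext i k
        exact (kill_tau_atTau _).trans (by rw [hH.deriv])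
    · refine elim_const (fun i => ?_) fun i => ?_
      · rw [atTau, constantCoeff_subst_zero tauVar_const, hH.const]
      · rw [constantCoeff_subst_zero onZeta_const, constantCoeff_conj, hH.const, map_zero]
  · rw [frameTau_castSucc]
    simp only [frame, Fin.lastCases_castSucc, crRow]
    rw [← killHom_apply, map_sub, map_mul, map_mul]
    simp only [killHom_apply, kill_tau_onZeta]
    rw [slice_conj, slice_conj, slice_pderiv, ← pderiv_conj, transverse]

/-- `Q_{χ_k}(z, 0, 0)`. -/
def chiGrad (Q : Ser (CRVar n)) (k : Fin n) : Ser (Fin n) := atZ (pderiv ℂ (Sum.inr (Sum.inl k)) Q)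

/-- The vectors `frame` at `(z, 0, 0)`. -/
def frameZ (Q : Ser (CRVar n)) (ρ : Series2 (Fin (n + 2)))
    (Λ : Matrix (Fin (n + 2)) (Fin (n + 1)) ℂ) : Fin (n + 1) → Fin (n + 2) → Ser (Fin n) :=
  Fin.lastCases (fun m => C (jetNormal0 ρ Λ m)) fun j m =>
    C (starRingEnd ℂ (Λ m j.castSucc)) - chiGrad Q j * C (starRingEnd ℂ (Λ m (Fin.last n)))

@[simp] theorem frameZ_last (m : Fin (n + 2)) :
    frameZ Q ρ Λ (Fin.last n) m = C (jetNormal0 ρ Λ m) := by simp [frameZ]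

@[simp] theorem frameZ_castSucc (j : Fin n) (m : Fin (n + 2)) : frameZ Q ρ Λ j.castSucc m =
    C (starRingEnd ℂ (Λ m j.castSucc)) - chiGrad Q j * C (starRingEnd ℂ (Λ m (Fin.last n))) := by
  simp [frameZ]

theorem zVar_eq_zero_of_mem_tauSet (i : CRVar n) (hi : i ∈ tauSet n) :
    (zVar i : Ser (Fin n)) = 0 := by
  rw [Finset.mem_singleton] at hi
  subst hi
  rfl

theorem jetNormal_zero_args {υ : Type} (m : Fin (n + 2)) :
    jetNormal ρ (fun _ => (0 : Ser υ)) (fun i k => C (Λ i k)) (fun _ => 0) m =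
      C (jetNormal0 ρ Λ m) := by
  rw [jetNormal, jetNormal0, map_cofactor]
  congr 1
  funext k j
  refine Fin.cases ?_ (fun k => ?_) k
  · rw [jetRow_zero, subst_zero_args]; rfl
  · rw [jetRow_succ]
    simp only [jetRow0, Fin.cases_succ, subst_zero_args, zero_mul, add_zero, map_sum, map_mul,
      mixedHess]

theorem atZ_frame (h : IsNormal Q) (hH : Realizes Q ρ Λ H) (l : Fin (n + 1)) (m : Fin (n + 2)) :
    atZ (frame Q ρ H l m) = frameZ Q ρ Λ l m := by
  refine Fin.lastCases ?_ (fun j => ?_) l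
  · simp only [frame, Fin.lastCases_last, frameZ_last]
    rw [atZ, subst_jetNormal _ _ _ zVar_const, ← jetNormal_zero_args]
    · congr 1
      · funext i
        rcases i with i | i
        · exact (atZ_atTau (H i)).trans (by rw [hH.const, map_zero])
        · exact (atZ_onZeta (conj (H i))).trans (by
            rw [constantCoeff_conj, hH.const, map_zero, map_zero])
      · funext i k
        exact (atZ_atTau _).trans (by rw [hH.deriv])
      · funext k
        have h1 : kill (chiSet n) (kill (zSet n) (pderiv ℂ (Sum.inl k) Q)) = 0 := by
          rw [kill_kill, Finset.union_comm, ← kill_kill, kill_pderiv (by simp [mem_chiSet]),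
            h.kill_chi, pderiv_X_of_ne (by simp), ← killHom_apply, map_zero]
        have h2 := atZ_kill zVar_eq_zero_of_mem_chiSet (kill (zSet n) (pderiv ℂ (Sum.inl k) Q))
        rw [h1, atZ_zero] at h2
        exact h2.symm
    · refine elim_const (fun i => ?_) fun i => ?_
      · rw [atTau, constantCoeff_subst_zero tauVar_const, hH.const]
      · rw [constantCoeff_subst_zero onZeta_const, constantCoeff_conj, hH.const, map_zero]
  · simp only [frame, Fin.lastCases_castSucc, crRow, frameZ_castSucc, atZ_sub, atZ_mul,
      h.atZ_pderiv_tau, atZ_onZeta, constantCoeff_conj, hH.deriv, one_mul]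
    rfl

/-- The value at `(H(z, 0), 0)`, where `s` stands for `H(z, 0)`. -/
def atSlice (s : Fin (n + 2) → Ser (Fin n)) (φ : Series2 (Fin (n + 2))) : Ser (Fin n) :=
  subst (Sum.elim s fun _ => 0) φ

theorem atZ_jet (h : IsNormal Q) (hH : Realizes Q ρ Λ H) (φ : Series2 (Fin (n + 2))) :
    atZ (subst (jetVar Q H) φ) = atSlice (fun i => slice (H i)) φ := by
  rw [atZ, subst_subst (jetVar_const h.const hH.const) zVar_const, atSlice]
  congr 1
  funext i
  rcases i with i | i
  · exact h.atZ_onZ (H i)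
  · exact (atZ_onZeta (conj (H i))).trans (by
      rw [constantCoeff_conj, hH.const, map_zero, map_zero]; rfl)

theorem atZ_pderiv_jet (h : IsNormal Q) (hH : Realizes Q ρ Λ H) (k : Fin n)
    (φ : Series2 (Fin (n + 2))) :
    atZ (pderiv ℂ (Sum.inr (Sum.inl k)) (subst (jetVar Q H) φ)) =
      ∑ i, atSlice (fun i => slice (H i)) (pderiv ℂ (Sum.inl i) φ) *
          (transverse H i * chiGrad Q k) +
        ∑ m, atSlice (fun i => slice (H i)) (pderiv ℂ (Sum.inr m) φ) *
          C (starRingEnd ℂ (Λ m k.castSucc)) := by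
  rw [pderiv_subst (jetVar_const h.const hH.const), Fintype.sum_sum_type, atZ_add, atZ_sum, atZ_sum]
  simp only [atZ_mul, atZ_jet h hH, jetVar_inl, jetVar_inr, pderiv_zeta_onZ h.const,
    pderiv_chi_onZeta, h.atZ_onZ, atZ_onZeta, pderiv_conj, constantCoeff_conj, hH.deriv]
  rfl

/-- At χ = τ = 0 the values of H̄ and of its Jacobian are constants known from `Λ`, and Q vanishes.
All arguments of the solved basic system are therefore explicit. -/
theorem slice_eq_of_realizes (hm : IsModel Q ρ Λ c) :
    ∃ s : Fin (n + 2) → Ser (Fin n), (∀ H, Realizes Q ρ Λ H → ∀ i, slice (H i) = s i) ∧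
      ∀ P, IsTame P → P _ Q → P _ ρ → ∀ i, P _ (s i) := by
  obtain ⟨Ψ, hΨ, hΨP, huniv⟩ := exists_base_solution hm
  have h := hm.normal
  set a : BaseVar n → Ser (Fin n) := Sum.elim (fun _ => 0)
    fun p => frameZ Q ρ Λ p.1 p.2 - C (frame0 ρ Λ p.1 p.2) with ha'
  have hq : ∀ k, constantCoeff (chiGrad Q k) = 0 := fun k => by
    rw [chiGrad, constantCoeff_atZ, h.pderiv_chi]
  have ha : ∀ i, constantCoeff (a i) = 0 := by
    rintro (i | ⟨l, m⟩)
    · exact map_zero _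
    · refine Fin.lastCases ?_ (fun j => ?_) l <;> simp [a, hq]
  refine ⟨fun i => subst a (Ψ i), fun H hH i => ?_, fun P hP hQ hρ i => ?_⟩
  · have hjc := jetVar_const h.const hH.const
    have := huniv (fun i => subst (onZ Q) (H i)) (fun i => subst onZeta (conj (H i)))
      (frame Q ρ H) (fun i => hjc (Sum.inl i)) (fun i => hjc (Sum.inr i)) (frame_const h hH)
      hH.eq (sum_frame h hH) i
    rw [← h.atZ_onZ, this, atZ, subst_subst _ zVar_const]
    · congr 1
      funext j
      rcases j with j | ⟨l, m⟩
      · exact (atZ_onZeta (conj (H j))).trans (by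
          rw [constantCoeff_conj, hH.const, map_zero, map_zero]; rfl)
      · have := atZ_sub (frame Q ρ H l m) (C (frame0 ρ Λ l m))
        rw [atZ_frame h hH, atZ_C] at this
        exact this
    · rintro (j | ⟨l, m⟩)
      · exact hjc (Sum.inr j)
      · simp [frame_const h hH]
  · refine hP.comp ha ?_ (hΨP P hP hρ i)
    rintro (j | ⟨l, m⟩)
    · exact hP.zero
    · refine hP.sub ?_ (hP.const _)
      refine Fin.lastCases ?_ (fun j => ?_) l
      · rw [frameZ_last]; exact hP.const _
      · rw [frameZ_castSucc]
        refine hP.sub (hP.const _) (hP.mul (hP.comp zVar_const ?_ (hP.pderiv _ hQ)) (hP.const _))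
        rintro (i | i)
        · exact hP.var _
        · exact hP.zero

end Slices

end

end FormalCR

namespace FormalCR

open MvPowerSeries

noncomputable section

/-! ### The χ-derivative of the basic system at χ = τ = 0. -/

section Family

variable {n : ℕ} {Q : Ser (CRVar n)} {ρ : Series2 (Fin (n + 2))}
  {Λ : Matrix (Fin (n + 2)) (Fin (n + 1)) ℂ} {c : ℂ} {H H' : Fin (n + 2) → Ser (Fin (n + 1))}

theorem slice_sum_const {s : Fin (n + 2) → Ser (Fin n)} (hs0 : ∀ i, constantCoeff (s i) = 0)
    (i : Fin (n + 2) ⊕ Fin (n + 2)) :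
    constantCoeff (Sum.elim s (fun _ => (0 : Ser (Fin n))) i) = 0 :=
  elim_const hs0 (fun _ => map_zero _) i

theorem constantCoeff_atSlice {s : Fin (n + 2) → Ser (Fin n)} (hs0 : ∀ i, constantCoeff (s i) = 0)
    (φ : Series2 (Fin (n + 2))) : constantCoeff (atSlice s φ) = constantCoeff φ :=
  constantCoeff_subst_zero (slice_sum_const hs0) φ

theorem Realizes.slice_const (hH : Realizes Q ρ Λ H) (i : Fin (n + 2)) :
    constantCoeff (slice (H i)) = 0 := by rw [constantCoeff_slice, hH.const]

theorem constantCoeff_chiGrad (h : IsNormal Q) (k : Fin n) : constantCoeff (chiGrad Q k) = 0 := by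
  rw [chiGrad, constantCoeff_atZ, h.pderiv_chi]

theorem pderiv_atZ (k : Fin n) (f : Ser (CRVar n)) :
    pderiv ℂ k (atZ f) = atZ (pderiv ℂ (Sum.inl k) f) := by
  classical
  unfold atZ
  rw [pderiv_subst zVar_const, Fintype.sum_sum_type]
  simp [pderiv_X, Pi.single_apply]

theorem constantCoeff_pderiv_chiGrad (k j : Fin n) :
    constantCoeff (pderiv ℂ k (chiGrad Q j)) = leviMatrix Q k j := by
  rw [chiGrad, pderiv_atZ, constantCoeff_atZ, leviMatrix]

theorem constantCoeff_frameZ (h : IsNormal Q) (l : Fin (n + 1)) (m : Fin (n + 2)) :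
    constantCoeff (frameZ Q ρ Λ l m) = frame0 ρ Λ l m := by
  refine Fin.lastCases ?_ (fun j => ?_) l
  · simp
  · simp [constantCoeff_chiGrad h]

theorem IsModel.chiGrad_ne_zero (h : IsModel Q ρ Λ c) (j : Fin n) : chiGrad Q j ≠ 0 := by
  intro h0
  have := h.nondeg' (u := Pi.single j 1) fun k => by
    simp [Pi.single_apply, ← constantCoeff_pderiv_chiGrad, h0]
  simpa using congrFun this j

/-- The linearization of the basic system at `(H(z, 0), 0)`. -/
def modelMatrix (Q : Ser (CRVar n)) (ρ : Series2 (Fin (n + 2)))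
    (Λ : Matrix (Fin (n + 2)) (Fin (n + 1)) ℂ) (s : Fin (n + 2) → Ser (Fin n)) :
    Matrix (Fin (n + 2)) (Fin (n + 2)) (Ser (Fin n)) :=
  Matrix.of (Fin.cases (fun i => atSlice s (pderiv ℂ (Sum.inl i) ρ)) fun l i =>
    ∑ m, atSlice s (pderiv ℂ (Sum.inl i) (pderiv ℂ (Sum.inr m) ρ)) * frameZ Q ρ Λ l m)

@[simp] theorem modelMatrix_zero (s : Fin (n + 2) → Ser (Fin n)) (i : Fin (n + 2)) :
    modelMatrix Q ρ Λ s 0 i = atSlice s (pderiv ℂ (Sum.inl i) ρ) := rfl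

@[simp] theorem modelMatrix_succ (s : Fin (n + 2) → Ser (Fin n)) (l : Fin (n + 1))
    (i : Fin (n + 2)) : modelMatrix Q ρ Λ s l.succ i =
      ∑ m, atSlice s (pderiv ℂ (Sum.inl i) (pderiv ℂ (Sum.inr m) ρ)) * frameZ Q ρ Λ l m := rfl

/-- The derivative `∑ ρ_{ζ′_m} ∂_τ H̄_m` at `(z, 0, 0)`. -/
def modelUnit (ρ : Series2 (Fin (n + 2))) (Λ : Matrix (Fin (n + 2)) (Fin (n + 1)) ℂ)
    (s : Fin (n + 2) → Ser (Fin n)) : Ser (Fin n) :=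
  ∑ m, atSlice s (pderiv ℂ (Sum.inr m) ρ) * C (starRingEnd ℂ (Λ m (Fin.last n)))

theorem IsModel.constantCoeff_modelUnit (h : IsModel Q ρ Λ c) {s : Fin (n + 2) → Ser (Fin n)}
    (hs0 : ∀ i, constantCoeff (s i) = 0) : constantCoeff (modelUnit ρ Λ s) = -c := by
  rw [← h.transversal, modelUnit, map_sum]
  refine Finset.sum_congr rfl fun m _ => ?_
  rw [map_mul, constantCoeff_atSlice hs0, constantCoeff_C, gradZeta]

/-- The constant term of this matrix is the Jacobian of the basic system. -/
theorem IsModel.modelMatrix_injective (h : IsModel Q ρ Λ c) {s : Fin (n + 2) → Ser (Fin n)}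
    (hs0 : ∀ i, constantCoeff (s i) = 0) (u : Fin (n + 2) → ℂ)
    (hu : ∀ l, ∑ i, constantCoeff (modelMatrix Q ρ Λ s l i) * u i = 0) : u = 0 := by
  refine h.jacobian_injective (u := u) ?_ fun l => ?_
  · rw [← hu 0]
    simp only [modelMatrix_zero, constantCoeff_atSlice hs0, gradZ]
  · rw [← hu l.succ]
    simp only [modelMatrix_succ, map_sum, map_mul, constantCoeff_atSlice hs0,
      constantCoeff_frameZ h.normal, mixedHess]

theorem Realizes.sum_atSlice_frameZ (hH : Realizes Q ρ Λ H) (h : IsNormal Q) (l : Fin (n + 1)) :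
    ∑ m, atSlice (fun i => slice (H i)) (pderiv ℂ (Sum.inr m) ρ) * frameZ Q ρ Λ l m = 0 := by
  have := congrArg atZ (sum_frame h hH l)
  rw [atZ_sum, atZ_zero] at this
  rw [← this]
  exact Finset.sum_congr rfl fun m _ => by rw [atZ_mul, atZ_jet h hH, atZ_frame h hH]

theorem Realizes.sum_atSlice_castSucc (hH : Realizes Q ρ Λ H) (h : IsNormal Q) (j : Fin n) :
    ∑ m, atSlice (fun i => slice (H i)) (pderiv ℂ (Sum.inr m) ρ) *
      C (starRingEnd ℂ (Λ m j.castSucc)) =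
        chiGrad Q j * modelUnit ρ Λ fun i => slice (H i) := by
  have := hH.sum_atSlice_frameZ h j.castSucc
  simp only [frameZ_castSucc, mul_sub, Finset.sum_sub_distrib, sub_eq_zero] at this
  rw [this, modelUnit, Finset.mul_sum]
  exact Finset.sum_congr rfl fun m _ => by ring

theorem atZ_pderiv_frame_castSucc (h : IsNormal Q) (hH : Realizes Q ρ Λ H) (k j : Fin n)
    (m : Fin (n + 2)) :
    atZ (pderiv ℂ (Sum.inr (Sum.inl k)) (frame Q ρ H j.castSucc m)) =
      (C (starRingEnd ℂ (constantCoeff (pderiv ℂ k (pderiv ℂ j (slice (H m)))))) +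
        C (starRingEnd ℂ (Λ m j.castSucc)) *
          atZ (pderiv ℂ (Sum.inr (Sum.inl k)) (pderiv ℂ (Sum.inr (Sum.inr ())) Q))) -
      (chiGrad Q j * C (starRingEnd ℂ (constantCoeff (pderiv ℂ k (transverse H m)))) +
        C (starRingEnd ℂ (Λ m (Fin.last n))) *
          atZ (pderiv ℂ (Sum.inr (Sum.inl k)) (pderiv ℂ (Sum.inr (Sum.inl j)) Q))) := by
  simp only [frame, Fin.lastCases_castSucc, crRow, map_sub, Derivation.leibniz, smul_eq_mul,
    atZ_sub, atZ_add, atZ_mul, pderiv_chi_onZeta, atZ_onZeta, pderiv_conj, constantCoeff_conj,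
    hH.deriv, h.atZ_pderiv_tau, one_mul, ← slice_pderiv, constantCoeff_slice, transverse]
  rfl

/-- Differentiation in χ commutes with setting τ = 0, after which the normal depends on H only
through its slice. -/
theorem atZ_pderiv_frame_last (hH : Realizes Q ρ Λ H) (k : Fin n) (m : Fin (n + 2)) :
    atZ (pderiv ℂ (Sum.inr (Sum.inl k)) (frame Q ρ H (Fin.last n) m)) =
      atZ (pderiv ℂ (Sum.inr (Sum.inl k)) (jetNormal ρ
        (Sum.elim (fun _ => 0) fun i => inChi (conj (slice (H i)))) (fun i k => C (Λ i k))
        (fun k => kill (tauSet n) (kill (zSet n) (pderiv ℂ (Sum.inl k) Q))) m)) := by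
  rw [← frameTau_last (Q := Q) _ (fun i => conj (transverse H i)), ← kill_tau_frame hH,
    ← kill_pderiv (by simp), atZ_kill zVar_eq_zero_of_mem_tauSet]

/-- Differentiating in χ_k moves U = H(z,Q) only through Q, so the unknown H_w(z,0) appears with the
factor Q_{χ_k}(z,0,0). -/
theorem Realizes.pderiv_eq (hH : Realizes Q ρ Λ H) (h : IsNormal Q) (k : Fin n) :
    (∑ i, modelMatrix Q ρ Λ (fun i => slice (H i)) 0 i * transverse H i) * chiGrad Q k +
      ∑ m, atSlice (fun i => slice (H i)) (pderiv ℂ (Sum.inr m) ρ) *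
        C (starRingEnd ℂ (Λ m k.castSucc)) = 0 := by
  have h1 := atZ_pderiv_jet h hH k ρ
  rw [hH.eq, map_zero, atZ_zero] at h1
  rw [h1, Finset.sum_mul]
  congr 1
  exact Finset.sum_congr rfl fun i _ => by rw [modelMatrix_zero, mul_assoc]

theorem Realizes.pderiv_frame (hH : Realizes Q ρ Λ H) (h : IsNormal Q) (k : Fin n)
    (l : Fin (n + 1)) :
    (∑ i, modelMatrix Q ρ Λ (fun i => slice (H i)) l.succ i * transverse H i) * chiGrad Q k +
      (∑ m, (∑ m', atSlice (fun i => slice (H i)) (pderiv ℂ (Sum.inr m') (pderiv ℂ (Sum.inr m) ρ)) *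
          C (starRingEnd ℂ (Λ m' k.castSucc))) * frameZ Q ρ Λ l m +
        ∑ m, atSlice (fun i => slice (H i)) (pderiv ℂ (Sum.inr m) ρ) *
          atZ (pderiv ℂ (Sum.inr (Sum.inl k)) (frame Q ρ H l m))) = 0 := by
  have h1 := congrArg (fun f => atZ (pderiv ℂ (Sum.inr (Sum.inl k)) f)) (sum_frame h hH l)
  simp only [map_zero, atZ_zero, map_sum, atZ_sum, Derivation.leibniz, smul_eq_mul, atZ_add,
    atZ_mul, atZ_jet h hH, atZ_frame h hH, atZ_pderiv_jet h hH, Finset.sum_add_distrib] at h1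
  rw [← h1]
  simp only [modelMatrix_succ, Finset.sum_mul, Finset.mul_sum, mul_add, Finset.sum_add_distrib]
  rw [Finset.sum_comm (γ := Fin (n + 2))]
  rw [add_comm (∑ _, _ * _) (_ + _), add_assoc]
  congr 1
  · exact Finset.sum_congr rfl fun _ _ => Finset.sum_congr rfl fun _ _ => by ring
  · congr 1
    exact Finset.sum_congr rfl fun _ _ => Finset.sum_congr rfl fun _ _ => by ring

end Family

end

end FormalCR

namespace FormalCR

open MvPowerSeries

noncomputable section

/-! ### The one-parameter indeterminacy of H_w(z,0). -/

theorem exists_mulVec_eq {σ : Type} [Finite σ] {m : ℕ} {M : Matrix (Fin m) (Fin m) (Ser σ)}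
    (hM : ∀ u : Fin m → ℂ, (∀ i, ∑ j, constantCoeff (M i j) * u j = 0) → u = 0)
    (b : Fin m → Ser σ) : ∃ x : Fin m → Ser σ, ∀ i, ∑ j, M i j * x j = b i := by
  have hdet : constantCoeff M.det ≠ 0 := by
    rw [det_constantCoeff]
    intro h
    obtain ⟨u, hu, hu'⟩ := Matrix.exists_mulVec_eq_zero_iff.mpr h
    exact hu (hM u fun i => congrFun hu' i)
  refine ⟨M⁻¹.mulVec b, fun i => ?_⟩
  have : M.mulVec (M⁻¹.mulVec b) = b := by
    rw [Matrix.mulVec_mulVec, Matrix.mul_nonsing_inv _ (isUnit_of_constantCoeff hdet),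
      Matrix.one_mulVec]
  exact congrFun this i

section Family

variable {n : ℕ} {Q : Ser (CRVar n)} {ρ : Series2 (Fin (n + 2))}
  {Λ : Matrix (Fin (n + 2)) (Fin (n + 1)) ℂ} {c : ℂ} {H H' : Fin (n + 2) → Ser (Fin (n + 1))}

/-- ρ_{ζ′}(0) annihilates the frame but not the conjugate transverse column of `Λ`, so together they
form a basis. -/
theorem IsModel.exists_coords (h : IsModel Q ρ Λ c) (v : Fin (n + 2) → ℂ) :
    ∃ (b : ℂ) (a : Fin n → ℂ) (g : ℂ), ∀ m, v m = b * starRingEnd ℂ (Λ m (Fin.last n)) +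
      (∑ i, a i * starRingEnd ℂ (Λ m i.castSucc) + g * jetNormal0 ρ Λ m) := by
  let B : Matrix (Fin (n + 2)) (Fin (n + 2)) ℂ :=
    Matrix.of (Fin.cases (fun m => starRingEnd ℂ (Λ m (Fin.last n))) (frame0 ρ Λ))
  have hB : B.det ≠ 0 := by
    intro hdet
    obtain ⟨x, hx, hx'⟩ := Matrix.exists_vecMul_eq_zero_iff.mpr hdet
    have h1 : ∀ m, x 0 * starRingEnd ℂ (Λ m (Fin.last n)) +
        ∑ l : Fin (n + 1), x l.succ * frame0 ρ Λ l m = 0 := by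
      intro m
      have := congrFun hx' m
      rw [Matrix.vecMul, dotProduct, Fin.sum_univ_succ] at this
      exact this
    have h2 : ∑ m, gradZeta ρ m * (x 0 * starRingEnd ℂ (Λ m (Fin.last n)) +
        ∑ l : Fin (n + 1), x l.succ * frame0 ρ Λ l m) = 0 := by simp [h1]
    simp only [mul_add, Finset.sum_add_distrib, Finset.mul_sum, mul_left_comm _ (x _)] at h2
    rw [Finset.sum_comm (γ := Fin (n + 2))] at h2
    simp only [← Finset.mul_sum, h.gradZeta_frame0, mul_zero, Finset.sum_const_zero, add_zero,
      h.transversal] at h2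
    have h0 : x 0 = 0 := (mul_eq_zero.mp h2).resolve_right (neg_ne_zero.mpr h.ne_zero)
    have h3 := h.frame0_independent (v := fun l => x l.succ) fun m => by simpa [h0] using h1 m
    exact hx (funext fun l => Fin.cases h0 (fun l => congrFun h3 l) l)
  have h1 : Matrix.vecMul (Matrix.vecMul v B⁻¹) B = v := by
    rw [Matrix.vecMul_vecMul, Matrix.nonsing_inv_mul _ (isUnit_iff_ne_zero.mpr hB),
      Matrix.vecMul_one]
  set x := Matrix.vecMul v B⁻¹
  refine ⟨x 0, fun i => x i.castSucc.succ, x (Fin.last n).succ, fun m => ?_⟩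
  rw [← h1, Matrix.vecMul, dotProduct, Fin.sum_univ_succ, Fin.sum_univ_castSucc]
  simp [B, -Fin.succ_last]

/-- The inverse of the map `z ↦ Q_χ(z, 0, 0)`. -/
theorem IsModel.exists_chiGrad_inverse (h : IsModel Q ρ Λ c) :
    ∃ S : Fin n → Ser (Fin n), (∀ i, constantCoeff (S i) = 0) ∧
      (∀ k, subst S (chiGrad Q k) = X k) ∧ (∀ k, subst (chiGrad Q) (S k) = X k) ∧
      ∀ P, IsTame P → P _ Q → ∀ i, P _ (S i) := by
  classical
  have hr : ∀ i : Fin n, constantCoeff (X (Sum.inr i) : Ser (Fin n ⊕ Fin n)) = 0 := by simp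
  let F : Fin n → Ser (Fin n ⊕ Fin n) := fun i =>
    subst (fun i => (X (Sum.inr i) : Ser (Fin n ⊕ Fin n))) (chiGrad Q i) - X (Sum.inl i)
  have hF : ∀ u : Fin n → ℂ,
      (∀ i, ∑ j, constantCoeff (pderiv ℂ (Sum.inr j) (F i)) * u j = 0) → u = 0 := by
    intro u hu
    refine h.nondeg u fun j => ?_
    rw [← hu j]
    refine Finset.sum_congr rfl fun k _ => ?_
    rw [map_sub, pderiv_subst hr, pderiv_X_of_ne (by simp), sub_zero, Finset.sum_eq_single k,
      pderiv_X_self, mul_one, constantCoeff_subst_zero hr, constantCoeff_pderiv_chiGrad]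
    · intro i _ hi
      rw [pderiv_X_of_ne (by simpa using hi), mul_zero]
    · simp
  obtain ⟨S, hS, hsol, hP⟩ := exists_implicit_system F (fun i => by
    simp [F, constantCoeff_subst_zero hr, constantCoeff_chiGrad h.normal]) hF
  have hq := constantCoeff_chiGrad h.normal
  have hFe : ∀ (a b : Fin n → Ser (Fin n)), (∀ i, constantCoeff (a i) = 0) →
      (∀ i, constantCoeff (b i) = 0) → ∀ i, subst (Sum.elim a b) (F i) =
        subst b (chiGrad Q i) - a i := by
    intro a b ha hb i
    have he := elim_const ha hb
    rw [subst_sub (hs he), subst_subst hr he, subst_X (hs he)]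
    congr 2
    funext j
    exact subst_X (hs he) _
  have h1 : ∀ k, subst S (chiGrad Q k) = X k := fun k => by
    have := hsol k
    rwa [hFe _ _ X_const hS, sub_eq_zero] at this
  refine ⟨S, hS, h1, fun k => ?_, fun P hT hQ => hP P hT fun i => ?_⟩
  -- For the composition in the other order, S(q(z)) and z are both solutions b of q(b) = q(z),
  -- hence equal.
  · have := implicit_unique hF (a := chiGrad Q) (b := fun k => subst (chiGrad Q) (S k))
      (b' := fun k => X k) hq (fun i => by rw [constantCoeff_subst_zero hq, hS]) X_const
      (fun i => ?_) fun i => ?_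
    · exact congrFun this k
    · rw [hFe _ _ hq (fun i => by rw [constantCoeff_subst_zero hq, hS]), ← subst_subst hS hq, h1,
        subst_X (hs hq), sub_self]
    · rw [hFe _ _ hq X_const, subst_X_eq, sub_self]
  · refine hT.sub (hT.comp hr (fun _ => hT.var _) ?_) (hT.var _)
    refine hT.comp zVar_const ?_ (hT.pderiv _ hQ)
    rintro (i | i)
    · exact hT.var _
    · exact hT.zero

/-- With linear forms L_j the relations L_j x_k = x_j L_k force L_j = λx_j with a common λ.
Comparing second derivatives proves it. -/
theorem eq_of_quadratic_relations {a : Fin n → Fin n → ℂ}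
    (ha : ∀ j k, (∑ i, C (a j i) * (X i : Ser (Fin n))) * X k =
      X j * ∑ i, C (a k i) * (X i : Ser (Fin n))) (j0 j i : Fin n) :
    a j i = if i = j then a j0 j0 else 0 := by
  classical
  have hd : ∀ (j k : Fin n), pderiv ℂ k (∑ i, C (a j i) * (X i : Ser (Fin n))) = C (a j k) := by
    intro j k
    rw [map_sum, Finset.sum_eq_single k]
    · simp [Derivation.leibniz]
    · intro b _ hb
      simp [Derivation.leibniz, pderiv_X_of_ne (R := ℂ) hb]
    · simp
  have h1 : ∀ {j k : Fin n}, j ≠ k → a j k = 0 := by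
    intro j k hjk
    have := congrArg (fun f => constantCoeff (pderiv ℂ k (pderiv ℂ k f))) (ha j k)
    simp [-map_sum, Derivation.leibniz, hd, pderiv_X_of_ne (R := ℂ) hjk] at this
    exact this
  have h2 : ∀ {j k : Fin n}, j ≠ k → a j j = a k k := by
    intro j k hjk
    have := congrArg (fun f => constantCoeff (pderiv ℂ j (pderiv ℂ k f))) (ha j k)
    simpa [-map_sum, Derivation.leibniz, hd, pderiv_X_of_ne (R := ℂ) hjk,
      pderiv_X_of_ne (R := ℂ) hjk.symm] using this
  split_ifs with hij
  · subst hij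
    by_cases hj : i = j0
    · rw [hj]
    · exact h2 hj
  · exact h1 (Ne.symm hij)

/-- The right-hand side of the equation of the direction in which `H_w(z, 0)` varies. -/
def modelRhs (Q : Ser (CRVar n)) (ρ : Series2 (Fin (n + 2)))
    (Λ : Matrix (Fin (n + 2)) (Fin (n + 1)) ℂ) (s : Fin (n + 2) → Ser (Fin n)) :
    Fin (n + 2) → Ser (Fin n) :=
  Fin.cases 0 (Fin.lastCases 0 fun j => modelUnit ρ Λ s * chiGrad Q j)

@[simp] theorem modelRhs_zero (s : Fin (n + 2) → Ser (Fin n)) : modelRhs Q ρ Λ s 0 = 0 := rfl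

@[simp] theorem modelRhs_last (s : Fin (n + 2) → Ser (Fin n)) :
    modelRhs Q ρ Λ s (Fin.last n).succ = 0 := by simp [modelRhs, -Fin.succ_last]

@[simp] theorem modelRhs_castSucc (s : Fin (n + 2) → Ser (Fin n)) (j : Fin n) :
    modelRhs Q ρ Λ s j.castSucc.succ = modelUnit ρ Λ s * chiGrad Q j := by
  simp [modelRhs]

/-- In the difference of the χ-derivatives for two maps the second-order jet survives only through
the constants ∂_kD(0), where D is the difference of the H_w(z,0). This gives E_j q_k = q_j σ_k with
q = Q_χ(z,0,0), a coordinate system. Such relations leave one free scalar. -/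
theorem Realizes.modelMatrix_transverse_sub (hH : Realizes Q ρ Λ H) (hH' : Realizes Q ρ Λ H')
    (hm : IsModel Q ρ Λ c) (hs' : ∀ i, slice (H' i) = slice (H i)) (j0 : Fin n) :
    ∃ κ : ℂ, ∀ l, ∑ i, modelMatrix Q ρ Λ (fun i => slice (H i)) l i *
      (transverse H' i - transverse H i) = C κ * modelRhs Q ρ Λ (fun i => slice (H i)) l := by
  classical
  have h := hm.normal
  set s : Fin (n + 2) → Ser (Fin n) := fun i => slice (H i) with hsdef
  have hss : (fun i => slice (H' i)) = s := funext hs'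
  have hs0 : ∀ i, constantCoeff (s i) = 0 := hH.slice_const
  set D : Fin (n + 2) → Ser (Fin n) := fun i => transverse H' i - transverse H i with hD
  have hD0 : ∀ i, constantCoeff (D i) = 0 := fun i => by
    rw [hD, map_sub, hH.constantCoeff_transverse, hH'.constantCoeff_transverse, sub_self]
  set θ := modelUnit ρ Λ s with hθdef
  have hθ0 : constantCoeff θ ≠ 0 := by
    rw [hm.constantCoeff_modelUnit hs0]; exact neg_ne_zero.mpr hm.ne_zero
  have hθ : θ ≠ 0 := fun h0 => hθ0 (by rw [h0, map_zero])
  set E : Fin (n + 2) → Ser (Fin n) := fun l => ∑ i, modelMatrix Q ρ Λ s l i * D i with hE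
  have hEsub : ∀ l, E l = ∑ i, modelMatrix Q ρ Λ s l i * transverse H' i -
      ∑ i, modelMatrix Q ρ Λ s l i * transverse H i := fun l => by
    rw [hE, ← Finset.sum_sub_distrib]
    exact Finset.sum_congr rfl fun i _ => mul_sub _ _ _
  have hE0 : ∀ l, constantCoeff (E l) = 0 := fun l => by
    simp [hE, map_sum, hD0]
  have hzero : E 0 = 0 := by
    have e1 := hH.pderiv_eq h j0
    have e2 := hH'.pderiv_eq h j0
    rw [hss] at e2
    have : E 0 * chiGrad Q j0 = 0 := by rw [hEsub]; linear_combination e2 - e1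
    exact (mul_eq_zero.mp this).resolve_right (hm.chiGrad_ne_zero j0)
  have hlast : E (Fin.last n).succ = 0 := by
    have e1 := hH.pderiv_frame h j0 (Fin.last n)
    have e2 := hH'.pderiv_frame h j0 (Fin.last n)
    simp only [atZ_pderiv_frame_last hH, atZ_pderiv_frame_last hH', hs'] at e1 e2
    have : E (Fin.last n).succ * chiGrad Q j0 = 0 := by rw [hEsub]; linear_combination e2 - e1
    exact (mul_eq_zero.mp this).resolve_right (hm.chiGrad_ne_zero j0)
  have hcast : ∀ j k : Fin n, E j.castSucc.succ * chiGrad Q k = chiGrad Q j *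
      ∑ m, atSlice s (pderiv ℂ (Sum.inr m) ρ) *
        C (starRingEnd ℂ (constantCoeff (pderiv ℂ k (D m)))) := by
    intro j k
    have e1 := hH.pderiv_frame h k j.castSucc
    have e2 := hH'.pderiv_frame h k j.castSucc
    rw [hss] at e2
    have e3 : ∑ m, atSlice s (pderiv ℂ (Sum.inr m) ρ) *
          atZ (pderiv ℂ (Sum.inr (Sum.inl k)) (frame Q ρ H' j.castSucc m)) -
        ∑ m, atSlice s (pderiv ℂ (Sum.inr m) ρ) *
          atZ (pderiv ℂ (Sum.inr (Sum.inl k)) (frame Q ρ H j.castSucc m)) =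
        - (chiGrad Q j * ∑ m, atSlice s (pderiv ℂ (Sum.inr m) ρ) *
          C (starRingEnd ℂ (constantCoeff (pderiv ℂ k (D m))))) := by
      rw [← Finset.sum_sub_distrib, Finset.mul_sum, ← Finset.sum_neg_distrib]
      refine Finset.sum_congr rfl fun m _ => ?_
      rw [atZ_pderiv_frame_castSucc h hH, atZ_pderiv_frame_castSucc h hH', hs', hD, map_sub,
        map_sub, map_sub, map_sub]
      ring
    rw [hEsub]
    linear_combination e2 - e1 - e3
  -- In this basis the pairing with ρ_{ζ′} along (H(z,0), 0) is explicit: the transverse column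
  -- gives θ, the tangent columns give θq_i, and the normal gives 0.
  choose b a g hcoord using fun k => hm.exists_coords
    (fun m => starRingEnd ℂ (constantCoeff (pderiv ℂ k (D m))))
  have hσ : ∀ k, ∑ m, atSlice s (pderiv ℂ (Sum.inr m) ρ) *
        C (starRingEnd ℂ (constantCoeff (pderiv ℂ k (D m)))) =
      θ * (C (b k) + ∑ i, C (a k i) * chiGrad Q i) := by
    intro k
    have h1 : ∀ m, C (starRingEnd ℂ (constantCoeff (pderiv ℂ k (D m)))) =
        C (b k) * C (starRingEnd ℂ (Λ m (Fin.last n))) +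
          (∑ i, C (a k i) * C (starRingEnd ℂ (Λ m i.castSucc)) +
            C (g k) * (C (jetNormal0 ρ Λ m) : Ser (Fin n))) := fun m => by
      rw [hcoord k m]; simp only [map_add, map_mul, map_sum]
    have h2 := hH.sum_atSlice_frameZ h (Fin.last n)
    simp only [frameZ_last] at h2
    simp only [h1, mul_add, Finset.sum_add_distrib, Finset.mul_sum, mul_left_comm _ (C (g k)),
      mul_left_comm _ (C (b k)), mul_left_comm _ (C (a k _))]
    rw [Finset.sum_comm (γ := Fin (n + 2))]
    simp only [← Finset.mul_sum, ← hsdef] at h2 ⊢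
    rw [h2, mul_zero, add_zero]
    have h3 : ∀ j : Fin n, ∑ m, atSlice s (pderiv ℂ (Sum.inr m) ρ) *
        C (starRingEnd ℂ (Λ m j.castSucc)) = chiGrad Q j * θ := hH.sum_atSlice_castSucc h
    simp only [h3]
    rw [show ∑ m, atSlice s (pderiv ℂ (Sum.inr m) ρ) * C (starRingEnd ℂ (Λ m (Fin.last n))) = θ
      from rfl]
    congr 1
    · ring
    · exact Finset.sum_congr rfl fun i _ => by ring
  have hdiag : ∀ j, E j.castSucc.succ = θ * (C (b j) + ∑ i, C (a j i) * chiGrad Q i) := by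
    intro j
    refine mul_right_cancel₀ (hm.chiGrad_ne_zero j) ?_
    rw [hcast, hσ, mul_comm]
  -- The difference of the transverse derivatives vanishes at z = 0, since both equal the last
  -- column of `Λ` there.
  have hb : ∀ j, b j = 0 := by
    intro j
    have := congrArg constantCoeff (hdiag j)
    rw [hE0, map_mul, map_add, map_sum] at this
    simp only [map_mul, constantCoeff_chiGrad h, mul_zero, Finset.sum_const_zero, add_zero,
      constantCoeff_C] at this
    exact (mul_eq_zero.mp this.symm).resolve_left hθ0
  simp only [hb, map_zero, zero_add] at hdiag hσ
  have hrel : ∀ j k, (∑ i, C (a j i) * chiGrad Q i) * chiGrad Q k =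
      chiGrad Q j * ∑ i, C (a k i) * chiGrad Q i := by
    intro j k
    refine mul_left_cancel₀ hθ ?_
    have := hcast j k
    rw [hσ, hdiag] at this
    linear_combination this
  -- In the coordinates q the relations become relations between linear forms.
  obtain ⟨S, hS, hSq, -, -⟩ := hm.exists_chiGrad_inverse
  have ha := eq_of_quadratic_relations (a := a) (fun j k => by
    have := congrArg (subst S) (hrel j k)
    simpa only [subst_mul (hs hS), subst_sum hS, subst_C', hSq] using this) j0
  refine ⟨a j0 j0, fun l => ?_⟩
  change E l = _
  refine Fin.cases ?_ (fun l => Fin.lastCases ?_ (fun j => ?_) l) l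
  · rw [hzero, modelRhs_zero, mul_zero]
  · rw [hlast, modelRhs_last, mul_zero]
  · rw [hdiag, modelRhs_castSucc]
    simp only [ha j, apply_ite C, map_zero, ite_mul, zero_mul, Finset.sum_ite_eq',
      Finset.mem_univ, if_true]
    ring

end Family

end

end FormalCR

namespace FormalCR

open MvPowerSeries

noncomputable section

/-! ### Regularity of H_w(z,0) and the direction in which it varies. -/

section Direction

variable {n : ℕ} {Q : Ser (CRVar n)} {ρ : Series2 (Fin (n + 2))}
  {Λ : Matrix (Fin (n + 2)) (Fin (n + 1)) ℂ} {c : ℂ} {H : Fin (n + 2) → Ser (Fin (n + 1))}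
  {P : ∀ σ : Type, Ser σ → Prop}

theorem IsTame.atZ (hP : IsTame P) {f : Ser (CRVar n)} (hf : P _ f) : P _ (atZ f) := by
  refine hP.comp zVar_const ?_ hf
  rintro (i | i)
  · exact hP.var _
  · exact hP.zero

theorem IsTame.atSlice (hP : IsTame P) {s : Fin (n + 2) → Ser (Fin n)}
    (hs0 : ∀ i, constantCoeff (s i) = 0) (hs' : ∀ i, P _ (s i)) {φ : Series2 (Fin (n + 2))}
    (hφ : P _ φ) : P _ (atSlice s φ) := by
  refine hP.comp (slice_sum_const hs0) ?_ hφ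
  rintro (i | i)
  · exact hs' i
  · exact hP.zero

theorem IsTame.chiGrad (hP : IsTame P) (hQ : P _ Q) (k : Fin n) : P _ (chiGrad Q k) :=
  hP.atZ (hP.pderiv _ hQ)

theorem IsTame.frameZ (hP : IsTame P) (hQ : P _ Q) (l : Fin (n + 1)) (m : Fin (n + 2)) :
    P _ (frameZ Q ρ Λ l m) := by
  refine Fin.lastCases ?_ (fun j => ?_) l
  · rw [frameZ_last]; exact hP.const _
  · rw [frameZ_castSucc]
    exact hP.sub (hP.const _) (hP.mul (hP.chiGrad hQ _) (hP.const _))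

theorem IsTame.modelMatrix (hP : IsTame P) (hQ : P _ Q) (hρ : P _ ρ) {s : Fin (n + 2) → Ser (Fin n)}
    (hs0 : ∀ i, constantCoeff (s i) = 0) (hs' : ∀ i, P _ (s i)) (l i : Fin (n + 2)) :
    P _ (modelMatrix Q ρ Λ s l i) := by
  refine Fin.cases ?_ (fun l => ?_) l
  · exact hP.atSlice hs0 hs' (hP.pderiv _ hρ)
  · rw [modelMatrix_succ]
    exact hP.sum fun m _ => hP.mul (hP.atSlice hs0 hs' (hP.pderiv _ (hP.pderiv _ hρ)))
      (hP.frameZ hQ _ _)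

theorem IsTame.modelRhs (hP : IsTame P) (hQ : P _ Q) (hρ : P _ ρ) {s : Fin (n + 2) → Ser (Fin n)}
    (hs0 : ∀ i, constantCoeff (s i) = 0) (hs' : ∀ i, P _ (s i)) (l : Fin (n + 2)) :
    P _ (modelRhs Q ρ Λ s l) := by
  refine Fin.cases ?_ (fun l => Fin.lastCases ?_ (fun j => ?_) l) l
  · exact hP.zero
  · rw [modelRhs_last]; exact hP.zero
  · rw [modelRhs_castSucc, modelUnit]
    exact hP.mul (hP.sum fun m _ => hP.mul (hP.atSlice hs0 hs' (hP.pderiv _ hρ)) (hP.const _))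
      (hP.chiGrad hQ _)

theorem IsTame.inChi (hP : IsTame P) {f : Ser (Fin n)} (hf : P _ f) : P _ (inChi f) :=
  hP.comp inChi_const (fun _ => hP.var _) hf

/-- `H_w(z, 0)` is tame over the data, for each single map. -/
theorem Realizes.isTame_transverse (hH : Realizes Q ρ Λ H) (hm : IsModel Q ρ Λ c) (j0 : Fin n)
    (hP : IsTame P) (hQ : P _ Q) (hρ : P _ ρ) (i : Fin (n + 2)) : P _ (transverse H i) := by
  have h := hm.normal
  have hsl : ∀ i, P _ (slice (H i)) := fun i => by
    obtain ⟨s, hs', hsP⟩ := slice_eq_of_realizes hm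
    rw [hs' H hH]
    exact hsP P hP hQ hρ i
  obtain ⟨Ψ, hΨ, hΨP, huniv⟩ := exists_base_solution hm
  have hjc := jetVar_const h.const hH.const
  set a : BaseVar n → Ser (CRVar n) := Sum.elim (fun i => subst onZeta (conj (H i)))
    fun p => frame Q ρ H p.1 p.2 - C (frame0 ρ Λ p.1 p.2) with ha'
  have ha : ∀ i, constantCoeff (a i) = 0 := by
    rintro (j | ⟨l, m⟩)
    · exact hjc (Sum.inr j)
    · simp [a, frame_const h hH]
  have haZ : ∀ v, P _ (FormalCR.atZ (a v)) := by
    rintro (j | ⟨l, m⟩)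
    · simp only [a, Sum.elim_inl, atZ_onZeta]; exact hP.const _
    · simp only [a, Sum.elim_inr, atZ_sub, atZ_frame h hH, atZ_C]
      exact hP.sub (hP.frameZ hQ _ _) (hP.const _)
  have haD : ∀ v, P _ (FormalCR.atZ (pderiv ℂ (Sum.inr (Sum.inl j0)) (a v))) := by
    rintro (j | ⟨l, m⟩)
    · simp only [a, Sum.elim_inl, pderiv_chi_onZeta, atZ_onZeta]; exact hP.const _
    · simp only [a, Sum.elim_inr, map_sub, pderiv_C, sub_zero]
      refine Fin.lastCases ?_ (fun j => ?_) l
      · rw [atZ_pderiv_frame_last hH]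
        refine hP.atZ (hP.pderiv _ (hP.jetNormal hρ (elim_const (fun _ => map_zero _) fun i => ?_) ?_
          (fun _ _ => hP.const _) (fun k => hP.kill _ (hP.kill _ (hP.pderiv _ hQ))) m))
        · exact (constantCoeff_subst_zero inChi_const _).trans (by
            rw [constantCoeff_conj, hH.slice_const, map_zero])
        · rintro (i | i)
          · exact hP.zero
          · exact hP.inChi (hP.conj (hsl i))
      · rw [atZ_pderiv_frame_castSucc h hH]
        exact hP.sub (hP.add (hP.const _) (hP.mul (hP.const _)
          (hP.atZ (hP.pderiv _ (hP.pderiv _ hQ))))) (hP.add (hP.mul (hP.chiGrad hQ _) (hP.const _))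
          (hP.mul (hP.const _) (hP.atZ (hP.pderiv _ (hP.pderiv _ hQ)))))
  have hU := huniv (fun i => subst (onZ Q) (H i)) (fun i => subst onZeta (conj (H i)))
      (frame Q ρ H) (fun i => hjc (Sum.inl i)) (fun i => hjc (Sum.inr i)) (frame_const h hH)
      hH.eq (sum_frame h hH) i
  -- The solved system, differentiated in χ_{j₀} at χ = τ = 0, expresses Q_{χ_{j₀}} H_w(z,0) by
  -- regular series and by finitely many constants of the 2-jet of this particular map.
  have h1 : P _ (chiGrad Q j0 * transverse H i) := by
    have h2 := congrArg (fun f => FormalCR.atZ (pderiv ℂ (Sum.inr (Sum.inl j0)) f)) hU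
    simp only [pderiv_zeta_onZ h.const, atZ_mul, h.atZ_onZ] at h2
    rw [pderiv_subst ha, atZ_sum] at h2
    change slice (pderiv ℂ (Fin.last n) (H i)) * chiGrad Q j0 = _ at h2
    rw [mul_comm, transverse, h2]
    refine hP.sum fun v _ => ?_
    rw [atZ_mul]
    refine hP.mul ?_ (haD v)
    rw [FormalCR.atZ, subst_subst ha zVar_const]
    exact hP.comp (fun v => by rw [constantCoeff_subst_zero zVar_const, ha]) haZ
      (hP.pderiv _ (hΨP P hP hρ i))
  obtain ⟨S, hS, hSq, hqS, hSP⟩ := hm.exists_chiGrad_inverse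
  -- The axioms allow cancelling an indeterminate, so the factor Q_{χ_{j₀}} is straightened to
  -- X_{j₀} and the coordinates are changed back afterwards.
  have h3 : P _ (subst S (transverse H i)) := by
    apply hP.of_X_mul j0
    rw [← hSq, ← subst_mul (hs hS)]
    exact hP.comp hS (hSP P hP hQ) h1
  have hq := constantCoeff_chiGrad h
  have h4 := hP.comp hq (hP.chiGrad hQ) h3
  rw [subst_subst hS hq] at h4
  simp only [hqS] at h4
  rwa [subst_X_eq] at h4

/-- The maps realizing given data differ, to first order along `w = 0`, by the multiples of one
vector. -/
theorem exists_direction (hm : IsModel Q ρ Λ c) (hH : Realizes Q ρ Λ H) (j0 : Fin n) :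
    ∃ D : Fin (n + 2) → Ser (Fin n), (∀ i, constantCoeff (D i) = 0) ∧
      (∃ i k, constantCoeff (pderiv ℂ k (D i)) ≠ 0) ∧
      (∀ P, IsTame P → P _ Q → P _ ρ → ∀ i, P _ (D i)) ∧
      ∀ H', Realizes Q ρ Λ H' → ∃ κ : ℂ, ∀ i, transverse H' i = transverse H i + C κ * D i := by
  have h := hm.normal
  obtain ⟨s, hs', hsP⟩ := slice_eq_of_realizes hm
  have hss : (fun i => slice (H i)) = s := funext (hs' H hH)
  have hs0 : ∀ i, constantCoeff (s i) = 0 := fun i => by rw [← hs' H hH, hH.slice_const]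
  have hinj := hm.modelMatrix_injective hs0
  obtain ⟨D, hD⟩ := exists_mulVec_eq hinj (modelRhs Q ρ Λ s)
  have hr0 : ∀ l, constantCoeff (modelRhs Q ρ Λ s l) = 0 := by
    intro l
    refine Fin.cases ?_ (fun l => Fin.lastCases ?_ (fun j => ?_) l) l
    · exact map_zero _
    · rw [modelRhs_last, map_zero]
    · rw [modelRhs_castSucc, map_mul, constantCoeff_chiGrad h, mul_zero]
  have hD0 : ∀ i, constantCoeff (D i) = 0 := by
    have := hinj (fun i => constantCoeff (D i)) fun l => by
      rw [← hr0 l, ← hD l, map_sum]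
      exact Finset.sum_congr rfl fun i _ => (map_mul _ _ _).symm
    exact fun i => congrFun this i
  refine ⟨D, hD0, ?_, fun P hP hQ hρ i => ?_, fun H' hH' => ?_⟩
  -- Differentiating the equations for D at the origin, a vanishing gradient of D would make the
  -- Levi matrix zero. This is impossible because the index `j0` witnesses n ≥ 1.
  · by_contra! hcon
    have hlevi : ∀ k j, leviMatrix Q k j = 0 := by
      intro k j
      have := congrArg (fun f => constantCoeff (pderiv ℂ k f)) (hD j.castSucc.succ)
      simp only [map_sum, Derivation.leibniz, smul_eq_mul, map_add, map_mul, hcon, hD0, mul_zero,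
        zero_mul, add_zero, Finset.sum_const_zero, modelRhs_castSucc,
        constantCoeff_pderiv_chiGrad, hm.constantCoeff_modelUnit hs0,
        constantCoeff_chiGrad h] at this
      exact (mul_eq_zero.mp this.symm).resolve_left (neg_ne_zero.mpr hm.ne_zero)
    have := hm.nondeg (fun _ => 1) fun j => by simp [hlevi]
    exact one_ne_zero (congrFun this j0)
  · have hsT := hsP P hP hQ hρ
    exact hP.solve (hP.modelMatrix hQ hρ hs0 hsT) (hP.modelRhs hQ hρ hs0 hsT) hinj hD i
  · obtain ⟨κ, hκ⟩ := hH.modelMatrix_transverse_sub hH' hm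
      (fun i => by rw [hs' H hH, hs' H' hH']) j0
    rw [hss] at hκ
    refine ⟨κ, fun i => ?_⟩
    have := mulVec_eq_zero_of_injective hinj
      (x := fun i => transverse H' i - transverse H i - C κ * D i) fun l => by
        simp only [mul_sub _ _ (C κ * _), Finset.sum_sub_distrib, hκ, mul_left_comm _ (C κ)]
        rw [← Finset.mul_sum, hD, sub_self]
    have hi := congrFun this i
    rw [Pi.zero_apply] at hi
    linear_combination hi

end Direction

end

end FormalCR

namespace FormalCR

open MvPowerSeries

noncomputable section

/-! ### Splitting off the part divisible by given indeterminates. -/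

section Telescope

variable {σ τ : Type} [Finite σ] [DecidableEq σ]

theorem subst_kill [Finite τ] {a : σ → Ser τ} (ha : ∀ i, constantCoeff (a i) = 0) {S : Finset σ}
    (hS : ∀ i ∈ S, a i = 0) (f : Ser σ) : subst a (kill S f) = subst a f := by
  rw [kill, subst_subst (kill_const S) ha]
  congr 1
  funext i
  split_ifs with h
  · rw [hS i h, subst_zero' ha]
  · rw [subst_X (hs ha)]

/-- The difference `f - f|_{x_S = 0}` is a combination of the `x_s`, `s ∈ S`. -/
theorem exists_sub_kill_eq (f : Ser σ) (S : Finset σ) :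
    ∃ A : σ → Ser σ, f - kill S f = ∑ s ∈ S, X s * A s ∧
      (∀ P, IsTame P → P _ f → ∀ s ∈ S, P _ (A s)) ∧
      ∀ T : Finset σ, (∀ s ∈ S, s ∉ T) → kill T f = 0 → ∀ s ∈ S, kill T (A s) = 0 := by
  induction S using Finset.induction_on with
  | empty => exact ⟨fun _ => 0, by simp [kill_empty], by simp, by simp⟩
  | insert s S hs' ih =>
    obtain ⟨A, hA, hAP, hAT⟩ := ih
    obtain ⟨g, hg⟩ := X_dvd_sub_kill s (kill S f)
    have hk : kill {s} (kill S f) = kill (insert s S) f := by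
      rw [kill_kill, Finset.insert_eq]
    have hne : ∀ t ∈ S, Function.update A s g t = A t := fun t ht =>
      Function.update_of_ne (ne_of_mem_of_not_mem ht hs') _ _
    refine ⟨Function.update A s g, ?_, fun P hP hf t ht => ?_, fun T hT hf t ht => ?_⟩
    · rw [Finset.sum_insert hs', Function.update_self, Finset.sum_congr rfl fun t ht => by
        rw [hne t ht], ← hA, ← hg, hk]
      ring
    · rcases Finset.mem_insert.mp ht with rfl | ht
      · rw [Function.update_self]
        apply hP.of_X_mul t
        rw [← hg]
        exact hP.sub (hP.kill _ hf) (hP.kill _ (hP.kill _ hf))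
      · rw [hne t ht]; exact hAP P hP hf t ht
    · rcases Finset.mem_insert.mp ht with rfl | ht
      · rw [Function.update_self]
        have h1 := congrArg (killHom T) hg
        have h0 : ∀ R : Finset σ, kill T (kill R f) = 0 := fun R => by
          rw [kill_kill, Finset.union_comm, ← kill_kill, hf, ← killHom_apply, map_zero]
        rw [map_sub, map_mul] at h1
        simp only [killHom_apply] at h1
        rw [kill_kill {t} S, h0, h0, sub_zero, kill_X, if_neg (hT t (Finset.mem_insert_self _ _))]
          at h1
        exact (mul_eq_zero.mp h1.symm).resolve_left (X_ne_zero' t)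
      · rw [hne t ht]
        exact hAT T (fun t ht => hT t (Finset.mem_insert_of_mem ht)) hf t ht

end Telescope

/-! ### A parametrization of the second Segre set. -/

section Segre

variable {n : ℕ} {Q : Ser (CRVar n)} {ρ : Series2 (Fin (n + 2))}
  {Λ : Matrix (Fin (n + 2)) (Fin (n + 1)) ℂ} {c : ℂ} {H : Fin (n + 2) → Ser (Fin (n + 1))}

/-- The point `(z, ξ(z, t), 0)`. -/
def segrePt (ξ : Fin n → Ser (Fin (n + 1))) : CRVar n → Ser (Fin (n + 1)) :=
  Sum.elim (fun j => X j.castSucc) (Sum.elim ξ fun _ => 0)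

theorem segrePt_const {ξ : Fin n → Ser (Fin (n + 1))} (hξ : ∀ i, constantCoeff (ξ i) = 0)
    (i : CRVar n) : constantCoeff (segrePt ξ i) = 0 :=
  elim_const (fun _ => by simp) (elim_const hξ fun _ => map_zero _) i

/-- The point `(z, χ, 0)`, where `χ` are unknowns. -/
def segreVar : CRVar n → Ser (Fin (n + 1) ⊕ Fin n) :=
  Sum.elim (fun j => X (Sum.inl j.castSucc)) (Sum.elim (fun k => X (Sum.inr k)) fun _ => 0)

theorem segreVar_const (i : CRVar n) :
    constantCoeff (segreVar i : Ser (Fin (n + 1) ⊕ Fin n)) = 0 :=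
  elim_const (fun _ => by simp) (elim_const (fun _ => by simp) fun _ => map_zero _) i

theorem subst_segreVar {υ : Type} [Finite υ] {a : Fin (n + 1) → Ser υ} {b : Fin n → Ser υ}
    (ha : ∀ i, constantCoeff (a i) = 0) (hb : ∀ i, constantCoeff (b i) = 0) (f : Ser (CRVar n)) :
    subst (Sum.elim a b) (subst segreVar f) =
      subst (Sum.elim (fun j => a j.castSucc) (Sum.elim b fun _ => 0)) f := by
  have he := elim_const ha hb
  have hX := subst_X (hs he) (R := ℂ)
  rw [subst_subst segreVar_const he]
  congr 1
  funext i
  rcases i with j | k | u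
  · exact hX _
  · exact hX _
  · exact subst_zero' he

/-- There is `ξ(z, t)` with `ξ(z, 0) = 0` and `Q(z, ξ(z, t), 0) = z_{j₀} t`. -/
theorem IsModel.exists_segre (hm : IsModel Q ρ Λ c) (j0 : Fin n) :
    ∃ ξ : Fin n → Ser (Fin (n + 1)), (∀ k, constantCoeff (ξ k) = 0) ∧
      (∀ k, kill {Fin.last n} (ξ k) = 0) ∧
      subst (segrePt ξ) Q = X j0.castSucc * X (Fin.last n) ∧
      ∀ P, IsTame P → P _ Q → ∀ k, P _ (ξ k) := by
  classical
  have h := hm.normal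
  set Q0 := kill (tauSet n) Q with hQ0
  have hz : kill (zSet n) Q0 = 0 := by
    rw [hQ0, kill_kill, Finset.union_comm, ← kill_kill, h.kill_z, kill_X, if_pos (by simp)]
  have hchi : kill (chiSet n) Q0 = 0 := by
    rw [hQ0, kill_kill, Finset.union_comm, ← kill_kill, h.kill_chi, kill_X, if_pos (by simp)]
  obtain ⟨B, hB, hBP, hBT⟩ := exists_sub_kill_eq Q0 (zSet n)
  have hsum : ∀ {M : Type} [AddCommMonoid M] (f : CRVar n → M),
      ∑ s ∈ zSet n, f s = ∑ j : Fin n, f (Sum.inl j) := by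
    intro M _ f
    refine Eq.trans ?_ (Finset.sum_map Finset.univ ⟨Sum.inl, Sum.inl_injective⟩ f)
    refine Finset.sum_congr (Finset.ext fun i => ?_) fun _ _ => rfl
    simp only [mem_zSet, Finset.mem_map, Finset.mem_univ, true_and, Function.Embedding.coeFn_mk,
      eq_comm]
  have hmem : ∀ j : Fin n, (Sum.inl j : CRVar n) ∈ zSet n := fun j => (mem_zSet _).mpr ⟨j, rfl⟩
  set A : Fin n → Ser (CRVar n) := fun j => B (Sum.inl j) with hA
  have hQA : Q0 = ∑ j, X (Sum.inl j) * A j := by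
    rw [hz, sub_zero, hsum] at hB
    exact hB
  have hAchi : ∀ j, kill (chiSet n) (A j) = 0 := fun j =>
    hBT _ (fun s hs1 hs2 => by
      obtain ⟨j, rfl⟩ := (mem_zSet _).mp hs1
      obtain ⟨k, hk⟩ := (mem_chiSet _).mp hs2
      simp at hk) hchi _ (hmem j)
  have hAP : ∀ P, IsTame P → P _ Q → ∀ j, P _ (A j) := fun P hP hQ j =>
    hBP P hP (hP.kill _ hQ) _ (hmem j)
  have hAlevi : ∀ k j, constantCoeff (pderiv ℂ (Sum.inr (Sum.inl j)) (A k)) = leviMatrix Q k j := by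
    intro k j
    have h1 : leviMatrix Q k j =
        constantCoeff (pderiv ℂ (Sum.inl k) (pderiv ℂ (Sum.inr (Sum.inl j)) Q0)) := by
      rw [hQ0, ← kill_pderiv (by simp), ← kill_pderiv (by simp), constantCoeff_kill]
      rfl
    rw [h1, hQA]
    simp only [map_sum, Derivation.leibniz, smul_eq_mul]
    rw [Finset.sum_eq_single k]
    · simp
    · intro b _ hb
      rw [pderiv_X_of_ne (by simp), mul_zero, add_zero, Derivation.leibniz,
        pderiv_X_of_ne (by simpa using hb)]
      simp
    · simp
  -- As Q(z,χ,0) = Σ z_j A_j(z,χ), it is enough to solve A_j(z,ξ) = t for j = j₀ and A_j(z,ξ) = 0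
  -- otherwise. The Jacobian in χ is the Levi matrix.
  let F : Fin n → Ser (Fin (n + 1) ⊕ Fin n) := fun j =>
    subst segreVar (A j) - if j = j0 then X (Sum.inl (Fin.last n)) else 0
  have hA0 : ∀ j, constantCoeff (A j) = 0 := fun j => by
    rw [← constantCoeff_kill (chiSet n), hAchi, map_zero]
  have hF : ∀ u : Fin n → ℂ,
      (∀ i, ∑ j, constantCoeff (pderiv ℂ (Sum.inr j) (F i)) * u j = 0) → u = 0 := by
    intro u hu
    refine hm.nondeg' fun k => ?_
    rw [← hu k]
    refine Finset.sum_congr rfl fun j _ => ?_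
    congr 1
    have h0 : pderiv ℂ (Sum.inr j) (if k = j0 then (X (Sum.inl (Fin.last n)) :
        Ser (Fin (n + 1) ⊕ Fin n)) else 0) = 0 := by
      split_ifs
      · exact pderiv_X_of_ne (by simp)
      · exact map_zero _
    rw [map_sub, h0, sub_zero, pderiv_subst segreVar_const, Finset.sum_eq_single (Sum.inr (Sum.inl j))]
    · rw [segreVar, Sum.elim_inr, Sum.elim_inl, pderiv_X_self, mul_one]
      exact ((constantCoeff_subst_zero segreVar_const _).trans (hAlevi k j)).symm
    · rintro (i | i | i) _ hi
      · rw [segreVar, Sum.elim_inl, pderiv_X_of_ne (by simp), mul_zero]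
      · rw [segreVar, Sum.elim_inr, Sum.elim_inl, pderiv_X_of_ne (by simpa using hi), mul_zero]
      · rw [segreVar, Sum.elim_inr, Sum.elim_inr, map_zero, mul_zero]
    · simp
  have hF0 : ∀ j, constantCoeff (F j) = 0 := by
    intro j
    rw [map_sub, constantCoeff_subst_zero segreVar_const, hA0]
    split_ifs <;> simp
  obtain ⟨ξ, hξ, hsol, hP⟩ := exists_implicit_system F hF0 hF
  have hFe : ∀ (a : Fin (n + 1) → Ser (Fin (n + 1))) (b : Fin n → Ser (Fin (n + 1))),
      (∀ i, constantCoeff (a i) = 0) → (∀ i, constantCoeff (b i) = 0) → ∀ j,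
      subst (Sum.elim a b) (F j) =
        subst (Sum.elim (fun j => a j.castSucc) (Sum.elim b fun _ => 0)) (A j) -
          if j = j0 then a (Fin.last n) else 0 := by
    intro a b ha hb j
    have he := elim_const ha hb
    rw [subst_sub (hs he), subst_segreVar ha hb]
    congr 1
    split_ifs
    · exact subst_X (hs he) _
    · exact subst_zero' he
  refine ⟨ξ, hξ, fun k => ?_, ?_, fun P hT hQ => hP P hT fun j => ?_⟩
  · have hk := kill_const ({Fin.last n} : Finset (Fin (n + 1)))
    have hb : ∀ k, constantCoeff (kill {Fin.last n} (ξ k)) = 0 := fun k => by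
      rw [constantCoeff_kill, hξ]
    -- At t = 0 the zero vector is also a solution, since A_j(z,0) = 0.
    have := implicit_unique hF hk hb (b' := fun _ => 0) (fun _ => map_zero _) (fun j => ?_)
      fun j => ?_
    · exact congrFun this k
    · have h1 := congrArg (kill {Fin.last n}) (hsol j)
      rw [← killHom_apply {Fin.last n} 0, map_zero, kill,
        subst_subst (elim_const X_const hξ) hk] at h1
      refine Eq.trans ?_ h1
      congr 1
      funext i
      rcases i with i | i
      · exact (subst_X (hs hk) (R := ℂ) i).symm
      · rfl
    · rw [hFe _ _ hk fun _ => map_zero _, if_pos (Finset.mem_singleton_self _), ite_self, sub_zero]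
      have hc : ∀ i : CRVar n, constantCoeff (Sum.elim
          (fun j : Fin n => if j.castSucc ∈ ({Fin.last n} : Finset (Fin (n + 1))) then 0 else
            (X j.castSucc : Ser (Fin (n + 1)))) (Sum.elim (fun _ => 0) fun _ => 0) i) = 0 :=
        elim_const (fun _ => hk _) (elim_const (fun _ => map_zero _) fun _ => map_zero _)
      rw [← subst_kill hc (S := chiSet n), hAchi, subst_zero' hc]
      intro i hi
      obtain ⟨k, rfl⟩ := (mem_chiSet i).mp hi
      rfl
  · have hc := segrePt_const hξ
    rw [← subst_kill hc (S := tauSet n) (by simp [segrePt]), ← hQ0, hQA, subst_sum hc]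
    simp only [subst_mul (hs hc)]
    rw [Finset.sum_eq_single j0]
    · have h1 := hsol j0
      rw [hFe _ _ X_const hξ, if_pos rfl, sub_eq_zero] at h1
      rw [subst_X (hs hc)]
      exact congrArg _ h1
    · intro j _ hj
      have h1 := hsol j
      rw [hFe _ _ X_const hξ, if_neg hj, sub_zero] at h1
      have h2 : subst (segrePt ξ) (A j) = 0 := h1
      rw [h2, mul_zero]
    · simp
  · refine hT.sub (hT.comp segreVar_const ?_ (hAP P hT hQ j)) ?_
    · rintro (i | i | i)
      · exact hT.var _
      · exact hT.var _
      · exact hT.zero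
    · split_ifs
      · exact hT.var _
      · exact hT.zero

end Segre

end

end FormalCR

namespace FormalCR

open MvPowerSeries

noncomputable section

/-! ### Adding an indeterminate for the slope. -/

section Interpolate

variable {σ : Type}

/-- A series, seen as a series in one more indeterminate. -/
def lift (f : Ser σ) : Ser (σ ⊕ Unit) := subst (fun i => X (Sum.inl i)) f

theorem lift_const (i : σ) : constantCoeff (X (Sum.inl i) : Ser (σ ⊕ Unit)) = 0 := by simp

variable [Finite σ]

theorem constantCoeff_lift (f : Ser σ) : constantCoeff (lift f) = constantCoeff f :=
  constantCoeff_subst_zero lift_const f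

theorem subst_atSlope_lift (b : σ) (r : ℂ) (f : Ser σ) : subst (atSlope b r) (lift f) = f := by
  have hc := atSlope_const b r
  rw [lift, subst_subst lift_const hc]
  simp only [subst_X (hs hc), atSlope_inl]
  exact subst_X_eq f

theorem IsTame.lift {P : ∀ σ : Type, Ser σ → Prop} (hP : IsTame P) {f : Ser σ} (hf : P _ f) :
    P _ (lift f) := hP.comp lift_const (fun _ => hP.var _) hf

end Interpolate

/-! ### The maps with given data as a one-parameter family. -/

section OneParameter

variable {n : ℕ} {Q : Ser (CRVar n)} {ρ : Series2 (Fin (n + 2))}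
  {Λ : Matrix (Fin (n + 2)) (Fin (n + 1)) ℂ} {c : ℂ} {H : Fin (n + 2) → Ser (Fin (n + 1))}

theorem subst_segrePt_inChi {ξ : Fin n → Ser (Fin (n + 1))} (hξ : ∀ i, constantCoeff (ξ i) = 0)
    (f : Ser (Fin n)) : subst (segrePt ξ) (inChi f) = subst ξ f := by
  have hc := segrePt_const hξ
  rw [inChi, subst_subst inChi_const hc]
  congr 1
  funext k
  exact subst_X (hs hc) _

theorem subst_segrePt_kill_tau {ξ : Fin n → Ser (Fin (n + 1))}
    (hξ : ∀ i, constantCoeff (ξ i) = 0) (f : Ser (CRVar n)) :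
    subst (segrePt ξ) (kill (tauSet n) f) = subst (segrePt ξ) f :=
  subst_kill (segrePt_const hξ) (by simp [segrePt]) f

theorem subst_segrePt_onZeta {ξ : Fin n → Ser (Fin (n + 1))} (hξ : ∀ i, constantCoeff (ξ i) = 0)
    (f : Ser (Fin (n + 1))) : subst (segrePt ξ) (subst onZeta f) = subst ξ (slice f) := by
  rw [← subst_segrePt_kill_tau hξ, kill_tau_onZeta, subst_segrePt_inChi hξ]

/-- The maps realizing given data are the specializations `y = r w` of one series `F(z, w, y)`. -/
theorem exists_family (hm : IsModel Q ρ Λ c) (hH : Realizes Q ρ Λ H) (j0 : Fin n)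
    {D : Fin (n + 2) → Ser (Fin n)} (hD0 : ∀ i, constantCoeff (D i) = 0)
    (hDP : ∀ P, IsTame P → P _ Q → P _ ρ → ∀ i, P _ (D i)) :
    ∃ F : Fin (n + 2) → Ser (Fin (n + 1) ⊕ Unit),
      (∀ P, IsTame P → P _ Q → P _ ρ → ∀ i, P _ (F i)) ∧
      ∀ H' κ, Realizes Q ρ Λ H' → (∀ i, transverse H' i = transverse H i + C κ * D i) →
        ∀ i, H' i = subst (atSlope (Fin.last n) (starRingEnd ℂ κ)) (F i) := by
  classical
  have h := hm.normal
  obtain ⟨s, hs', hsP⟩ := slice_eq_of_realizes hm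
  have hs0 : ∀ i, constantCoeff (s i) = 0 := fun i => by rw [← hs' H hH, hH.slice_const]
  obtain ⟨Ψ, hΨ, hΨP, huniv⟩ := exists_base_solution hm
  obtain ⟨ξ, hξ, hξk, hξQ, hξP⟩ := hm.exists_segre j0
  have hseg := segrePt_const hξ
  -- Since D(0) = 0 and ξ(z,0) = 0, the series D̄(ξ) is divisible by t. Hence κ̄D̄(ξ) = (κ̄t)E, and
  -- the parameter enters only through y = κ̄t.
  have hE : ∀ m, ∃ E : Ser (Fin (n + 1)), subst ξ (conj (D m)) = X (Fin.last n) * E := by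
    intro m
    apply X_dvd_of_kill
    have hk := kill_const ({Fin.last n} : Finset (Fin (n + 1)))
    rw [kill, subst_subst hξ hk]
    have : (fun i => subst (fun s => if s ∈ ({Fin.last n} : Finset (Fin (n + 1))) then 0 else
        (X s : Ser (Fin (n + 1)))) (ξ i)) = fun _ => (0 : Ser (Fin (n + 1))) := funext hξk
    rw [this, subst_zero_args, constantCoeff_conj, hD0, map_zero, map_zero]
  choose E hE using hE
  let V : Fin (n + 2) → Ser (Fin (n + 1) ⊕ Unit) := fun m =>
    lift (subst ξ (conj (transverse H m))) + X (Sum.inr ()) * lift (E m)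
  let W : Fin (n + 1) → Fin (n + 2) → Ser (Fin (n + 1) ⊕ Unit) := Fin.lastCases
    (fun m => lift (subst (segrePt ξ) (jetNormal ρ
      (Sum.elim (fun _ => 0) fun i => inChi (conj (s i))) (fun i k => C (Λ i k))
      (fun k => kill (tauSet n) (kill (zSet n) (pderiv ℂ (Sum.inl k) Q))) m)))
    fun j m => lift (subst (segrePt ξ) (pderiv ℂ (Sum.inr (Sum.inr ())) Q)) *
        lift (subst ξ (pderiv ℂ j (conj (s m)))) -
      lift (subst (segrePt ξ) (pderiv ℂ (Sum.inr (Sum.inl j)) Q)) * V m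
  have hje : ∀ i, constantCoeff ((Sum.elim (fun _ => 0) fun i => inChi (conj (s i)) :
      Fin (n + 2) ⊕ Fin (n + 2) → Ser (CRVar n)) i) = 0 :=
    elim_const (fun _ => map_zero _) fun i => (constantCoeff_subst_zero inChi_const _).trans
      (by rw [constantCoeff_conj, hs0, map_zero])
  let a : BaseVar n → Ser (Fin (n + 1) ⊕ Unit) := Sum.elim (fun m => lift (subst ξ (conj (s m))))
    fun p => W p.1 p.2 - C (frame0 ρ Λ p.1 p.2)
  have hWH : ∀ H' κ, Realizes Q ρ Λ H' → (∀ i, transverse H' i = transverse H i + C κ * D i) →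
      ∀ l m, subst (atSlope (Fin.last n) (starRingEnd ℂ κ)) (W l m) =
        subst (segrePt ξ) (frame Q ρ H' l m) := by
    intro H' κ hH' hκ l m
    have hc := atSlope_const (Fin.last n) (starRingEnd ℂ κ)
    have hss : ∀ i, slice (H' i) = s i := hs' H' hH'
    rw [← subst_segrePt_kill_tau hξ, kill_tau_frame hH']
    simp only [hss, hκ]
    refine Fin.lastCases ?_ (fun j => ?_) l
    · rw [frameTau_last]
      simp only [W, Fin.lastCases_last, subst_atSlope_lift]
    · rw [frameTau_castSucc, subst_sub (hs hseg), subst_mul (hs hseg), subst_mul (hs hseg),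
        subst_segrePt_kill_tau hξ, subst_segrePt_kill_tau hξ, subst_segrePt_inChi hξ,
        subst_segrePt_inChi hξ, conj_add, conj_mul, conj_C, subst_add (hs hξ), subst_mul (hs hξ),
        subst_C', hE]
      simp only [W, V, Fin.lastCases_castSucc]
      rw [subst_sub (hs hc), subst_mul (hs hc), subst_mul (hs hc), subst_add (hs hc),
        subst_mul (hs hc), subst_X (hs hc), atSlope_inr]
      simp only [subst_atSlope_lift]
      ring
  have hW0 : ∀ l m, constantCoeff (W l m) = frame0 ρ Λ l m := by
    intro l m
    -- Constant terms do not depend on the slope, so they may be read off at the reference map,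
    -- where κ = 0.
    have h1 := hWH H 0 hH (fun i => by simp) l m
    rw [← constantCoeff_subst_zero (atSlope_const (Fin.last n) (starRingEnd ℂ 0)), h1,
      constantCoeff_subst_zero hseg, frame_const h hH]
  have ha : ∀ v, constantCoeff (a v) = 0 := by
    rintro (m | ⟨l, m⟩)
    · exact (constantCoeff_lift _).trans (by
        rw [constantCoeff_subst_zero hξ, constantCoeff_conj, hs0, map_zero])
    · simp [a, hW0]
  -- The family consists of all maps that realize the data. The scalar is kept with the map, so that
  -- it need not be chosen.
  let ι : Type := {p : (Fin (n + 2) → Ser (Fin (n + 1))) × ℂ // Realizes Q ρ Λ p.1 ∧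
    ∀ i, transverse p.1 i = transverse H i + C p.2 * D i}
  have hblow : ∀ (i : Fin (n + 2)) (p : ι), blowup j0.castSucc (Fin.last n) (p.1.1 i) =
      subst (atSlope (Fin.last n) (starRingEnd ℂ p.1.2)) (subst a (Ψ i)) := by
    rintro i ⟨⟨H', κ⟩, hH', hκ⟩
    have hc := atSlope_const (Fin.last n) (starRingEnd ℂ κ)
    have hjc := jetVar_const h.const hH'.const
    have hU := huniv (fun i => subst (onZ Q) (H' i)) (fun i => subst onZeta (conj (H' i)))
      (frame Q ρ H') (fun i => hjc (Sum.inl i)) (fun i => hjc (Sum.inr i)) (frame_const h hH')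
      hH'.eq (sum_frame h hH') i
    -- At (z, ξ(z,t), 0) the coordinate w equals z_{j₀}t, so evaluating H there is the blow-up of H.
    have h1 : blowup j0.castSucc (Fin.last n) (H' i) =
        subst (segrePt ξ) (subst (onZ Q) (H' i)) := by
      rw [blowup, subst_subst (onZ_const h.const) hseg]
      congr 1
      funext k
      refine Fin.lastCases ?_ (fun k => ?_) k
      · rw [Function.update_self, onZ_last, hξQ]
      · rw [Function.update_of_ne (Fin.castSucc_lt_last k).ne, onZ_castSucc]
        exact (subst_X (hs hseg) (R := ℂ) (Sum.inl k)).symm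
    change blowup j0.castSucc (Fin.last n) (H' i) =
      subst (atSlope (Fin.last n) (starRingEnd ℂ κ)) (subst a (Ψ i))
    rw [h1, hU, subst_subst _ hseg, subst_subst ha hc]
    · congr 1
      funext v
      rcases v with m | ⟨l, m⟩
      · exact (subst_segrePt_onZeta hξ _).trans (by
          rw [slice_conj, hs' H' hH']; exact (subst_atSlope_lift _ _ _).symm)
      · simp only [a, Sum.elim_inr]
        rw [subst_sub (hs hseg), subst_sub (hs hc), hWH H' κ hH' hκ, subst_C', subst_C']
    · rintro (m | ⟨l, m⟩)
      · exact hjc (Sum.inr m)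
      · simp [frame_const h hH']
  choose F hF hFP using fun i => exists_interpolation (Fin.castSucc_lt_last j0).ne (subst a (Ψ i))
    (fun p : ι => p.1.1 i) (fun p => starRingEnd ℂ p.1.2) (hblow i)
  refine ⟨F, fun P hP hQ hρ i => hFP i P hP ?_, fun H' κ hH' hκ i => hF i ⟨⟨H', κ⟩, hH', hκ⟩⟩
  have hsT := hsP P hP hQ hρ
  have hξT := hξP P hP hQ
  have hsegT : ∀ v, P _ (segrePt ξ v) := by
    rintro (j | k | u)
    · exact hP.var _
    · exact hξT k
    · exact hP.zero
  have hET : ∀ m, P _ (E m) := fun m => by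
    apply hP.of_X_mul (Fin.last n)
    rw [← hE]
    exact hP.comp hξ hξT (hP.conj (hDP P hP hQ hρ m))
  have hVT : ∀ m, P _ (V m) := fun m => hP.add
    (hP.lift (hP.comp hξ hξT (hP.conj (hH.isTame_transverse hm j0 hP hQ hρ m))))
    (hP.mul (hP.var _) (hP.lift (hET m)))
  refine hP.comp ha ?_ (hΨP P hP hρ i)
  rintro (m | ⟨l, m⟩)
  · exact hP.lift (hP.comp hξ hξT (hP.conj (hsT m)))
  · refine hP.sub ?_ (hP.const _)
    refine Fin.lastCases ?_ (fun j => ?_) l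
    · simp only [W, Fin.lastCases_last]
      refine hP.lift (hP.comp hseg hsegT (hP.jetNormal hρ hje ?_ (fun _ _ => hP.const _)
        (fun k => hP.kill _ (hP.kill _ (hP.pderiv _ hQ))) m))
      rintro (i | i)
      · exact hP.zero
      · exact hP.inChi (hP.conj (hsT i))
    · simp only [W, Fin.lastCases_castSucc]
      exact hP.sub (hP.mul (hP.lift (hP.comp hseg hsegT (hP.pderiv _ hQ)))
        (hP.lift (hP.comp hξ hξT (hP.pderiv _ (hP.conj (hsT m))))))
        (hP.mul (hP.lift (hP.comp hseg hsegT (hP.pderiv _ hQ))) (hVT m))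

end OneParameter

end

end FormalCR

namespace FormalCR

open MvPowerSeries

noncomputable section

/-! ### The basic identity, given H(0,τ). -/

section Arguments

variable {n : ℕ} {Q : Ser (CRVar n)} {ρ : Series2 (Fin (n + 2))}
  {Λ : Matrix (Fin (n + 2)) (Fin (n + 1)) ℂ} {c : ℂ} {H : Fin (n + 2) → Ser (Fin (n + 1))}

/-- The indeterminate of `ζ_j`. -/
abbrev zetaArg (j : Fin (n + 1)) : PsiVar n := Sum.inr (Sum.inl j)

/-- The indeterminate of `H̄_m(ζ)`. -/
abbrev barArg (m : Fin (n + 2)) : PsiVar n := Sum.inr (Sum.inr (Sum.inl m))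

/-- The indeterminate of `∂_k H̄_m(ζ) - ∂_k H̄_m(0)`. -/
abbrev barJetArg (m : Fin (n + 2)) (k : Fin (n + 1)) : PsiVar n :=
  Sum.inr (Sum.inr (Sum.inr (Sum.inr (Sum.inl (m, k)))))

/-- The indeterminate of `∂_k H_m(0, τ) - ∂_k H_m(0)`. -/
abbrev jetArg (m : Fin (n + 2)) (k : Fin (n + 1)) : PsiVar n :=
  Sum.inr (Sum.inr (Sum.inr (Sum.inr (Sum.inr (m, k)))))

/-- The restriction of `psiArgs` to the hypersurface. -/
def basicPt (Q : Ser (CRVar n)) (Λ : Matrix (Fin (n + 2)) (Fin (n + 1)) ℂ)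
    (H : Fin (n + 2) → Ser (Fin (n + 1))) : PsiVar n → Ser (CRVar n) :=
  Sum.elim (onZ Q) <| Sum.elim onZeta <| Sum.elim (fun i => subst onZeta (conj (H i))) <|
    Sum.elim (fun i => subst onZeta (H i)) <| Sum.elim
      (fun p => subst onZeta (conj (pderiv ℂ p.2 (H p.1))) - C (starRingEnd ℂ (Λ p.1 p.2)))
      fun p => atTau (pderiv ℂ p.2 (H p.1)) - C (Λ p.1 p.2)

theorem Realizes.basicPt_const (hH : Realizes Q ρ Λ H) (hQ : constantCoeff Q = 0) (v : PsiVar n) :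
    constantCoeff (basicPt Q Λ H v) = 0 := by
  rcases v with i | i | i | i | i | i
  · exact onZ_const hQ i
  · exact onZeta_const i
  · exact (constantCoeff_subst_zero onZeta_const _).trans (by
      rw [constantCoeff_conj, hH.const, map_zero])
  · exact (constantCoeff_subst_zero onZeta_const _).trans (hH.const i)
  · simp only [basicPt, Sum.elim_inr, Sum.elim_inl, map_sub, constantCoeff_C,
      constantCoeff_subst_zero onZeta_const, constantCoeff_conj, hH.deriv, sub_self]
  · simp only [basicPt, Sum.elim_inr, map_sub, constantCoeff_C, atTau,
      constantCoeff_subst_zero tauVar_const, hH.deriv, sub_self]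

theorem restrict_inZ (hQ : constantCoeff Q = 0) (f : Ser (Fin (n + 1))) :
    restrict Q (inZ f) = subst (onZ Q) f := by
  have hr := restrict_const hQ
  rw [restrict, inZ, subst_subst (by simp) hr]
  congr 1
  funext j
  exact subst_X (hs hr) _

theorem restrict_inZeta (hQ : constantCoeff Q = 0) (f : Ser (Fin (n + 1))) :
    restrict Q (inZeta f) = subst onZeta f := by
  have hr := restrict_const hQ
  rw [restrict, inZeta, subst_subst (by simp) hr]
  congr 1
  funext j
  exact subst_X (hs hr) _

theorem restrict_atZeroTau (hQ : constantCoeff Q = 0) (f : Ser (Fin (n + 1))) :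
    restrict Q (atZeroTau f) = atTau f := by
  have hr := restrict_const hQ
  rw [restrict, atZeroTau, subst_subst (fun j => Fin.lastCases (by simp) (fun j => by simp) j) hr,
    atTau]
  congr 1
  funext j
  refine Fin.lastCases ?_ (fun j => ?_) j
  · rw [Fin.lastCases_last, tauVar_last, subst_X (hs hr), Sum.elim_inr, onZeta_last]
  · rw [Fin.lastCases_castSucc, tauVar_castSucc, subst_zero' hr]

theorem restrict_psiArgs (hQ : constantCoeff Q = 0) (H : FormalMap (Fin (n + 1)) (Fin (n + 2)))
    (v : PsiVar n) : restrict Q (psiArgs H v) = basicPt Q H.derivAtZero H.toFun v := by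
  have hr := restrict_const hQ
  have hC : ∀ (f : Series2 (Fin (n + 1))) (c : ℂ), restrict Q (f - C c) = restrict Q f - C c :=
    fun f c => by rw [restrict, subst_sub (hs hr), subst_C']; rfl
  rcases v with i | i | i | i | i | i
  · exact subst_X (hs hr) _
  · exact subst_X (hs hr) _
  · exact restrict_inZeta hQ _
  · exact restrict_inZeta hQ _
  · exact (hC _ _).trans (by rw [restrict_inZeta hQ, pderiv_conj]; rfl)
  · exact (hC _ _).trans (by rw [restrict_atZeroTau hQ]; rfl)

theorem psiArgs_const (H : FormalMap (Fin (n + 1)) (Fin (n + 2))) (v : PsiVar n) :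
    constantCoeff (psiArgs H v) = 0 := by
  have hz : ∀ f : Ser (Fin (n + 1)), constantCoeff (inZeta f) = constantCoeff f := fun f =>
    constantCoeff_subst_zero (by simp) f
  rcases v with i | i | i | i | i | i
  · exact constantCoeff_X _
  · exact constantCoeff_X _
  · exact (hz _).trans (by rw [constantCoeff_conj, H.map_zero, map_zero])
  · exact (hz _).trans (H.map_zero i)
  · simp only [psiArgs, Sum.elim_inr, Sum.elim_inl, map_sub, constantCoeff_C, hz, pderiv_conj,
      constantCoeff_conj, FormalMap.derivAtZero, sub_self]
  · simp only [psiArgs, Sum.elim_inr, map_sub, constantCoeff_C, atZeroTau]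
    rw [constantCoeff_subst_zero (fun j => Fin.lastCases (by simp) (fun j => by simp) j),
      FormalMap.derivAtZero, sub_self]

theorem restrict_sub_psiArgs (hQ : constantCoeff Q = 0)
    (H : FormalMap (Fin (n + 1)) (Fin (n + 2))) (i : Fin (n + 2)) (Ψ : Ser (PsiVar n)) :
    restrict Q (inZ (H.toFun i) - subst (psiArgs H) Ψ) =
      subst (onZ Q) (H.toFun i) - subst (basicPt Q H.derivAtZero H.toFun) Ψ := by
  have hr := restrict_const hQ
  rw [← restrict_inZ hQ, restrict, subst_sub (hs hr), subst_subst (psiArgs_const H) hr]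
  congr 2
  exact funext fun v => restrict_psiArgs hQ H v

/-- The indeterminates `(z, χ, τ)`. -/
def normalArg : CRVar n → Ser (PsiVar n) :=
  Sum.elim (fun j => X (Sum.inl j.castSucc))
    (Sum.elim (fun j => X (zetaArg j.castSucc)) fun _ => X (zetaArg (Fin.last n)))

theorem normalArg_const (v : CRVar n) : constantCoeff (normalArg v : Ser (PsiVar n)) = 0 :=
  elim_const (fun _ => by simp) (elim_const (fun _ => by simp) fun _ => by simp) v

theorem subst_basicPt_normalArg (hc : ∀ v, constantCoeff (basicPt Q Λ H v) = 0)
    (f : Ser (CRVar n)) : subst (basicPt Q Λ H) (subst normalArg f) = f := by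
  rw [subst_subst normalArg_const hc]
  refine Eq.trans ?_ (subst_X_eq f)
  have hX := subst_X (hs hc) (R := ℂ)
  congr 1
  funext v
  rcases v with j | j | j
  · exact (hX _).trans (onZ_castSucc Q j)
  · exact (hX _).trans (onZeta_castSucc j)
  · exact (hX _).trans onZeta_last

/-- Given the series `S` for `H(0, τ)`, the basic identity follows. -/
theorem exists_identity_of_trace (hm : IsModel Q ρ Λ c) {P : ∀ σ : Type, Ser σ → Prop}
    (hP : IsTame P) (hQ : P _ Q) (hρ : P _ ρ) {S : Fin (n + 2) → Ser (PsiVar n)}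
    (hS0 : ∀ i, constantCoeff (S i) = 0) (hSP : ∀ i, P _ (S i))
    (hS : ∀ H, Realizes Q ρ Λ H → ∀ i, subst (basicPt Q Λ H) (S i) = atTau (H i)) :
    ∃ Ψ : Fin (n + 2) → Ser (PsiVar n), (∀ i, P _ (Ψ i)) ∧ ∀ H, Realizes Q ρ Λ H → ∀ i,
      subst (onZ Q) (H i) = subst (basicPt Q Λ H) (Ψ i) := by
  have h := hm.normal
  obtain ⟨Ψ, hΨ, hΨP, huniv⟩ := exists_base_solution hm
  set e : Fin (n + 2) ⊕ Fin (n + 2) → Ser (PsiVar n) := Sum.elim S fun m => X (barArg m) with he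
  have he0 : ∀ i, constantCoeff (e i) = 0 := elim_const hS0 fun _ => by simp
  let q (k : Fin n) : Ser (PsiVar n) :=
    subst normalArg (kill (zSet n) (pderiv ℂ (Sum.inl k) Q))
  -- This is the frame with each ingredient replaced by the matching indeterminate of Ψ. Only H(0,τ)
  -- has none, and `S` takes its place.
  let Y : Fin (n + 1) → Fin (n + 2) → Ser (PsiVar n) := Fin.lastCases
    (jetNormal ρ e (fun i k => C (Λ i k) + X (jetArg i k)) q)
    fun j m => crRow (subst normalArg (pderiv ℂ (Sum.inr (Sum.inr ())) Q))
      (subst normalArg (pderiv ℂ (Sum.inr (Sum.inl j)) Q))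
      (C (starRingEnd ℂ (Λ m j.castSucc)) + X (barJetArg m j.castSucc))
      (C (starRingEnd ℂ (Λ m (Fin.last n))) + X (barJetArg m (Fin.last n)))
  have hY0 : ∀ l m, constantCoeff (Y l m) = frame0 ρ Λ l m := by
    intro l m
    refine Fin.lastCases ?_ (fun j => ?_) l
    · simp only [Y, Fin.lastCases_last, frame0_last]
      refine constantCoeff_jetNormal he0 (fun i k => ?_) (fun k => ?_) m
      · simp
      · rw [constantCoeff_subst_zero normalArg_const, constantCoeff_kill, h.pderiv_z]
    · simp only [Y, Fin.lastCases_castSucc, frame0_castSucc, crRow, map_sub, map_mul, map_add,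
        constantCoeff_subst_zero normalArg_const, h.pderiv_tau, h.pderiv_chi, constantCoeff_C,
        constantCoeff_X]
      ring
  let b : BaseVar n → Ser (PsiVar n) := Sum.elim (fun m => X (barArg m))
    fun p => Y p.1 p.2 - C (frame0 ρ Λ p.1 p.2)
  have hb : ∀ v, constantCoeff (b v) = 0 := by
    rintro (m | ⟨l, m⟩)
    · simp [b]
    · simp [b, hY0]
  refine ⟨fun i => subst b (Ψ i), fun i => hP.comp hb ?_ (hΨP P hP hρ i), fun H hH i => ?_⟩
  · have hnT : ∀ {f : Ser (CRVar n)}, P _ f → P _ (subst normalArg f : Ser (PsiVar n)) := by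
      intro f hf
      refine hP.comp normalArg_const ?_ hf
      rintro (j | j | j) <;> exact hP.var _
    rintro (m | ⟨l, m⟩)
    · exact hP.var _
    · refine hP.sub ?_ (hP.const _)
      refine Fin.lastCases ?_ (fun j => ?_) l
      · simp only [Y, Fin.lastCases_last]
        refine hP.jetNormal hρ he0 ?_ (fun i k => hP.add (hP.const _) (hP.var _))
          (fun k => hnT (hP.kill _ (hP.pderiv _ hQ))) m
        rintro (i | i)
        · exact hSP i
        · exact hP.var _
      · simp only [Y, Fin.lastCases_castSucc, crRow]
        exact hP.sub (hP.mul (hnT (hP.pderiv _ hQ)) (hP.add (hP.const _) (hP.var _)))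
          (hP.mul (hnT (hP.pderiv _ hQ)) (hP.add (hP.const _) (hP.var _)))
  · have hc := hH.basicPt_const h.const
    have hX := subst_X (hs hc) (R := ℂ)
    have hjc := jetVar_const h.const hH.const
    have hU := huniv (fun i => subst (onZ Q) (H i)) (fun i => subst onZeta (conj (H i)))
      (frame Q ρ H) (fun i => hjc (Sum.inl i)) (fun i => hjc (Sum.inr i)) (frame_const h hH)
      hH.eq (sum_frame h hH) i
    rw [hU, subst_subst hb hc]
    congr 1
    funext v
    have hjet : ∀ i k, subst (basicPt Q Λ H) (C (Λ i k) + X (jetArg i k)) =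
        atTau (pderiv ℂ k (H i)) := fun i k => by
      rw [subst_add (hs hc), subst_C', hX]
      simp [basicPt]
    have hbar : ∀ i k, subst (basicPt Q Λ H) (C (starRingEnd ℂ (Λ i k)) + X (barJetArg i k)) =
        subst onZeta (conj (pderiv ℂ k (H i))) := fun i k => by
      rw [subst_add (hs hc), subst_C', hX]
      simp [basicPt]
    rcases v with m | ⟨l, m⟩
    · exact (hX (barArg m)).symm
    · simp only [b, Sum.elim_inr]
      rw [subst_sub (hs hc), subst_C']
      congr 1
      refine Fin.lastCases ?_ (fun j => ?_) l
      · simp only [Y, frame, Fin.lastCases_last]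
        rw [subst_jetNormal he0 _ _ hc]
        congr 1
        · funext v
          rcases v with v | v
          · exact (hS H hH v).symm
          · exact (hX (barArg v)).symm
        · funext i k
          exact (hjet i k).symm
        · funext k
          exact (subst_basicPt_normalArg hc _).symm
      · simp only [Y, frame, Fin.lastCases_castSucc, crRow]
        rw [subst_sub (hs hc), subst_mul (hs hc), subst_mul (hs hc), hbar, hbar,
          subst_basicPt_normalArg hc, subst_basicPt_normalArg hc]

end Arguments

end

end FormalCR

namespace FormalCR

open MvPowerSeries

noncomputable section

/-! ### Recovering H(0,τ), and the conclusion. -/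

theorem pderiv_comm {σ : Type} (i j : σ) (f : Ser σ) :
    pderiv ℂ i (pderiv ℂ j f) = pderiv ℂ j (pderiv ℂ i f) := by
  classical
  ext d
  simp only [coeff_pderiv, Finsupp.add_apply, Finsupp.single_apply, add_right_comm d]
  by_cases h : i = j
  · rw [h]
  · simp only [h, Ne.symm h, if_false]
    push_cast
    ring

section Trace

variable {n : ℕ} {Q : Ser (CRVar n)} {ρ : Series2 (Fin (n + 2))}
  {Λ : Matrix (Fin (n + 2)) (Fin (n + 1)) ℂ} {c : ℂ} {H : Fin (n + 2) → Ser (Fin (n + 1))}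

/-- The point `(0, w, y)`. -/
def traceVar {υ : Type} (w y : Ser υ) : Fin (n + 1) ⊕ Unit → Ser υ :=
  Sum.elim (Fin.lastCases w fun _ => 0) fun _ => y

theorem traceVar_const {υ : Type} {w y : Ser υ} (hw : constantCoeff w = 0)
    (hy : constantCoeff y = 0) (v : Fin (n + 1) ⊕ Unit) : constantCoeff (traceVar w y v) = 0 := by
  refine elim_const (fun j => ?_) (fun _ => hy) v
  refine Fin.lastCases ?_ (fun j => ?_) j <;> simp [hw]

theorem subst_traceVar {υ υ' : Type} [Finite υ] {a : υ → Ser υ'}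
    (ha : ∀ i, constantCoeff (a i) = 0) {w y : Ser υ} (hw : constantCoeff w = 0)
    (hy : constantCoeff y = 0) (f : Ser (Fin (n + 1) ⊕ Unit)) :
    subst a (subst (traceVar w y) f) = subst (traceVar (subst a w) (subst a y)) f := by
  rw [subst_subst (traceVar_const hw hy) ha]
  congr 1
  funext v
  rcases v with j | u
  · refine Fin.lastCases ?_ (fun j => ?_) j
    · simp [traceVar]
    · simp only [traceVar, Sum.elim_inl, Fin.lastCases_castSucc]
      exact subst_zero' ha
  · rfl

theorem atTau_subst_atSlope (r : ℂ) (f : Ser (Fin (n + 1) ⊕ Unit)) :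
    atTau (subst (atSlope (Fin.last n) r) f) =
      subst (traceVar (X (Sum.inr (Sum.inr ()))) (C r * X (Sum.inr (Sum.inr ())))) f := by
  rw [atTau, subst_subst (atSlope_const _ _) tauVar_const]
  have hX := subst_X (hs (tauVar_const (n := n))) (R := ℂ)
  congr 1
  funext v
  rcases v with j | u
  · rw [atSlope_inl, hX]
    refine Fin.lastCases ?_ (fun j => ?_) j <;> simp [traceVar]
  · rw [atSlope_inr, subst_mul (hs tauVar_const), subst_C', hX, tauVar_last]
    rfl

theorem pderiv_castSucc_subst_atSlope (r : ℂ) (k : Fin n) (f : Ser (Fin (n + 1) ⊕ Unit)) :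
    pderiv ℂ k.castSucc (subst (atSlope (Fin.last n) r) f) =
      subst (atSlope (Fin.last n) r) (pderiv ℂ (Sum.inl k.castSucc) f) := by
  classical
  rw [pderiv_subst (atSlope_const _ _), Fintype.sum_sum_type]
  simp [atSlope_inl, atSlope_inr, pderiv_X, Pi.single_apply]

theorem pderiv_last_subst_atSlope (r : ℂ) (f : Ser (Fin (n + 1) ⊕ Unit)) :
    pderiv ℂ (Fin.last n) (subst (atSlope (Fin.last n) r) f) =
      subst (atSlope (Fin.last n) r) (pderiv ℂ (Sum.inl (Fin.last n)) f) +
        C r * subst (atSlope (Fin.last n) r) (pderiv ℂ (Sum.inr ()) f) := by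
  classical
  rw [pderiv_subst (atSlope_const _ _), Fintype.sum_sum_type]
  simp [atSlope_inl, atSlope_inr, pderiv_X, Pi.single_apply]
  ring

theorem slice_subst_atSlope (r : ℂ) (f : Ser (Fin (n + 1) ⊕ Unit)) :
    slice (subst (atSlope (Fin.last n) r) f) = slice (subst (atSlope (Fin.last n) 0) f) := by
  have hX := subst_X (hs (sliceVar_const (n := n))) (R := ℂ)
  simp only [slice]
  rw [subst_subst (atSlope_const _ _) sliceVar_const, subst_subst (atSlope_const _ _) sliceVar_const]
  congr 1
  funext v
  rcases v with j | u
  · rfl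
  · simp only [atSlope_inr, subst_mul (hs (sliceVar_const (n := n))), hX, sliceVar_last, mul_zero]

/-- If H = F(z,w,rw), then H_w(z,0) is affine in r with coefficient F_y(z,0,0). Comparison with κD
shows where the y-derivative of F does not vanish. -/
theorem transverse_subst_atSlope_sub (r : ℂ) (f : Fin (n + 2) → Ser (Fin (n + 1) ⊕ Unit))
    (i : Fin (n + 2)) : transverse (fun i => subst (atSlope (Fin.last n) r) (f i)) i -
      transverse (fun i => subst (atSlope (Fin.last n) 0) (f i)) i =
        C r * slice (subst (atSlope (Fin.last n) 0) (pderiv ℂ (Sum.inr ()) (f i))) := by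
  have ha : ∀ f g : Ser (Fin (n + 1)), slice (f + g) = slice f + slice g :=
    fun f g => subst_add (hs sliceVar_const) f g
  have hm : ∀ (r : ℂ) (f : Ser (Fin (n + 1))), slice (C r * f) = C r * slice f := fun r f => by
    rw [slice, subst_mul (hs sliceVar_const), subst_C']; rfl
  simp only [transverse, pderiv_last_subst_atSlope, ha, hm, slice_subst_atSlope r, map_zero,
    zero_mul, add_zero, add_sub_cancel_left]

/-- If `F(z, w, y)` parametrizes the maps realizing given data by `y = r w` and its `y`-derivative
does not vanish to second order, then `r τ` is a function of the jet along `z = 0`. -/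
theorem exists_slope_of_pderiv_ne_zero {F : Fin (n + 2) → Ser (Fin (n + 1) ⊕ Unit)}
    {i : Fin (n + 2)} {k : Fin n} (hF0 : constantCoeff (pderiv ℂ (Sum.inl k.castSucc) (F i)) =
      Λ i k.castSucc)
    (hF : constantCoeff (pderiv ℂ (Sum.inr ()) (pderiv ℂ (Sum.inl k.castSucc) (F i))) ≠ 0) :
    ∃ y : Ser (PsiVar n), constantCoeff y = 0 ∧
      (∀ P, IsTame P → P _ (F i) → P _ y) ∧
      ∀ H r, Realizes Q ρ Λ H → constantCoeff Q = 0 →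
        H i = subst (atSlope (Fin.last n) r) (F i) →
        subst (basicPt Q Λ H) y = C r * X (Sum.inr (Sum.inr ())) := by
  classical
  set G := pderiv ℂ (Sum.inl k.castSucc) (F i) with hG
  let w : Ser (PsiVar n ⊕ Fin 1) := X (Sum.inl (zetaArg (Fin.last n)))
  let u : Ser (PsiVar n ⊕ Fin 1) := X (Sum.inr 0)
  have hw : constantCoeff w = 0 := by simp [w]
  have hu : constantCoeff u = 0 := by simp [u]
  have hpt := traceVar_const (n := n) hw hu
  -- The unknown u stands for rτ and solves F_{i,z_k}(0,τ,u) = ∂_kH_i(0,τ), the right side being a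
  -- constant plus an indeterminate of Ψ.
  let f : Fin 1 → Ser (PsiVar n ⊕ Fin 1) := fun _ =>
    subst (traceVar w u) G - C (Λ i k.castSucc) - X (Sum.inl (jetArg i k.castSucc))
  have hf' : ∀ v : Fin 1 → ℂ, (∀ i, ∑ j, constantCoeff (pderiv ℂ (Sum.inr j) (f i)) * v j = 0) →
      v = 0 := by
    intro v hv
    have h1 := hv 0
    simp only [f, map_sub, Finset.univ_unique, Fin.default_eq_zero, Finset.sum_singleton] at h1
    rw [pderiv_C, pderiv_X_of_ne (by simp), pderiv_subst hpt,
      Finset.sum_eq_single (Sum.inr ())] at h1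
    · rw [show traceVar w u (Sum.inr () : Fin (n + 1) ⊕ Unit) = X (Sum.inr 0) from rfl,
        pderiv_X_self, mul_one, constantCoeff_subst_zero hpt, map_zero, sub_zero, sub_zero] at h1
      funext j
      rw [Subsingleton.elim j 0]
      exact (mul_eq_zero.mp h1).resolve_left hF
    · rintro (j | j) _ hj
      · refine mul_eq_zero_of_right _ ?_
        simp only [traceVar, Sum.elim_inl]
        refine Fin.lastCases ?_ (fun j => ?_) j
        · rw [Fin.lastCases_last]; exact pderiv_X_of_ne (by simp)
        · rw [Fin.lastCases_castSucc, map_zero]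
      · exact absurd rfl hj
    · simp
  obtain ⟨y, hy, hsol, hP⟩ := exists_implicit_system f (fun j => by
    simp [f, constantCoeff_subst_zero hpt, hF0]) hf'
  refine ⟨y 0, hy 0, fun P hT hPF => hP P hT (fun j => ?_) 0, fun H r hH hQ hHr => ?_⟩
  · refine hT.sub (hT.sub (hT.comp hpt ?_ (hT.pderiv _ hPF)) (hT.const _)) (hT.var _)
    rintro (j | j)
    · refine Fin.lastCases ?_ (fun j => ?_) j
      · simp only [traceVar, Sum.elim_inl, Fin.lastCases_last]; exact hT.var _
      · simp only [traceVar, Sum.elim_inl, Fin.lastCases_castSucc]; exact hT.zero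
    · exact hT.var _
  · have hc := hH.basicPt_const hQ
    have hfe : ∀ b : Fin 1 → Ser (CRVar n), (∀ i, constantCoeff (b i) = 0) → ∀ j,
        subst (Sum.elim (basicPt Q Λ H) b) (f j) =
          subst (traceVar (X (Sum.inr (Sum.inr ()))) (b 0)) G - atTau (pderiv ℂ k.castSucc (H i)) := by
      intro b hb j
      have he := elim_const hc hb
      have hX := subst_X (hs he) (R := ℂ)
      rw [subst_sub (hs he), subst_sub (hs he), subst_C', hX, subst_traceVar he hw hu, hX, hX]
      have h1 : basicPt Q Λ H (jetArg i k.castSucc) =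
        atTau (pderiv ℂ k.castSucc (H i)) - C (Λ i k.castSucc) := rfl
      have h2 : basicPt Q Λ H (zetaArg (Fin.last n)) = X (Sum.inr (Sum.inr ())) := onZeta_last
      rw [Sum.elim_inl, Sum.elim_inl, Sum.elim_inr, h1, h2]
      ring
    have hb1 : ∀ j : Fin 1, constantCoeff (subst (basicPt Q Λ H) (y j)) = 0 := fun j => by
      rw [constantCoeff_subst_zero hc, hy]
    have hb2 : ∀ _ : Fin 1, constantCoeff (C r * X (Sum.inr (Sum.inr ())) : Ser (CRVar n)) = 0 :=
      fun _ => by simp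
    have := implicit_unique hf' hc hb1 hb2 (fun j => ?_) fun _ => ?_
    · exact congrFun this 0
    · have h1 := congrArg (subst (basicPt Q Λ H)) (hsol j)
      rw [subst_subst (elim_const X_const hy) hc, subst_zero' hc] at h1
      refine Eq.trans ?_ h1
      congr 1
      funext v
      rcases v with v | v
      · exact (subst_X (hs hc) (R := ℂ) v).symm
      · rfl
    · rw [hfe _ hb2 0, hHr, pderiv_castSucc_subst_atSlope, atTau_subst_atSlope, sub_self]

/-- `H(0, τ)` is a function of the arguments of the basic identity. -/
theorem exists_trace (hm : IsModel Q ρ Λ c) (hH : Realizes Q ρ Λ H) (j0 : Fin n)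
    {P : ∀ σ : Type, Ser σ → Prop} (hP : IsTame P) (hQ : P _ Q) (hρ : P _ ρ) :
    ∃ S : Fin (n + 2) → Ser (PsiVar n), (∀ i, constantCoeff (S i) = 0) ∧ (∀ i, P _ (S i)) ∧
      ∀ H', Realizes Q ρ Λ H' → ∀ i, subst (basicPt Q Λ H') (S i) = atTau (H' i) := by
  have h := hm.normal
  obtain ⟨D, hD0, ⟨i0, k0, hik⟩, hDP, hD⟩ := exists_direction hm hH j0
  obtain ⟨F, hFP, hF⟩ := exists_family hm hH j0 hD0 hDP
  have hH0 : ∀ i, H i = subst (atSlope (Fin.last n) 0) (F i) := fun i => by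
    have := hF H 0 hH (fun i => by simp) i
    rwa [map_zero] at this
  have hF0 : ∀ i, constantCoeff (F i) = 0 := fun i => by
    rw [← constantCoeff_subst_zero (atSlope_const (Fin.last n) 0), ← hH0, hH.const]
  obtain ⟨y, hy0, hyP, hy⟩ : ∃ y : Ser (PsiVar n), constantCoeff y = 0 ∧ P _ y ∧
      ∀ H', Realizes Q ρ Λ H' → ∃ r, (∀ i, H' i = subst (atSlope (Fin.last n) r) (F i)) ∧
        subst (basicPt Q Λ H') y = C r * X (Sum.inr (Sum.inr ())) := by
    -- If all maps share H_w(z,0), slope 0 serves them all and nothing has to be recovered.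
    -- Otherwise a second map with κ ≠ 0 shows that the mixed derivative of F needed for the slope
    -- is nonzero.
    by_cases hall : ∀ H', Realizes Q ρ Λ H' → ∀ i, transverse H' i = transverse H i
    · refine ⟨0, map_zero _, hP.zero, fun H' hH' => ⟨0, fun i => ?_, ?_⟩⟩
      · have := hF H' 0 hH' (fun i => by simp [hall H' hH' i]) i
        rwa [map_zero] at this
      · rw [subst_zero' (hH'.basicPt_const h.const), map_zero, zero_mul]
    · push Not at hall
      obtain ⟨H1, hH1, i1, hi1⟩ := hall
      obtain ⟨κ, hκ⟩ := hD H1 hH1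
      have hκ0 : κ ≠ 0 := by
        rintro rfl
        exact hi1 (by simp [hκ])
      set r := starRingEnd ℂ κ
      have hH1F : H1 = fun i => subst (atSlope (Fin.last n) r) (F i) := funext (hF H1 κ hH1 hκ)
      have hHF : H = fun i => subst (atSlope (Fin.last n) 0) (F i) := funext hH0
      have hkey := transverse_subst_atSlope_sub r F i0
      rw [← hH1F, ← hHF, hκ, add_sub_cancel_left] at hkey
      have h1 := congrArg (fun f => constantCoeff (pderiv ℂ k0 f)) hkey
      simp only [Derivation.leibniz, pderiv_C, mul_zero, add_zero, smul_eq_mul, map_mul,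
        constantCoeff_C, ← slice_pderiv, constantCoeff_slice, pderiv_castSucc_subst_atSlope,
        constantCoeff_subst_zero (atSlope_const (Fin.last n) (0 : ℂ))] at h1
      obtain ⟨y, hy0, hyP, hy⟩ := exists_slope_of_pderiv_ne_zero (Q := Q) (ρ := ρ) (Λ := Λ) (F := F)
        (i := i0) (k := k0) (by
          rw [← hH.deriv, hH0, pderiv_castSucc_subst_atSlope,
            constantCoeff_subst_zero (atSlope_const (Fin.last n) (0 : ℂ))]) (by
          rw [pderiv_comm]
          intro h0
          rw [h0, mul_zero] at h1
          exact mul_ne_zero hκ0 hik h1)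
      refine ⟨y, hy0, hyP P hP (hFP P hP hQ hρ i0), fun H' hH' => ?_⟩
      obtain ⟨κ', hκ'⟩ := hD H' hH'
      exact ⟨_, hF H' κ' hH' hκ', hy H' _ hH' h.const (hF H' κ' hH' hκ' i0)⟩
  have hw : constantCoeff (X (zetaArg (Fin.last n)) : Ser (PsiVar n)) = 0 := by simp
  have hpt := traceVar_const (n := n) hw hy0
  refine ⟨fun i => subst (traceVar (X (zetaArg (Fin.last n))) y) (F i), fun i => ?_, fun i => ?_,
    fun H' hH' i => ?_⟩
  · rw [constantCoeff_subst_zero hpt, hF0]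
  · refine hP.comp hpt ?_ (hFP P hP hQ hρ i)
    rintro (j | j)
    · refine Fin.lastCases ?_ (fun j => ?_) j
      · simp only [traceVar, Sum.elim_inl, Fin.lastCases_last]; exact hP.var _
      · simp only [traceVar, Sum.elim_inl, Fin.lastCases_castSucc]; exact hP.zero
    · exact hyP
  · obtain ⟨r, hr, hry⟩ := hy H' hH'
    have hc := hH'.basicPt_const h.const
    rw [subst_traceVar hc hw hy0, hry, subst_X (hs hc), hr, atTau_subst_atSlope]
    congr 2
    exact onZeta_last

/-- The basic identity, with a function that depends only on the hypersurfaces and the Jacobian. -/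
theorem exists_basic_identity (h : IsNormal Q) {P : ∀ σ : Type, Ser σ → Prop}
    (hP : IsTame P) (hQ : P _ Q) (hρ : P _ ρ) :
    ∃ Ψ : Fin (n + 2) → Ser (PsiVar n), (∀ i, P _ (Ψ i)) ∧ ∀ H c, IsModel Q ρ Λ c →
      Realizes Q ρ Λ H → ∀ i, subst (onZ Q) (H i) = subst (basicPt Q Λ H) (Ψ i) := by
  by_cases hex : ∃ H c, IsModel Q ρ Λ c ∧ Realizes Q ρ Λ H
  · obtain ⟨H, c, hm, hH⟩ := hex
    -- Without variables z the hypersurface is w = τ, and H(Z) agrees on it with the argument H(ζ).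
    -- This is also the only use of that argument.
    rcases Nat.eq_zero_or_pos n with rfl | hn
    · refine ⟨fun i => X (Sum.inr (Sum.inr (Sum.inr (Sum.inl i)))), fun i => hP.var _,
        fun H' _ _ hH' i => ?_⟩
      rw [subst_X (hs (hH'.basicPt_const h.const))]
      have hQX : Q = X (Sum.inr (Sum.inr ())) := by
        have h1 := h.kill_z
        have : zSet 0 = ∅ := Finset.eq_empty_of_forall_notMem fun i hi => by
          obtain ⟨j, -⟩ := (mem_zSet i).mp hi
          exact j.elim0
        rwa [this, kill_empty] at h1
      have : onZ Q = onZeta := by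
        funext j
        refine Fin.lastCases ?_ (fun j => j.elim0) j
        rw [onZ_last, onZeta_last, hQX]
      rw [this]
      rfl
    · obtain ⟨S, hS0, hSP, hS⟩ := exists_trace hm hH ⟨0, hn⟩ hP hQ hρ
      obtain ⟨Ψ, hΨP, hΨ⟩ := exists_identity_of_trace hm hP hQ hρ hS0 hSP hS
      exact ⟨Ψ, hΨP, fun H' _ _ hH' => hΨ H' hH'⟩
  · exact ⟨fun _ => 0, fun _ => hP.zero, fun H' c hm hH' => absurd ⟨H', c, hm, hH'⟩ hex⟩

end Trace

/-- The smallest tame class that contains two given series. -/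
def TameClosure {σ τ : Type} (f : Ser σ) (g : Ser τ) (υ : Type) (φ : Ser υ) : Prop :=
  ∀ P, IsTame P → P σ f → P τ g → P υ φ

/-- Working in this closure yields one Ψ that is convergent or algebraic as soon as the data are,
instead of a separate Ψ for each regularity class. -/
theorem isTame_tameClosure {σ τ : Type} (f : Ser σ) (g : Ser τ) : IsTame (TameClosure f g) where
  const c _ hP _ _ := hP.const c
  var s _ hP _ _ := hP.var s
  add h h' P hP hf hg := hP.add (h P hP hf hg) (h' P hP hf hg)
  mul h h' P hP hf hg := hP.mul (h P hP hf hg) (h' P hP hf hg)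
  comp ha ha' h P hP hf hg := hP.comp ha (fun i => ha' i P hP hf hg) (h P hP hf hg)
  conj h P hP hf hg := hP.conj (h P hP hf hg)
  of_X_mul s _ h P hP hf hg := hP.of_X_mul s (h P hP hf hg)
  of_blowup hst h P hP hf hg := hP.of_blowup hst (h P hP hf hg)
  implicit h0 h1 h2 h P hP hf hg := hP.implicit h0 h1 h2 (h P hP hf hg)

end

end FormalCR

theorem propositionP (n : ℕ)
    (M : FormalCR.FormalHypersurface (Fin (n + 1)))
    (M' : FormalCR.FormalHypersurface (Fin (n + 2)))
    (hM : M.LeviNondegenerate) (hM' : M'.LeviNondegenerate)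
    (hnormal : M.InNormalCoordinates)
    (Λ : Matrix (Fin (n + 2)) (Fin (n + 1)) ℂ) :
    ∃ Ψ : Fin (n + 2) → MvPowerSeries (FormalCR.PsiVar n) ℂ,
      (∀ H : FormalCR.FormalMap (Fin (n + 1)) (Fin (n + 2)),
        H.MapsInto M M' → H.ConstantlyDegenerate M M' 1 → H.Transversal M M' →
          H.derivAtZero = Λ → FormalCR.BasicIdentity M Ψ H) ∧
      (M.RealAnalytic → M'.RealAnalytic → ∀ i, FormalCR.IsConvergent (Ψ i)) ∧
      (M.Algebraic → M'.Algebraic → ∀ i, FormalCR.IsAlgebraicSeries (Ψ i)) := by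
  open FormalCR in
  obtain ⟨Q, hQ, hMQ⟩ := hnormal
  obtain ⟨ρ, hρ, hρ0, hρP⟩ := exists_canonical M'
  obtain ⟨Ψ, hΨP, hΨ⟩ := exists_basic_identity (ρ := ρ) (Λ := Λ) hQ (isTame_tameClosure Q ρ)
    (fun _ _ hQ _ => hQ) (fun _ _ _ hρ => hρ)
  refine ⟨Ψ, fun H hH hdeg htr hΛ i => ?_, fun h h' i => ?_, fun h h' i => ?_⟩
  · subst hΛ
    have hR := realizes_of_degenerate hQ.const hQ.kill_z hMQ hH hdeg
      (ρ := ρ) (by rw [hρ]; exact Ideal.mem_span_singleton_self ρ)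
    obtain ⟨c, hc⟩ := isModel_of_transversal hM hM' hQ hMQ hρ hρ0 htr
    rw [hMQ, ← restrict_eq_zero_iff hQ.const, restrict_sub_psiArgs hQ.const, sub_eq_zero]
    exact hΨ H.toFun c hc hR i
  · exact hΨP i (fun _ => IsConvergent) isTame_isConvergent
      (isTame_isConvergent.of_normalFn hQ hMQ h) (hρP (fun _ => IsConvergent) isTame_isConvergent h')
  · exact hΨP i (fun _ => IsAlgebraicSeries) isTame_isAlgebraicSeries
      (isTame_isAlgebraicSeries.of_normalFn hQ hMQ h)
      (hρP (fun _ => IsAlgebraicSeries) isTame_isAlgebraicSeries h')
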